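/- **Proposition.** Let $n\ge 0$ and let $f:(\mathbb C^{n+1},0)\to(\mathbb C,0)$ be a holomorphic germ with an isolated singularity, let $J_f=(\partial f/\partial x_0,\dots,\partial f/\partial x_n)$, and let $g_1,\dots,g_\mu=1\in\mathcal O_{\mathbb C^{n+1},0}$ induce a $\mathbb C$-basis of the jacobian algebra $\mathcal O_{\mathbb C^{n+1},0}/J_f$. Let $F(x,u)=f(x)+\sum_{j=1}^{\mu}u_jg_j(x)$ be the corresponding miniversal deformation with base $S=(\mathbb C^\mu,0)$, let $\widetilde D\subset(\mathbb C^{n+1}\times S,0)$ be defined by $F=\partial F/\partial x_0=\dots=\partial F/\partial x_n=0$, and let $D\subset S$, the discriminant, be the image of $\widetilde D$ under the projection; thus $\mathcal O_{\widetilde D}=\mathcal O_{\mathbb C^{n+1}\times S,0}/(F,\partial F/\partial x_0,\dots,\partial F/\partial x_n)$ and $\mathcal O_D$ is the image of $\mathcal O_S$ in $\mathcal O_{\widetilde D}$. Let $\mathscr C=\{b\in\mathcal O_{\widetilde D}: b\,\mathcal O_{\widetilde D}\subset\mathcal O_D\}$ be the conductor of the normalisation $\widetilde D\to D$, and regard $\operatorname{Ext}^1_{\mathcal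 O_D}(\mathcal O_{\widetilde D},\mathcal O_{\widetilde D})$ as an $\mathcal O_{\widetilde D}$-module through the second argument. A Saito matrix is a $\mu\times\mu$ matrix $\chi=(\chi_{ij})$ over $\mathcal O_S$ such that the vector fields $\chi_i=\sum_j\chi_{ij}\,\partial/\partial u_j$ form an $\mathcal O_S$-basis of the module $\Theta_S(-\log D)$ of vector fields on $S$ tangent to $D$. Then: 1. $\operatorname{Ext}^1_{\mathcal O_D}(\mathcal O_{\widetilde D},\mathcal O_{\widetilde D})$ is annihilated by $\mathscr C$ and is a maximal Cohen–Macaulay module over $\mathcal O_{\widetilde D}/\mathscr C$. 2. Symmetric Saito matrices exist, and for every symmetric Saito matrix $\chi$ the $\mathcal O_{\widetilde D}$-module $\operatorname{Ext}^1_{\mathcal O_D}(\mathcal O_{\widetilde D},\mathcal O_{\widetilde D})$ is presented by the matrix $\widetilde\chi$ obtained from $\chi$ by deleting its last row and column, i.e. it is isomorphic to the cokernel of $\widetilde\chi:\mathcal O_{\widetilde D}^{\,\mu-1}\to\mathcal O_{\widetilde D}^{\,\mu-1}$. (If $\mu=1$, then $\mathcal O_{\widetilde D}/\mathscr C=0$,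 and the zero module over the zero ring counts as maximal Cohen–Macaulay.) -/

import Mathlib

open CategoryTheory

noncomputable section

/-! ### Convergent power series

`ConvSeries σ` is the ring `ℂ{z_i : i ∈ σ}` of convergent power series, that is, the ring of germs
at the origin of holomorphic functions on `ℂ^σ` (for finite `σ`). -/

/-- A power series is convergent if it converges absolutely on some polydisc of positive radius. -/
def IsConvergentSeries {σ : Type} (p : MvPowerSeries σ ℂ) : Prop :=
  ∃ r : ℝ, 0 < r ∧ Summable fun α : σ →₀ ℕ => ‖MvPowerSeries.coeff α p‖ * r ^ α.degree

theorem IsConvergentSeries.mono {σ : Type} {p : MvPowerSeries σ ℂ} {r s : ℝ} (hs : 0 < s)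
    (hsr : s ≤ r) (h : Summable fun α : σ →₀ ℕ => ‖MvPowerSeries.coeff α p‖ * r ^ α.degree) :
    Summable fun α : σ →₀ ℕ => ‖MvPowerSeries.coeff α p‖ * s ^ α.degree := by
  refine h.of_nonneg_of_le (fun α => by positivity) (fun α => ?_)
  gcongr

theorem IsConvergentSeries.of_finite {σ : Type} {p : MvPowerSeries σ ℂ} (s : Finset (σ →₀ ℕ))
    (h : ∀ α ∉ s, MvPowerSeries.coeff α p = 0) : IsConvergentSeries p :=
  ⟨1, one_pos, summable_of_ne_finset_zero (s := s) fun α hα => by simp [h α hα]⟩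

theorem IsConvergentSeries.add {σ : Type} {p q : MvPowerSeries σ ℂ} (hp : IsConvergentSeries p)
    (hq : IsConvergentSeries q) : IsConvergentSeries (p + q) := by
  obtain ⟨r, hr, hp⟩ := hp
  obtain ⟨s, hs, hq⟩ := hq
  have ht : 0 < min r s := lt_min hr hs
  refine ⟨min r s, ht, ((IsConvergentSeries.mono ht (min_le_left _ _) hp).add
    (IsConvergentSeries.mono ht (min_le_right _ _) hq)).of_nonneg_of_le
    (fun α => by positivity) (fun α => ?_)⟩
  rw [map_add, ← add_mul]
  gcongr
  exact norm_add_le _ _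

theorem IsConvergentSeries.mul_aux {σ : Type} [DecidableEq σ] {p q : MvPowerSeries σ ℂ} {t : ℝ} (ht : 0 ≤ t)
    (α : σ →₀ ℕ) : ‖MvPowerSeries.coeff α (p * q)‖ * t ^ α.degree ≤
      ∑ x ∈ Finset.HasAntidiagonal.antidiagonal α, (‖MvPowerSeries.coeff x.1 p‖ * t ^ x.1.degree) *
        (‖MvPowerSeries.coeff x.2 q‖ * t ^ x.2.degree) := by
  rw [MvPowerSeries.coeff_mul]
  refine (mul_le_mul_of_nonneg_right (norm_sum_le _ _) (pow_nonneg ht _)).trans ?_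
  rw [Finset.sum_mul]
  refine Finset.sum_le_sum fun x hx => le_of_eq ?_
  have h : α.degree = x.1.degree + x.2.degree := by
    rw [← map_add, Finset.HasAntidiagonal.mem_antidiagonal.1 hx]
  rw [h, pow_add, norm_mul]
  ring

theorem IsConvergentSeries.mul {σ : Type} {p q : MvPowerSeries σ ℂ} (hp : IsConvergentSeries p)
    (hq : IsConvergentSeries q) : IsConvergentSeries (p * q) := by
  obtain ⟨r, hr, hp⟩ := hp
  obtain ⟨s, hs, hq⟩ := hq
  obtain ⟨t, ht, htr, hts⟩ : ∃ t : ℝ, 0 < t ∧ t ≤ r ∧ t ≤ s :=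
    ⟨min r s, lt_min hr hs, min_le_left _ _, min_le_right _ _⟩
  have hpos (u : MvPowerSeries σ ℂ) (α : σ →₀ ℕ) :
      0 ≤ ‖MvPowerSeries.coeff α u‖ * t ^ α.degree :=
    mul_nonneg (norm_nonneg _) (pow_nonneg ht.le _)
  classical
  have h := Summable.mul_of_nonneg (IsConvergentSeries.mono ht htr hp)
    (IsConvergentSeries.mono ht hts hq) (hpos p) (hpos q)
  have h' := summable_sum_mul_antidiagonal_of_summable_mul (A := σ →₀ ℕ)
    (f := fun α => ‖MvPowerSeries.coeff α p‖ * t ^ α.degree)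
    (g := fun α => ‖MvPowerSeries.coeff α q‖ * t ^ α.degree) h
  exact ⟨t, ht, h'.of_nonneg_of_le (hpos (p * q)) (IsConvergentSeries.mul_aux ht.le)⟩

/-- The `ℂ`-algebra of convergent power series. -/
def convSubalgebra (σ : Type) : Subalgebra ℂ (MvPowerSeries σ ℂ) where
  carrier := {p | IsConvergentSeries p}
  mul_mem' := IsConvergentSeries.mul
  add_mem' := IsConvergentSeries.add
  algebraMap_mem' c := by
    classical
    refine IsConvergentSeries.of_finite {0} fun α hα => ?_
    rw [MvPowerSeries.algebraMap_apply, MvPowerSeries.coeff_C]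
    simp_all

abbrev ConvSeries (σ : Type) : Type := convSubalgebra σ

namespace ConvSeries

/-- The value at the origin. -/
def constCoeff {σ : Type} (p : ConvSeries σ) : ℂ := MvPowerSeries.constantCoeff p.1

/-- The coordinate function `z_i`. -/
def X {σ : Type} (i : σ) : ConvSeries σ :=
  ⟨MvPowerSeries.X i, by
    classical
    refine IsConvergentSeries.of_finite {Finsupp.single i 1} fun α hα => ?_
    rw [MvPowerSeries.coeff_X, if_neg (by simpa using hα)]⟩

/-- The partial derivative `∂/∂z_i`. -/
def pderiv {σ : Type} (i : σ) (p : ConvSeries σ) : ConvSeries σ :=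
  ⟨MvPowerSeries.pderiv ℂ i p.1, by
    obtain ⟨r, hr, hp⟩ := p.2
    refine ⟨r / 2, by positivity, ((hp.comp_injective
      (add_left_injective (Finsupp.single i 1))).mul_left (2 / r)).of_nonneg_of_le
      (fun α => by positivity) (fun α => ?_)⟩
    have h1 : ((α i : ℝ) + 1) ≤ 2 ^ (α.degree + 1) := by
      have h2 : α i + 1 ≤ α.degree + 1 := Nat.succ_le_succ (Finsupp.le_degree i α)
      exact_mod_cast h2.trans (Nat.lt_two_pow_self).le
    have h3 : ‖((α i : ℂ) + 1)‖ = (α i : ℝ) + 1 := by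
      rw [← Nat.cast_succ, Complex.norm_natCast, Nat.cast_succ]
    simp only [Function.comp_apply]
    rw [MvPowerSeries.coeff_pderiv, norm_mul, h3, map_add, Finsupp.degree_single]
    calc ‖MvPowerSeries.coeff (α + Finsupp.single i 1) p.1‖ * ((α i : ℝ) + 1) * (r / 2) ^ α.degree
        ≤ ‖MvPowerSeries.coeff (α + Finsupp.single i 1) p.1‖ * 2 ^ (α.degree + 1)
            * (r / 2) ^ α.degree := by gcongr
      _ = 2 / r * (‖MvPowerSeries.coeff (α + Finsupp.single i 1) p.1‖ * r ^ (α.degree + 1)) := by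
          rw [div_pow, pow_succ, pow_succ]
          field_simp⟩

/-- Regard a function of the variables `σ` as a function of the larger set of variables `τ`
(pull-back along the coordinate projection `ℂ^τ → ℂ^σ`). -/
def rename {σ τ : Type} (e : σ ↪ τ) : ConvSeries σ →ₐ[ℂ] ConvSeries τ :=
  AlgHom.codRestrict ((MvPowerSeries.rename (R := ℂ) e).comp (convSubalgebra σ).val)
    (convSubalgebra τ) (by
      rintro ⟨p, r, hr, hp⟩
      refine ⟨r, hr, ?_⟩
      refine ((Finsupp.embDomain_injective e).summable_iff ?_).1 (hp.congr fun α => ?_)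
      · intro x hx
        have : MvPowerSeries.coeff x (MvPowerSeries.rename (R := ℂ) e p) = 0 := by
          refine MvPowerSeries.coeff_rename_eq_zero _ _ ?_
          rintro ⟨y, rfl⟩
          exact hx ⟨y, Finsupp.embDomain_eq_mapDomain e y⟩
        simp [this]
      · have h1 : (Finsupp.embDomain e α).degree = α.degree := by
          rw [Finsupp.embDomain_eq_mapDomain, Finsupp.degree_mapDomain]
        have h2 := MvPowerSeries.coeff_embDomain_rename e p α
        simp only [Function.comp_apply, h1]
        exact congrArg (fun c : ℂ => ‖c‖ * r ^ α.degree) h2.symm)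

/-- The jacobian ideal `(∂f/∂x_0, …, ∂f/∂x_n)`. -/
def jacobianIdeal {σ : Type} (f : ConvSeries σ) : Ideal (ConvSeries σ) :=
  Ideal.span (Set.range fun i => pderiv i f)

end ConvSeries

/-! ### The deformation, its critical space and its discriminant

Below `ι` indexes the coordinates `x` of the ambient space of the singularity and `κ` the
coordinates `u` of the base `S` of the deformation. -/

open ConvSeries in
/-- The deformation `F(x,u) = f(x) + ∑ j, u_j g_j(x)`. -/
def deformation {ι κ : Type} [Fintype κ] (f : ConvSeries ι) (g : κ → ConvSeries ι) :
    ConvSeries (ι ⊕ κ) :=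
  rename .inl f + ∑ j, X (.inr j) * rename .inl (g j)

section Discriminant

variable {ι κ : Type} (F : ConvSeries (ι ⊕ κ))

/-- The ideal of `D̃ = {∂F/∂x_i = 0 for all i, F = 0}`. -/
def criticalZeroIdeal : Ideal (ConvSeries (ι ⊕ κ)) :=
  Ideal.span (Set.range fun i : ι => ConvSeries.pderiv (.inl i) F) ⊔ Ideal.span {F}

/-- The ring `O_D̃`. -/
def DTildeRing : Type := ConvSeries (ι ⊕ κ) ⧸ criticalZeroIdeal F

instance : CommRing (DTildeRing F) :=
  inferInstanceAs (CommRing (ConvSeries (ι ⊕ κ) ⧸ criticalZeroIdeal F))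

/-- The pull-back `O_S → O_D̃` along the projection `(x, u) ↦ u`. -/
def pullbackToDTilde : ConvSeries κ →+* DTildeRing F :=
  (Ideal.Quotient.mk (criticalZeroIdeal F)).comp
    (ConvSeries.rename (Function.Embedding.inr : κ ↪ ι ⊕ κ)).toRingHom

/-- The ideal of the discriminant `D`, the image of `D̃` in `S`: a function vanishes on `D` exactly
if its pull-back to `D̃` vanishes. -/
def discriminantIdeal : Ideal (ConvSeries κ) := RingHom.ker (pullbackToDTilde F)

/-- The ring `O_D`. -/
def DRing : Type := ConvSeries κ ⧸ discriminantIdeal F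

instance : CommRing (DRing F) :=
  inferInstanceAs (CommRing (ConvSeries κ ⧸ discriminantIdeal F))

/-- `O_D̃` as an algebra over `O_D`, by pull-back of functions. -/
instance : Algebra (DRing F) (DTildeRing F) :=
  (RingHom.kerLift (pullbackToDTilde F)).toAlgebra

/-- The module `Θ_S(-log D)` of vector fields `∑ j, a_j ∂/∂u_j` on `S` which are tangent to `D`,
i.e. which map the ideal of `D` to itself; a vector field is given by its coefficients. -/
def logVectorFields [Fintype κ] : Submodule (ConvSeries κ) (κ → ConvSeries κ) where
  carrier := {a | ∀ h ∈ discriminantIdeal F,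
    ∑ j, a j * ConvSeries.pderiv j h ∈ discriminantIdeal F}
  zero_mem' h _ := by simp
  add_mem' {a b} ha hb h hh := by
    simpa [add_mul, Finset.sum_add_distrib] using add_mem (ha h hh) (hb h hh)
  smul_mem' c a ha h hh := by
    simpa [mul_assoc, Finset.mul_sum] using Ideal.mul_mem_left _ c (ha h hh)

/-- `χ` is a Saito matrix of `Θ_S(-log D)`: the vector fields `χ_i = ∑ j, χ_ij ∂/∂u_j` given by its
rows form an `O_S`-basis of `Θ_S(-log D)`. -/
structure IsSaitoMatrix [Fintype κ] (χ : Matrix κ κ (ConvSeries κ)) : Prop where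
  linearIndependent : LinearIndependent (ConvSeries κ) χ.row
  span_eq : Submodule.span (ConvSeries κ) (Set.range χ.row) = logVectorFields F

end Discriminant

/-! ### Commutative algebra -/

/-- The conductor of `A → B`, as an ideal of `B`: the annihilator of `B / A`. -/
def conductorIdeal (A B : Type) [CommRing A] [CommRing B] [Algebra A B] : Ideal B where
  carrier := {b | ∀ c : B, b * c ∈ (algebraMap A B).range}
  zero_mem' c := by simp
  add_mem' {a b} ha hb c := by rw [add_mul]; exact add_mem (ha c) (hb c)
  smul_mem' a b hb c := by
    have := hb (a * c)
    rwa [← mul_assoc, mul_comm b a] at this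

/-- The group `Ext^k_A(B, B)` for an `A`-algebra `B`. -/
def SelfExt (A B : Type) [CommRing A] [CommRing B] [Algebra A B] (k : ℕ) : Type :=
  Abelian.Ext (ModuleCat.of A B) (ModuleCat.of A B) k

section SelfExt

variable (A B : Type) [CommRing A] [CommRing B] [Algebra A B] (k : ℕ)

instance : AddCommGroup (SelfExt A B k) :=
  inferInstanceAs (AddCommGroup (Abelian.Ext (ModuleCat.of A B) (ModuleCat.of A B) k))

/-- Multiplication by `b` as an `A`-linear endomorphism of `B`. -/
def mulEnd (b : B) : ModuleCat.of A B ⟶ ModuleCat.of A B :=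
  ModuleCat.ofHom (LinearMap.mulLeft A b)

/-- `Ext^k_A(B, B)` is a `B`-module through functoriality in the second argument. -/
instance : Module B (SelfExt A B k) where
  smul b e := Abelian.Ext.comp (e : Abelian.Ext (ModuleCat.of A B) (ModuleCat.of A B) k)
    (Abelian.Ext.mk₀ (mulEnd A B b)) (add_zero k)
  one_smul e := by
    have : mulEnd A B 1 = 𝟙 _ := by ext x; simp [mulEnd]
    change Abelian.Ext.comp _ (Abelian.Ext.mk₀ (mulEnd A B 1)) _ = _
    rw [this]
    exact Abelian.Ext.comp_mk₀_id _
  mul_smul a b e := by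
    have : mulEnd A B (a * b) = mulEnd A B b ≫ mulEnd A B a := by
      ext x; simp [mulEnd]
    change Abelian.Ext.comp _ (Abelian.Ext.mk₀ (mulEnd A B (a * b))) _ =
      Abelian.Ext.comp (Abelian.Ext.comp _ (Abelian.Ext.mk₀ (mulEnd A B b)) (add_zero k))
        (Abelian.Ext.mk₀ (mulEnd A B a)) (add_zero k)
    rw [this, ← Abelian.Ext.mk₀_comp_mk₀]
    exact (Abelian.Ext.comp_assoc _ _ _ (add_zero k) (add_zero 0) (by simp)).symm
  smul_zero b := Abelian.Ext.zero_comp (X := ModuleCat.of A B) (n := k) _ _ _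
  smul_add b e e' := Abelian.Ext.add_comp
    (e : Abelian.Ext (ModuleCat.of A B) (ModuleCat.of A B) k) e' _ (add_zero k)
  add_smul a b e := by
    have : mulEnd A B (a + b) = mulEnd A B a + mulEnd A B b := by
      ext x; simp [mulEnd, add_mul]
    change Abelian.Ext.comp _ (Abelian.Ext.mk₀ (mulEnd A B (a + b))) _ = _
    rw [this, Abelian.Ext.mk₀_add]
    exact Abelian.Ext.comp_add _ _ _ _
  zero_smul e := by
    have : mulEnd A B 0 = 0 := by ext x; simp [mulEnd]
    change Abelian.Ext.comp _ (Abelian.Ext.mk₀ (mulEnd A B 0)) _ = _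
    rw [this, Abelian.Ext.mk₀_zero]
    exact Abelian.Ext.comp_zero _ _ _ _ _

end SelfExt

/-- A module `M` over a (Noetherian) ring `R` is maximal Cohen–Macaulay if it is finitely generated
and, at every maximal ideal `𝔪`, its depth equals the dimension `ht 𝔪` of `R_𝔪`, i.e. there is an
`M`-regular sequence of length `ht 𝔪` in `𝔪`. (For `R` local, `𝔪` is the maximal ideal and
`ht 𝔪 = dim R`; over the zero ring the zero module is maximal Cohen–Macaulay.) -/
def IsMaximalCohenMacaulay (R M : Type) [CommRing R] [AddCommGroup M] [Module R M] : Prop :=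
  Module.Finite R M ∧ ∀ 𝔪 : Ideal R, 𝔪.IsMaximal →
    ∃ rs : List R, (∀ r ∈ rs, r ∈ 𝔪) ∧ RingTheory.Sequence.IsRegular M rs ∧
      (rs.length : ℕ∞) = 𝔪.height

/-- The cokernel of a matrix, i.e. the `R`-module presented by the matrix
(generators: rows, relations: columns). -/
abbrev MatrixCokernel {R : Type} [CommRing R] {p q : Type} [Fintype p] [Fintype q]
    (A : Matrix p q R) : Type :=
  (p → R) ⧸ LinearMap.range A.mulVecLin

end

/-! Let C be the ring of the relative critical space {∂F/∂x_i = 0}. Its equations together with the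
u_j are a system of parameters of the regular ring ℂ{x,u}, so they form a regular sequence. With
Weierstrass finiteness and Nakayama's lemma this makes C free over O_S with basis the g_j
(`span_relative_eq_top`, `linearIndependent_relative`). The differentials of F and the ∂F/∂x_i at
the origin are independent (`linearIndependent_linearPart`). Hence D̃ is smooth, O_D̃ = C/FC is a
Cohen–Macaulay domain of dimension at most μ-1, and F is a nonzerodivisor on C.

Suppose h ∈ O_S vanishes on D, and write h = ∑ a_i ∂F/∂x_i + bF. The vector field ∑ a_i ∂/∂x_i
preserves the ideal of D̃ and is O_S-linear. It induces a derivation of a domain integral over O_S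
in characteristic zero, which must vanish. So all a_i vanish on D̃, and ∂h/∂u_j ≡ b g_j there. Two
facts follow. First, Θ_S(-log D) is the kernel of O_S^μ → O_D̃, a ↦ ∑ a_j g_j
(`mem_logVectorFields_iff`), so the rows of a Saito matrix are the relations between the generators
g_j of O_D̃. Second, b lies in the conductor, and b ≠ 0 for suitable h.

Symmetric Saito matrices come from duality. The jacobian algebra is a complete intersection, so its
socle is cyclic and it carries a nondegenerate form. The form lifts to a perfect form on C, for
which multiplication by F is self-adjoint (`exists_isSymm_matrix`).

Now let K be the module of relations over O_D, generated by the rows χ_i. Then Ext¹ is Hom(K, O_D̃)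
modulo restrictions of homomorphisms from the free module. A nonzero conductor element yields an
approximate inverse of χ (`exists_of_mem_conductor`), from which every relation between the rows is
c_μ·(g_1,…,g_μ). So a homomorphism K → O_D̃ amounts to values w_i with ∑ g_i w_i = 0, and since g_μ
= 1 the first μ-1 of them are arbitrary. Eliminating the last column by ∑_j χ_ij g_j = 0 identifies
the restrictions with the image of χ̃. This gives the presentation.

The approximate inverse also yields Xχ̃ = b for every b in the conductor. Thus the conductor
annihilates coker χ̃, and det χ̃ ≠ 0. The cokernel of an injective square matrix has depth at least
dim O_D̃ - 1 (`isWeaklyRegular_matrixCokernel`), which suffices over the quotient by the nonzero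
conductor. If det χ̃ is a unit, the conductor is the whole ring.

The required facts about convergent power series (locality, Noetherianity, finiteness over the base)
all come from one division theorem in weighted ℓ¹-norms, `exists_division`. -/

noncomputable section

/-! ### Weighted norms of power series -/

namespace MvPowerSeries

open scoped ENNReal NNReal MvPowerSeries.WithPiTopology

variable {σ : Type}

/-- The value of the monomial `x^α` at the polyradius `ρ`. -/
def weight (ρ : σ → ℝ≥0) (α : σ →₀ ℕ) : ℝ≥0∞ := α.prod fun i k => (ρ i : ℝ≥0∞) ^ k

theorem weight_add (ρ : σ → ℝ≥0) (α β : σ →₀ ℕ) :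
    weight ρ (α + β) = weight ρ α * weight ρ β :=
  Finsupp.prod_add_index' (fun _ => pow_zero _) (fun _ _ _ => pow_add _ _ _)

@[simp] theorem weight_zero (ρ : σ → ℝ≥0) : weight ρ 0 = 1 := Finsupp.prod_zero_index

theorem weight_single (ρ : σ → ℝ≥0) (i : σ) (k : ℕ) :
    weight ρ (Finsupp.single i k) = (ρ i : ℝ≥0∞) ^ k :=
  Finsupp.prod_single_index (pow_zero _)

theorem weight_ne_top (ρ : σ → ℝ≥0) (α : σ →₀ ℕ) : weight ρ α ≠ ⊤ :=
  ENNReal.prod_ne_top fun _ _ => ENNReal.pow_ne_top ENNReal.coe_ne_top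

theorem weight_ne_zero {ρ : σ → ℝ≥0} (hρ : ∀ i, 0 < ρ i) (α : σ →₀ ℕ) : weight ρ α ≠ 0 :=
  Finset.prod_ne_zero_iff.2 fun i _ => pow_ne_zero _ (by simpa using (hρ i).ne')

theorem weight_mono {ρ ρ' : σ → ℝ≥0} (h : ∀ i, ρ i ≤ ρ' i) (α : σ →₀ ℕ) :
    weight ρ α ≤ weight ρ' α :=
  Finset.prod_le_prod' fun i _ => pow_le_pow_left' (by exact_mod_cast h i) _

theorem weight_const (r : ℝ≥0) (α : σ →₀ ℕ) : weight (fun _ => r) α = (r : ℝ≥0∞) ^ α.degree := by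
  rw [weight, Finsupp.prod, Finset.prod_pow_eq_pow_sum, Finsupp.degree_apply]

/-- The weighted `ℓ¹`-norm of a power series at the polyradius `ρ`. -/
def wnorm (ρ : σ → ℝ≥0) (p : MvPowerSeries σ ℂ) : ℝ≥0∞ := ∑' α, ‖coeff α p‖ₑ * weight ρ α

theorem enorm_coeff_mul_weight_le (ρ : σ → ℝ≥0) (p : MvPowerSeries σ ℂ) (α : σ →₀ ℕ) :
    ‖coeff α p‖ₑ * weight ρ α ≤ wnorm ρ p :=
  ENNReal.le_tsum (f := fun α => ‖coeff α p‖ₑ * weight ρ α) α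

theorem wnorm_mono {ρ ρ' : σ → ℝ≥0} (h : ∀ i, ρ i ≤ ρ' i) (p : MvPowerSeries σ ℂ) :
    wnorm ρ p ≤ wnorm ρ' p :=
  ENNReal.tsum_le_tsum fun α => mul_le_mul_right (weight_mono h α) _

@[simp] theorem wnorm_zero (ρ : σ → ℝ≥0) : wnorm ρ (0 : MvPowerSeries σ ℂ) = 0 := by simp [wnorm]

theorem wnorm_neg (ρ : σ → ℝ≥0) (p : MvPowerSeries σ ℂ) : wnorm ρ (-p) = wnorm ρ p := by
  simp [wnorm]

theorem wnorm_add_le (ρ : σ → ℝ≥0) (p q : MvPowerSeries σ ℂ) :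
    wnorm ρ (p + q) ≤ wnorm ρ p + wnorm ρ q := by
  rw [wnorm, wnorm, wnorm, ← ENNReal.tsum_add]
  refine ENNReal.tsum_le_tsum fun α => ?_
  rw [← add_mul, map_add]
  exact mul_le_mul_left (enorm_add_le _ _) _

theorem wnorm_sum_le {ι : Type} (ρ : σ → ℝ≥0) (s : Finset ι) (p : ι → MvPowerSeries σ ℂ) :
    wnorm ρ (∑ i ∈ s, p i) ≤ ∑ i ∈ s, wnorm ρ (p i) :=
  Finset.le_sum_of_subadditive _ (wnorm_zero ρ).le (wnorm_add_le ρ) s p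

theorem wnorm_mul_le (ρ : σ → ℝ≥0) (p q : MvPowerSeries σ ℂ) :
    wnorm ρ (p * q) ≤ wnorm ρ p * wnorm ρ q := by
  classical
  have key : wnorm ρ p * wnorm ρ q =
      ∑' x : Σ α : σ →₀ ℕ, Finset.HasAntidiagonal.antidiagonal α,
        (‖coeff x.2.1.1 p‖ₑ * weight ρ x.2.1.1) * (‖coeff x.2.1.2 q‖ₑ * weight ρ x.2.1.2) := by
    refine Eq.trans ?_ (Finset.HasAntidiagonal.sigmaAntidiagonalEquivProd.tsum_eq
      fun x : (σ →₀ ℕ) × (σ →₀ ℕ) =>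
        (‖coeff x.1 p‖ₑ * weight ρ x.1) * (‖coeff x.2 q‖ₑ * weight ρ x.2)).symm
    rw [ENNReal.tsum_prod', wnorm, wnorm, ← ENNReal.tsum_mul_right]
    exact tsum_congr fun α => ENNReal.tsum_mul_left.symm
  rw [key, ENNReal.tsum_sigma']
  refine ENNReal.tsum_le_tsum fun α => ?_
  rw [coeff_mul, tsum_fintype, Finset.univ_eq_attach,
    Finset.sum_attach _ (fun x : (σ →₀ ℕ) × (σ →₀ ℕ) =>
      (‖coeff x.1 p‖ₑ * weight ρ x.1) * (‖coeff x.2 q‖ₑ * weight ρ x.2))]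
  refine (mul_le_mul_left (enorm_sum_le _ _) _).trans ?_
  rw [Finset.sum_mul]
  refine Finset.sum_le_sum fun x hx => le_of_eq ?_
  rw [← Finset.HasAntidiagonal.mem_antidiagonal.1 hx, weight_add, enorm_mul]
  ring

theorem wnorm_monomial (ρ : σ → ℝ≥0) (α : σ →₀ ℕ) (c : ℂ) :
    wnorm ρ (monomial α c) = ‖c‖ₑ * weight ρ α := by
  classical
  rw [wnorm, tsum_eq_single α]
  · rw [coeff_monomial_same]
  · intro β hβ
    rw [coeff_monomial_ne hβ]
    simp

/-- Each coefficient is bounded by the norm divided by the weight of its monomial, which is nonzero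
because the radii are positive. -/
theorem summable_of_tsum_wnorm_ne_top {ρ : σ → ℝ≥0} (hρ : ∀ i, 0 < ρ i)
    {s : ℕ → MvPowerSeries σ ℂ} (h : ∑' n, wnorm ρ (s n) ≠ ⊤) : Summable s := by
  rw [WithPiTopology.summable_iff_summable_coeff]
  intro α
  refine Summable.of_enorm ?_
  have h1 : (∑' n, ‖coeff α (s n)‖ₑ) * weight ρ α ≠ ⊤ := by
    rw [← ENNReal.tsum_mul_right]
    exact ne_top_of_le_ne_top h
      (ENNReal.tsum_le_tsum fun n => enorm_coeff_mul_weight_le ρ (s n) α)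
  exact fun h2 => h1 (by rw [h2, ENNReal.top_mul (weight_ne_zero hρ α)])

theorem wnorm_tsum_le (ρ : σ → ℝ≥0) {s : ℕ → MvPowerSeries σ ℂ} (h : Summable s) :
    wnorm ρ (∑' n, s n) ≤ ∑' n, wnorm ρ (s n) := by
  rw [show ∑' n, wnorm ρ (s n) = ∑' n, ∑' α, ‖coeff α (s n)‖ₑ * weight ρ α from rfl,
    ENNReal.tsum_comm]
  refine ENNReal.tsum_le_tsum fun α => ?_
  rw [ENNReal.tsum_mul_right]
  refine mul_le_mul_left ?_ _
  have := (WithPiTopology.hasSum_iff_hasSum_coeff (R := ℂ)).1 h.hasSum α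
  rw [← this.tsum_eq]
  exact enorm_tsum_le_tsum_enorm

/-! ### Division with remainder -/

section Division

variable {L : Type} (α : L → σ →₀ ℕ)

/-- A choice, for every exponent, of one of the exponents `α l` below it, if there is one. -/
def divisor (β : σ →₀ ℕ) : Option L :=
  open Classical in if h : ∃ l, α l ≤ β then some h.choose else none

theorem le_of_divisor_eq_some {β : σ →₀ ℕ} {l : L} (h : divisor α β = some l) : α l ≤ β := by
  classical
  unfold divisor at h
  split_ifs at h with h1
  exact Option.some_injective _ h ▸ h1.choose_spec

theorem divisor_eq_none_iff {β : σ →₀ ℕ} : divisor α β = none ↔ ∀ l, ¬ α l ≤ β := by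
  classical
  unfold divisor
  split_ifs with h1
  · simpa using h1
  · simpa using h1

/-- The quotients of the division by the monomials with exponents `α l`. -/
def monomialQuotient [DecidableEq L] (l : L) (p : MvPowerSeries σ ℂ) : MvPowerSeries σ ℂ :=
  fun γ => if divisor α (γ + α l) = some l then coeff (γ + α l) p else 0

/-- The remainder of the division by the monomials with exponents `α l`. -/
def monomialRemainder (p : MvPowerSeries σ ℂ) : MvPowerSeries σ ℂ :=
  fun γ => if divisor α γ = none then coeff γ p else 0

theorem coeff_monomialQuotient [DecidableEq L] (l : L) (p : MvPowerSeries σ ℂ) (γ : σ →₀ ℕ) :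
    coeff γ (monomialQuotient α l p) =
      if divisor α (γ + α l) = some l then coeff (γ + α l) p else 0 := rfl

theorem coeff_monomialRemainder (p : MvPowerSeries σ ℂ) (γ : σ →₀ ℕ) :
    coeff γ (monomialRemainder α p) = if divisor α γ = none then coeff γ p else 0 := rfl

theorem sum_monomialQuotient_add_monomialRemainder [DecidableEq L] [Fintype L] (p : MvPowerSeries σ ℂ) :
    ∑ l, monomialQuotient α l p * monomial (α l) 1 + monomialRemainder α p = p := by
  classical
  ext β
  rw [map_add, map_sum, coeff_monomialRemainder]
  have h (l : L) : coeff β (monomialQuotient α l p * monomial (α l) 1) =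
      if divisor α β = some l then coeff β p else 0 := by
    rw [coeff_mul_monomial, mul_one, coeff_monomialQuotient]
    by_cases h1 : α l ≤ β
    · rw [if_pos h1, tsub_add_cancel_of_le h1]
    · rw [if_neg h1, if_neg fun h2 => h1 (le_of_divisor_eq_some α h2)]
  simp only [h]
  cases h2 : divisor α β <;> simp

/-- Every monomial of `p` goes into exactly one quotient or into the remainder, so no weight is
counted twice. -/
theorem wnorm_monomialQuotient_add_le [DecidableEq L] [Fintype L] (ρ : σ → ℝ≥0) (p : MvPowerSeries σ ℂ) :
    ∑ l, wnorm ρ (monomialQuotient α l p) * weight ρ (α l) + wnorm ρ (monomialRemainder α p) ≤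
      wnorm ρ p := by
  classical
  have h (l : L) : wnorm ρ (monomialQuotient α l p) * weight ρ (α l) ≤
      ∑' β, if divisor α β = some l then ‖coeff β p‖ₑ * weight ρ β else 0 := by
    rw [wnorm, ← ENNReal.tsum_mul_right]
    refine le_trans (le_of_eq (tsum_congr fun γ => ?_)) (ENNReal.tsum_comp_le_tsum_of_injective
      (add_left_injective (α l)) fun β => if divisor α β = some l then ‖coeff β p‖ₑ * weight ρ β
        else 0)
    rw [coeff_monomialQuotient]
    split_ifs
    · rw [mul_assoc, ← weight_add]
    · simp
  refine (add_le_add_left (Finset.sum_le_sum fun l _ => h l) _).trans ?_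
  rw [← Summable.tsum_finsetSum fun _ _ => ENNReal.summable, wnorm, ← ENNReal.tsum_add, wnorm]
  refine ENNReal.tsum_le_tsum fun β => ?_
  rw [coeff_monomialRemainder]
  cases h2 : divisor α β <;> simp

/-- **Division with remainder** by power series `f l` which are close to monomials. -/
theorem exists_division [Fintype L] {ρ : σ → ℝ≥0} (hρ : ∀ i, 0 < ρ i)
    (f : L → MvPowerSeries σ ℂ)
    (hf : ∀ l, wnorm ρ (f l - monomial (α l) 1) ≤ 2⁻¹ * weight ρ (α l))
    {q : MvPowerSeries σ ℂ} (hq : wnorm ρ q ≠ ⊤) :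
    ∃ (t : L → MvPowerSeries σ ℂ) (r : MvPowerSeries σ ℂ), (∀ l, wnorm ρ (t l) ≠ ⊤) ∧
      wnorm ρ r ≠ ⊤ ∧ (∀ γ, (∃ l, α l ≤ γ) → coeff γ r = 0) ∧ q = ∑ l, t l * f l + r := by
  classical
  -- Dividing by the monomials but subtracting multiples of the `f l` leaves the error ∑ q_l
  -- (x^{α_l} - f_l), which halves the norm. Iterating and summing the quotients and remainders
  -- gives the division.
  let step : MvPowerSeries σ ℂ → MvPowerSeries σ ℂ := fun y =>
    y - (∑ l, monomialQuotient α l y * f l + monomialRemainder α y)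
  have hstep (y : MvPowerSeries σ ℂ) : wnorm ρ (step y) ≤ 2⁻¹ * wnorm ρ y := by
    have h1 : step y = -∑ l, monomialQuotient α l y * (f l - monomial (α l) 1) := by
      have := sum_monomialQuotient_add_monomialRemainder α y
      simp only [step, mul_sub, Finset.sum_sub_distrib]
      nth_rewrite 1 [← this]
      ring
    rw [h1, wnorm_neg]
    refine (wnorm_sum_le _ _ _).trans ?_
    calc ∑ l, wnorm ρ (monomialQuotient α l y * (f l - monomial (α l) 1))
        ≤ ∑ l, 2⁻¹ * (wnorm ρ (monomialQuotient α l y) * weight ρ (α l)) := by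
          refine Finset.sum_le_sum fun l _ => (wnorm_mul_le _ _ _).trans ?_
          refine (mul_le_mul_right (hf l) _).trans (le_of_eq ?_)
          ring
      _ ≤ 2⁻¹ * wnorm ρ y := by
          rw [← Finset.mul_sum]
          exact mul_le_mul_right (le_self_add.trans (wnorm_monomialQuotient_add_le α ρ y)) _
  let y : ℕ → MvPowerSeries σ ℂ := fun n => step^[n] q
  have hy (n : ℕ) : wnorm ρ (y n) ≤ 2⁻¹ ^ n * wnorm ρ q := by
    induction n with
    | zero => simp [y]
    | succ n ih =>
      simp only [y, Function.iterate_succ_apply'] at ih ⊢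
      refine (hstep _).trans ((mul_le_mul_right ih _).trans (le_of_eq ?_))
      rw [pow_succ]
      ring
  have hysum : ∑' n, wnorm ρ (y n) ≠ ⊤ := by
    refine ne_top_of_le_ne_top ?_ (ENNReal.tsum_le_tsum hy)
    rw [ENNReal.tsum_mul_right, ENNReal.tsum_geometric]
    refine ENNReal.mul_ne_top ?_ hq
    simp
  have hT (l : L) : ∑' n, wnorm ρ (monomialQuotient α l (y n)) ≠ ⊤ := by
    have h1 : (∑' n, wnorm ρ (monomialQuotient α l (y n))) * weight ρ (α l) ≠ ⊤ := by
      rw [← ENNReal.tsum_mul_right]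
      refine ne_top_of_le_ne_top hysum (ENNReal.tsum_le_tsum fun n => ?_)
      exact (Finset.single_le_sum
        (f := fun l => wnorm ρ (monomialQuotient α l (y n)) * weight ρ (α l))
        (fun _ _ => zero_le) (Finset.mem_univ l)).trans
          (le_self_add.trans (wnorm_monomialQuotient_add_le α ρ (y n)))
    exact fun h2 => h1 (by rw [h2, ENNReal.top_mul (weight_ne_zero hρ _)])
  have hR : ∑' n, wnorm ρ (monomialRemainder α (y n)) ≠ ⊤ :=
    ne_top_of_le_ne_top hysum (ENNReal.tsum_le_tsum fun n =>
      le_add_self.trans (wnorm_monomialQuotient_add_le α ρ (y n)))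
  have sT (l : L) := summable_of_tsum_wnorm_ne_top hρ (hT l)
  have sR := summable_of_tsum_wnorm_ne_top hρ hR
  have sY := summable_of_tsum_wnorm_ne_top hρ hysum
  refine ⟨fun l => ∑' n, monomialQuotient α l (y n), ∑' n, monomialRemainder α (y n),
    fun l => ne_top_of_le_ne_top (hT l) (wnorm_tsum_le ρ (sT l)),
    ne_top_of_le_ne_top hR (wnorm_tsum_le ρ sR), ?_, ?_⟩
  · rintro γ ⟨l, hl⟩
    have h1 := (WithPiTopology.hasSum_iff_hasSum_coeff (R := ℂ)).1 sR.hasSum γ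
    rw [← h1.tsum_eq]
    refine (tsum_congr fun n => ?_).trans tsum_zero
    rw [coeff_monomialRemainder, if_neg]
    exact fun h => (divisor_eq_none_iff α).1 h l hl
  · have h1 : HasSum (fun n => ∑ l, monomialQuotient α l (y n) * f l +
        monomialRemainder α (y n)) (∑ l, (∑' n, monomialQuotient α l (y n)) * f l +
          ∑' n, monomialRemainder α (y n)) :=
      (hasSum_sum fun l _ => (sT l).hasSum.mul_right (f l)).add sR.hasSum
    have h2 (n : ℕ) : ∑ l, monomialQuotient α l (y n) * f l + monomialRemainder α (y n) =
        y n - y (n + 1) := by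
      simp only [y, Function.iterate_succ_apply', step]
      ring
    simp only [h2] at h1
    -- The series telescopes to `y 0`, which is `q`.
    have h3 : HasSum (fun n => y n - y (n + 1)) (y 0) := by
      have h4 := sY.hasSum.sub ((hasSum_nat_add_iff' 1).2 sY.hasSum)
      simpa using h4
    exact h3.unique h1

end Division

end MvPowerSeries

/-! ### Division, units and coordinate ideals for convergent power series -/

namespace ConvSeries

open scoped ENNReal NNReal
open MvPowerSeries (wnorm weight)

variable {σ : Type}

/-- The coefficient of `z^α`. -/
def coeff (α : σ →₀ ℕ) : ConvSeries σ →ₗ[ℂ] ℂ :=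
  (MvPowerSeries.coeff α).comp (convSubalgebra σ).val.toLinearMap

theorem coeff_apply (α : σ →₀ ℕ) (p : ConvSeries σ) : coeff α p = MvPowerSeries.coeff α p.1 := rfl

theorem constCoeff_eq_coeff (p : ConvSeries σ) : p.constCoeff = coeff 0 p := rfl

theorem ext_coeff {p q : ConvSeries σ} (h : ∀ α, coeff α p = coeff α q) : p = q :=
  Subtype.ext (MvPowerSeries.ext h)

theorem summable_iff_wnorm_ne_top {p : MvPowerSeries σ ℂ} {r : ℝ≥0} :
    (Summable fun α : σ →₀ ℕ => ‖MvPowerSeries.coeff α p‖ * (r : ℝ) ^ α.degree) ↔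
      wnorm (fun _ => r) p ≠ ⊤ := by
  have h : wnorm (fun _ => r) p =
      ∑' α : σ →₀ ℕ, ‖‖MvPowerSeries.coeff α p‖ * (r : ℝ) ^ α.degree‖ₑ := by
    refine tsum_congr fun α => ?_
    rw [MvPowerSeries.weight_const, enorm_mul, enorm_pow, enorm_norm]
    simp
  rw [h]
  refine ⟨fun h1 => ?_, fun h1 => Summable.of_enorm h1⟩
  exact ENNReal.tsum_coe_ne_top_iff_summable.2 (NNReal.summable_coe.1 h1.norm)

theorem isConvergentSeries_of_wnorm_ne_top [Finite σ] {p : MvPowerSeries σ ℂ} {ρ : σ → ℝ≥0}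
    (hρ : ∀ i, 0 < ρ i) (h : wnorm ρ p ≠ ⊤) : IsConvergentSeries p := by
  obtain ⟨r, hr, hrρ⟩ : ∃ r : ℝ≥0, 0 < r ∧ ∀ i, r ≤ ρ i := by
    cases isEmpty_or_nonempty σ
    · exact ⟨1, one_pos, fun i => isEmptyElim i⟩
    · obtain ⟨i, hi⟩ := Finite.exists_min ρ
      exact ⟨ρ i, hρ i, hi⟩
  exact ⟨r, hr, summable_iff_wnorm_ne_top.2 (ne_top_of_le_ne_top h
    (MvPowerSeries.wnorm_mono hrρ p))⟩

theorem exists_wnorm_ne_top (p : ConvSeries σ) :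
    ∃ r : ℝ≥0, 0 < r ∧ ∀ ρ : σ → ℝ≥0, (∀ i, ρ i ≤ r) → wnorm ρ p.1 ≠ ⊤ := by
  obtain ⟨r, hr, h⟩ := p.2
  lift r to ℝ≥0 using hr.le
  exact ⟨r, hr, fun ρ hρ => ne_top_of_le_ne_top (summable_iff_wnorm_ne_top.1 h)
    (MvPowerSeries.wnorm_mono hρ _)⟩

theorem exists_forall_wnorm_ne_top {ι : Type} [Finite ι] (p : ι → ConvSeries σ) :
    ∃ r : ℝ≥0, 0 < r ∧ ∀ ρ : σ → ℝ≥0, (∀ i, ρ i ≤ r) → ∀ j, wnorm ρ (p j).1 ≠ ⊤ := by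
  choose r hr h using fun j => exists_wnorm_ne_top (p j)
  cases isEmpty_or_nonempty ι
  · exact ⟨1, one_pos, fun _ _ j => isEmptyElim j⟩
  · obtain ⟨j, hj⟩ := Finite.exists_min r
    exact ⟨r j, hr j, fun ρ hρ i => h i ρ fun k => (hρ k).trans (hj i)⟩

theorem exists_division [Finite σ] {L : Type} [Fintype L] (α : L → σ →₀ ℕ) {ρ : σ → ℝ≥0}
    (hρ : ∀ i, 0 < ρ i) (f : L → ConvSeries σ)
    (hf : ∀ l, wnorm ρ ((f l).1 - MvPowerSeries.monomial (α l) 1) ≤ 2⁻¹ * weight ρ (α l))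
    {q : ConvSeries σ} (hq : wnorm ρ q.1 ≠ ⊤) :
    ∃ (t : L → ConvSeries σ) (r : ConvSeries σ), (∀ γ, (∃ l, α l ≤ γ) → coeff γ r = 0) ∧
      q = ∑ l, t l * f l + r := by
  obtain ⟨t, r, ht, hr, h0, h⟩ := MvPowerSeries.exists_division α hρ (fun l => (f l).1) hf hq
  refine ⟨fun l => ⟨t l, isConvergentSeries_of_wnorm_ne_top hρ (ht l)⟩,
    ⟨r, isConvergentSeries_of_wnorm_ne_top hρ hr⟩, h0, Subtype.ext ?_⟩
  rw [h]
  simp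

/-- Without a constant term every monomial has positive degree, so shrinking the radius by `s` gains
at least one factor `s`. -/
theorem wnorm_const_mul_le {p : MvPowerSeries σ ℂ} (hp : MvPowerSeries.constantCoeff p = 0)
    {r s : ℝ≥0} (hs : s ≤ 1) : wnorm (fun _ => s * r) p ≤ s * wnorm (fun _ => r) p := by
  rw [wnorm, wnorm, ← ENNReal.tsum_mul_left]
  refine ENNReal.tsum_le_tsum fun α => ?_
  rw [MvPowerSeries.weight_const, MvPowerSeries.weight_const]
  by_cases h : α = 0
  · subst h
    rw [MvPowerSeries.coeff_zero_eq_constantCoeff, hp]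
    simp
  · have h1 : α.degree ≠ 0 := fun h2 => h ((Finsupp.degree_eq_zero_iff α).1 h2)
    have h2 : (s : ℝ≥0∞) ^ α.degree ≤ s := pow_le_of_le_one zero_le (by exact_mod_cast hs) h1
    rw [ENNReal.coe_mul, mul_pow, mul_left_comm]
    gcongr

theorem isUnit_iff [Finite σ] {p : ConvSeries σ} : IsUnit p ↔ p.constCoeff ≠ 0 := by
  constructor
  · intro h
    exact (h.map ((MvPowerSeries.constantCoeff (σ := σ) (R := ℂ)).comp
      (convSubalgebra σ).val.toRingHom)).ne_zero
  intro h
  set c := p.constCoeff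
  suffices h1 : ∃ t, t * (c⁻¹ • p) = 1 by
    obtain ⟨t, ht⟩ := h1
    refine IsUnit.of_mul_eq_one_right (c⁻¹ • t) ?_
    rw [← ht, smul_mul_assoc, mul_smul_comm]
  obtain ⟨r, hr, hr1⟩ := exists_wnorm_ne_top (c⁻¹ • p - 1)
  obtain ⟨s, hs, hs1⟩ := ENNReal.exists_nnreal_pos_mul_lt (b := 2⁻¹) (hr1 (fun _ => r)
    fun _ => le_rfl) (by simp)
  have h0 : MvPowerSeries.constantCoeff (c⁻¹ • p - 1).1 = 0 := by
    have : MvPowerSeries.constantCoeff p.1 = c := rfl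
    simp [this, h]
  have h2 : wnorm (fun _ => min s 1 * r) (c⁻¹ • p - 1).1 ≤ 2⁻¹ := by
    refine (wnorm_const_mul_le h0 (min_le_right s 1)).trans (le_trans ?_ hs1.le)
    gcongr
    exact min_le_left _ _
  have hpos : 0 < min s 1 * r := mul_pos (lt_min hs one_pos) hr
  -- The normalised series is close to the monomial with exponent 0. That monomial divides
  -- everything, so dividing 1 by the series leaves no remainder.
  obtain ⟨t, r, h3, h4⟩ := exists_division (L := Unit) (fun _ => (0 : σ →₀ ℕ))
    (ρ := fun _ => min s 1 * r) (fun _ => hpos) (fun _ => c⁻¹ • p) (q := 1)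
    (fun _ => by simpa using h2) (by
      have := MvPowerSeries.wnorm_monomial (fun _ : σ => min s 1 * r) 0 1
      rw [MvPowerSeries.monomial_zero_one] at this
      change wnorm _ 1 ≠ ⊤
      rw [this]
      simp)
  refine ⟨t (), ?_⟩
  rw [h4, show r = 0 from ext_coeff fun γ => (h3 γ ⟨(), zero_le⟩).trans (map_zero _).symm]
  simp

instance [Finite σ] : IsLocalRing (ConvSeries σ) := by
  refine IsLocalRing.of_nonunits_add fun a b ha hb => ?_
  rw [mem_nonunits_iff, isUnit_iff, not_not] at *
  rw [constCoeff_eq_coeff] at *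
  rw [map_add, ha, hb, add_zero]

theorem mem_maximalIdeal [Finite σ] {p : ConvSeries σ} :
    p ∈ IsLocalRing.maximalIdeal (ConvSeries σ) ↔ p.constCoeff = 0 := by
  rw [IsLocalRing.mem_maximalIdeal, mem_nonunits_iff, isUnit_iff, not_not]

theorem coeff_X (i : σ) (α : σ →₀ ℕ) [DecidableEq σ] :
    coeff α (X i) = if α = Finsupp.single i 1 then 1 else 0 :=
  MvPowerSeries.coeff_X α i

theorem coeff_mul_X (p : ConvSeries σ) (i : σ) (α : σ →₀ ℕ) :
    coeff (α + Finsupp.single i 1) (p * X i) = coeff α p := by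
  have := MvPowerSeries.coeff_add_mul_monomial α (Finsupp.single i 1) p.1 (1 : ℂ)
  rwa [mul_one] at this

theorem coeff_mul_X_eq_zero (p : ConvSeries σ) {i : σ} {α : σ →₀ ℕ} (h : α i = 0) :
    coeff α (p * X i) = 0 := by
  classical
  have := MvPowerSeries.coeff_mul_monomial α (Finsupp.single i 1) p.1 (1 : ℂ)
  rw [if_neg (fun h1 => by simpa [h] using h1 i)] at this
  exact this

/-- For the converse, divide by the variables in `s`: the remainder has only monomials free of these
variables, and by assumption these coefficients vanish. -/
theorem mem_span_X_iff [Finite σ] {s : Set σ} {p : ConvSeries σ} :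
    p ∈ Ideal.span (X '' s) ↔ ∀ α : σ →₀ ℕ, (∀ j ∈ s, α j = 0) → coeff α p = 0 := by
  constructor
  · intro hp α hα
    suffices h : ∀ a, coeff α (a * p) = 0 by simpa using h 1
    induction hp using Submodule.span_induction with
    | mem x hx =>
      obtain ⟨j, hj, rfl⟩ := hx
      exact fun a => coeff_mul_X_eq_zero _ (hα j hj)
    | zero => simp
    | add x y _ _ hx hy => exact fun a => by rw [mul_add, map_add, hx, hy, add_zero]
    | smul b x _ ih => exact fun a => by rw [smul_eq_mul, ← mul_assoc, ih]
  · intro h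
    have := Fintype.ofFinite s
    obtain ⟨r, hr, hr1⟩ := exists_wnorm_ne_top p
    obtain ⟨t, q, hq, hp⟩ := exists_division (fun j : s => Finsupp.single j.1 1)
      (ρ := fun _ => r) (fun _ => hr) (fun j => X j.1)
      (fun j => by
        rw [show (X j.1 : ConvSeries σ).1 = MvPowerSeries.monomial (Finsupp.single j.1 1) 1
          from rfl, sub_self]
        simp) (hr1 _ fun _ => le_rfl)
    have hq0 : q = 0 := ext_coeff fun α => by
      rw [map_zero]
      by_cases hα : ∃ j ∈ s, α j ≠ 0
      · obtain ⟨j, hj, hα⟩ := hα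
        exact hq α ⟨⟨j, hj⟩, by simpa [Nat.one_le_iff_ne_zero] using hα⟩
      · push Not at hα
        have h1 := h α hα
        rw [hp, map_add, map_sum, Finset.sum_eq_zero, zero_add] at h1
        · exact h1
        · exact fun j _ => coeff_mul_X_eq_zero _ (hα j.1 j.2)
    rw [hp, hq0, add_zero]
    exact sum_mem fun j _ => Ideal.mul_mem_left _ _ (Ideal.subset_span ⟨j.1, j.2, rfl⟩)

end ConvSeries

/-! ### Polyradii at which a single monomial dominates -/

namespace MvPowerSeries

open scoped ENNReal NNReal
open Filter Topology

variable {σ : Type}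

theorem weight_pow (ρ : σ → ℝ≥0) (s : ℕ) (α : σ →₀ ℕ) :
    weight (fun i => ρ i ^ s) α = weight ρ α ^ s := by
  rw [weight, weight, Finsupp.prod, Finsupp.prod, ← Finset.prod_pow]
  refine Finset.prod_congr rfl fun i _ => ?_
  push_cast
  rw [← pow_mul, ← pow_mul, mul_comm]

/-- If all monomials of `g` have, at the polyradius `ρ`, at most the weight `a < weight ρ α`, then
at high powers of `ρ` the monomial `z^α` dominates `g`. -/
theorem eventually_wnorm_le {ρ : σ → ℝ≥0} {g : MvPowerSeries σ ℂ} {s₀ : ℕ}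
    (hg : wnorm (fun i => ρ i ^ s₀) g ≠ ⊤) {α : σ →₀ ℕ} {a : ℝ≥0∞} (ha : a < weight ρ α)
    (h : ∀ β, coeff β g ≠ 0 → weight ρ β ≤ a) :
    ∀ᶠ s in atTop, wnorm (fun i => ρ i ^ s) g ≤ 2⁻¹ * weight (fun i => ρ i ^ s) α := by
  set b := weight ρ α
  have hb0 : b ≠ 0 := (zero_le.trans_lt ha).ne'
  have hbt : b ≠ ⊤ := weight_ne_top ρ α
  have hlim : Tendsto (fun k : ℕ => wnorm (fun i => ρ i ^ s₀) g / b ^ s₀ * (a / b) ^ k) atTop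
      (𝓝 (wnorm (fun i => ρ i ^ s₀) g / b ^ s₀ * 0)) := by
    refine ENNReal.Tendsto.const_mul (ENNReal.tendsto_pow_atTop_nhds_zero_of_lt_one ?_)
      (Or.inr (ENNReal.div_ne_top hg (pow_ne_zero _ hb0)))
    rwa [ENNReal.div_lt_iff (Or.inl hb0) (Or.inl hbt), one_mul]
  rw [mul_zero] at hlim
  have hev := hlim.eventually_le_const (u := 2⁻¹) (by simp)
  rw [eventually_atTop] at hev ⊢
  obtain ⟨k₀, hk₀⟩ := hev
  refine ⟨s₀ + k₀, fun s hs => ?_⟩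
  obtain ⟨k, rfl⟩ := Nat.exists_eq_add_of_le (le_of_add_le_left hs)
  have hk := hk₀ k (by lia)
  have h1 : wnorm (fun i => ρ i ^ (s₀ + k)) g ≤ wnorm (fun i => ρ i ^ s₀) g * a ^ k := by
    rw [wnorm, wnorm, ← ENNReal.tsum_mul_right]
    refine ENNReal.tsum_le_tsum fun β => ?_
    by_cases hβ : coeff β g = 0
    · simp [hβ]
    · rw [weight_pow, weight_pow, pow_add, ← mul_assoc]
      gcongr
      exact h β hβ
  refine h1.trans ?_
  rw [weight_pow]
  calc wnorm (fun i => ρ i ^ s₀) g * a ^ k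
      = (wnorm (fun i => ρ i ^ s₀) g / b ^ s₀ * (a / b) ^ k) * b ^ (s₀ + k) := by
        rw [pow_add, mul_mul_mul_comm, ENNReal.div_mul_cancel (pow_ne_zero _ hb0)
          (ENNReal.pow_ne_top hbt), ← mul_pow, ENNReal.div_mul_cancel hb0 hbt]
    _ ≤ 2⁻¹ * b ^ (s₀ + k) := by gcongr

/-! ### An ordering of the exponents by the natural numbers -/

section Value

variable [Finite σ]

/-- Pairwise different primes. -/
def primeOf (i : σ) : ℕ :=
  haveI := Fintype.ofFinite σ
  Nat.nth Nat.Prime (Fintype.equivFin σ i)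

theorem primeOf_prime (i : σ) : (primeOf i).Prime :=
  Nat.nth_mem_of_infinite Nat.infinite_setOfPred_prime _

theorem primeOf_injective : Function.Injective (primeOf (σ := σ)) := fun i j h => by
  have := Nat.nth_injective Nat.infinite_setOfPred_prime h
  exact (@Fintype.equivFin σ (Fintype.ofFinite σ)).injective (Fin.ext this)

/-- The product `∏ p_i ^ α_i` of prime powers. -/
def primeValue (α : σ →₀ ℕ) : ℕ := α.prod fun i k => primeOf i ^ k

/-- By unique factorisation. Hence comparing values is a total order on exponents, compatible with
addition, and well-founded because the values are natural numbers. -/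
theorem primeValue_injective : Function.Injective (primeValue (σ := σ)) := by
  intro α β h
  let e : σ ↪ ℕ := ⟨primeOf, primeOf_injective⟩
  have h1 (γ : σ →₀ ℕ) : primeValue γ = (Finsupp.embDomain e γ).prod fun p k => p ^ k := by
    rw [Finsupp.prod_embDomain]
    rfl
  have h2 (γ : σ →₀ ℕ) : (primeValue γ).factorization = Finsupp.embDomain e γ := by
    rw [h1]
    refine Nat.prod_pow_factorization_eq_self fun p hp => ?_
    rw [Finsupp.support_embDomain, Finset.mem_map] at hp
    obtain ⟨i, _, rfl⟩ := hp
    exact primeOf_prime i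
  exact Finsupp.embDomain_injective e (by rw [← h2, ← h2, h])

/-- The polyradius `(1 / p_i)`. -/
def primeRadius (i : σ) : ℝ≥0 := (primeOf i : ℝ≥0)⁻¹

theorem primeRadius_pos (i : σ) : 0 < primeRadius i :=
  inv_pos.2 (by exact_mod_cast (primeOf_prime i).pos)

theorem primeRadius_le (i : σ) : primeRadius i ≤ 2⁻¹ :=
  inv_anti₀ two_pos (by exact_mod_cast (primeOf_prime i).two_le)

theorem weight_primeRadius (α : σ →₀ ℕ) :
    weight primeRadius α = ((primeValue α : ℝ≥0)⁻¹ : ℝ≥0) := by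
  rw [weight, primeValue, Finsupp.prod, Finsupp.prod, Nat.cast_prod, ← Finset.prod_inv_distrib,
    ENNReal.ofNNReal_finsetProd]
  refine Finset.prod_congr rfl fun i _ => ?_
  rw [primeRadius]
  push_cast
  rw [← inv_pow, ENNReal.coe_pow]

theorem primeValue_pos (α : σ →₀ ℕ) : 0 < primeValue α :=
  Finset.prod_pos fun i _ => pow_pos (primeOf_prime i).pos _

end Value

end MvPowerSeries

/-! ### Leading monomials and Noetherianity -/

namespace ConvSeries

open scoped ENNReal NNReal
open Filter Topology
open MvPowerSeries (wnorm weight primeRadius primeValue)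

variable {σ : Type} [Finite σ]

theorem eventually_wnorm_primeRadius_ne_top (p : ConvSeries σ) :
    ∀ᶠ s in atTop, wnorm (fun i => primeRadius i ^ s) p.1 ≠ ⊤ := by
  obtain ⟨r, hr, h⟩ := exists_wnorm_ne_top p
  have := (tendsto_pow_atTop_nhds_zero_of_lt_one (r := (2⁻¹ : ℝ≥0)) zero_le
    (by rw [inv_lt_one₀ two_pos]; exact one_lt_two)).eventually_le_const hr
  filter_upwards [this] with s hs
  exact h _ fun i => (pow_le_pow_left' (MvPowerSeries.primeRadius_le i) s).trans hs

/-- `z^α` is the leading monomial of `f`, and has coefficient `1`. -/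
def IsLeading (f : ConvSeries σ) (α : σ →₀ ℕ) : Prop :=
  coeff α f = 1 ∧ ∀ β, coeff β f ≠ 0 → primeValue α ≤ primeValue β

theorem exists_isLeading {f : ConvSeries σ} (hf : f ≠ 0) : ∃ (c : ℂ) (α : σ →₀ ℕ),
    coeff α f ≠ 0 ∧ IsLeading (c • f) α := by
  have h1 : {α | coeff α f ≠ 0}.Nonempty := by
    by_contra h
    rw [Set.not_nonempty_iff_eq_empty, Set.eq_empty_iff_forall_notMem] at h
    exact hf (ext_coeff fun α => by simpa using h α)
  obtain ⟨α, hα, hmin⟩ := (measure (primeValue (σ := σ))).wf.has_min _ h1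
  refine ⟨(coeff α f)⁻¹, α, hα, by simpa using inv_mul_cancel₀ hα, fun β hβ => ?_⟩
  exact not_lt.1 (hmin β fun h => hβ (by rw [map_smul, h, smul_zero]))

/-- The other monomials have strictly larger integral value, so their weights are at most
1/(`primeValue α` + 1). This gap is what `MvPowerSeries.eventually_wnorm_le` amplifies. -/
theorem IsLeading.eventually_wnorm_le {f : ConvSeries σ} {α : σ →₀ ℕ} (h : IsLeading f α) :
    ∀ᶠ s in atTop, wnorm (fun i => primeRadius i ^ s) (f.1 - MvPowerSeries.monomial α 1) ≤
      2⁻¹ * weight (fun i => primeRadius i ^ s) α := by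
  classical
  obtain ⟨s₀, hs₀⟩ := (eventually_wnorm_primeRadius_ne_top f).exists
  have hpos := MvPowerSeries.primeValue_pos α
  refine MvPowerSeries.eventually_wnorm_le (s₀ := s₀) (a := ((primeValue α + 1 : ℝ≥0)⁻¹ : ℝ≥0))
    ?_ ?_ fun β hβ => ?_
  · rw [sub_eq_add_neg]
    refine ne_top_of_le_ne_top ?_ (MvPowerSeries.wnorm_add_le _ _ _)
    rw [MvPowerSeries.wnorm_neg, MvPowerSeries.wnorm_monomial]
    exact ENNReal.add_ne_top.2 ⟨hs₀, ENNReal.mul_ne_top (by simp)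
      (MvPowerSeries.weight_ne_top _ _)⟩
  · rw [MvPowerSeries.weight_primeRadius, ENNReal.coe_lt_coe]
    exact inv_strictAnti₀ (by exact_mod_cast hpos) (lt_add_one _)
  · rw [MvPowerSeries.weight_primeRadius, ENNReal.coe_le_coe]
    rw [map_sub, MvPowerSeries.coeff_monomial] at hβ
    have h1 : β ≠ α := by
      rintro rfl
      rw [if_pos rfl, ← coeff_apply, h.1, sub_self] at hβ
      exact hβ rfl
    rw [if_neg h1, sub_zero] at hβ
    have h2 : primeValue α < primeValue β := lt_of_le_of_ne (h.2 β hβ)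
      fun h3 => h1 (MvPowerSeries.primeValue_injective h3.symm)
    exact inv_anti₀ (by positivity) (by exact_mod_cast h2)

/-- A standard basis argument. By Dickson's lemma the leading exponents of an ideal have finitely
many minimal elements. Dividing by elements with these leading exponents leaves a remainder in the
ideal none of whose monomials can be leading, so it is zero. -/
instance : IsNoetherianRing (ConvSeries σ) := by
  rw [isNoetherianRing_iff_ideal_fg]
  intro I
  let E : Set (σ →₀ ℕ) := {α | ∃ f ∈ I, IsLeading f α}
  have hfin : {α | Minimal (· ∈ E) α}.Finite :=
    (wellQuasiOrderedLE_iff.1 inferInstance).2 _ (setOfPred_minimal_antichain _)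
  have := hfin.fintype
  choose! f hfI hf using fun α (hα : α ∈ E) => hα
  let L := {α | Minimal (· ∈ E) α}
  have hL (α : L) : α.1 ∈ E := α.2.1
  suffices h : I = Ideal.span (Set.range fun α : L => f α) by
    rw [h]
    exact Submodule.fg_span (Set.finite_range _)
  refine le_antisymm (fun q hq => ?_) (Ideal.span_le.2 ?_)
  · have h1 : ∀ᶠ s in atTop, ∀ α : L, wnorm (fun i => primeRadius i ^ s)
        ((f α).1 - MvPowerSeries.monomial α.1 1) ≤
          2⁻¹ * weight (fun i => primeRadius i ^ s) α.1 :=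
      eventually_all.2 fun α => (hf α (hL α)).eventually_wnorm_le
    obtain ⟨s, hs, hsq⟩ := (h1.and (eventually_wnorm_primeRadius_ne_top q)).exists
    obtain ⟨t, r, hr, h⟩ := exists_division (fun α : L => α.1)
      (fun i => pow_pos (MvPowerSeries.primeRadius_pos i) s) (fun α => f α) hs hsq
    have hsum : ∑ l : L, t l * f l ∈ Ideal.span (Set.range fun α : L => f α) :=
      sum_mem fun α _ => Ideal.mul_mem_left _ _ (Ideal.subset_span ⟨α, rfl⟩)
    have hrI : r ∈ I := by
      have h2 : r = q - ∑ l : L, t l * f l := by rw [h]; ring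
      rw [h2]
      exact sub_mem hq (sum_mem fun α _ => Ideal.mul_mem_left _ _ (hfI α (hL α)))
    have hr0 : r = 0 := by
      by_contra h0
      obtain ⟨c, α, hα, hlead⟩ := exists_isLeading h0
      have hαE : α ∈ E := ⟨c • r, Submodule.smul_of_tower_mem I c hrI, hlead⟩
      obtain ⟨β, hβα, hβ⟩ := exists_minimal_le_of_wellFoundedLT (· ∈ E) α hαE
      exact hα (hr α ⟨⟨β, hβ⟩, hβα⟩)
    rw [h, hr0, add_zero]
    exact hsum
  · rintro _ ⟨α, rfl⟩
    exact hfI α (hL α)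

end ConvSeries

namespace ConvSeries

open scoped ENNReal NNReal
open MvPowerSeries (wnorm weight)

variable {σ τ : Type}

/-! ### Coordinate subspaces -/

theorem coeff_embDomain_rename (e : σ ↪ τ) (p : ConvSeries σ) (α : σ →₀ ℕ) :
    coeff (Finsupp.embDomain e α) (rename e p) = coeff α p :=
  MvPowerSeries.coeff_embDomain_rename e p.1 α

theorem coeff_rename_eq_zero (e : σ ↪ τ) (p : ConvSeries σ) {α : τ →₀ ℕ} {j : τ}
    (hj : j ∉ Set.range e) (hα : α j ≠ 0) : coeff α (rename e p) = 0 := by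
  refine MvPowerSeries.coeff_rename_eq_zero _ _ ?_
  rintro ⟨β, rfl⟩
  rw [← Finsupp.embDomain_eq_mapDomain] at hα
  exact hα (Finsupp.embDomain_of_notMem_range _ _ _ hj)

@[simp] theorem rename_X (e : σ ↪ τ) (i : σ) : rename e (X i) = X (e i) :=
  Subtype.ext (MvPowerSeries.rename_X e i)

theorem exists_embDomain_eq (e : σ ↪ τ) {α : τ →₀ ℕ} (h : ∀ j ∉ Set.range e, α j = 0) :
    ∃ β, Finsupp.embDomain e β = α := by
  refine ⟨α.comapDomain e e.injective.injOn, ?_⟩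
  ext j
  by_cases hj : j ∈ Set.range e
  · obtain ⟨i, rfl⟩ := hj
    rw [Finsupp.embDomain_apply_self, Finsupp.comapDomain_apply]
  · rw [Finsupp.embDomain_of_notMem_range _ _ _ hj, h j hj]

theorem degree_embDomain (e : σ ↪ τ) (α : σ →₀ ℕ) :
    (Finsupp.embDomain e α).degree = α.degree := by
  rw [Finsupp.embDomain_eq_mapDomain, Finsupp.degree_mapDomain]

/-- Restriction of a function of the variables `τ` to the coordinate subspace `ℂ^σ`. -/
def restrict (e : σ ↪ τ) : ConvSeries τ →ₐ[ℂ] ConvSeries σ :=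
  AlgHom.codRestrict ((MvPowerSeries.killCompl (R := ℂ) e).comp (convSubalgebra τ).val)
    (convSubalgebra σ) (by
      rintro ⟨p, r, hr, hp⟩
      refine ⟨r, hr, (hp.comp_injective (Finsupp.embDomain_injective e)).congr fun α => ?_⟩
      rw [Function.comp_apply, degree_embDomain]
      rfl)

theorem coeff_restrict (e : σ ↪ τ) (p : ConvSeries τ) (α : σ →₀ ℕ) :
    coeff α (restrict e p) = coeff (Finsupp.embDomain e α) p := rfl

@[simp] theorem restrict_rename (e : σ ↪ τ) (p : ConvSeries σ) : restrict e (rename e p) = p :=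
  ext_coeff fun α => by rw [coeff_restrict, coeff_embDomain_rename]

theorem restrict_X_of_notMem (e : σ ↪ τ) {j : τ} (hj : j ∉ Set.range e) : restrict e (X j) = 0 :=
  Subtype.ext (MvPowerSeries.killCompl_X_eq_zero hj)

@[simp] theorem constCoeff_rename (e : σ ↪ τ) (p : ConvSeries σ) :
    (rename e p).constCoeff = p.constCoeff := by
  rw [constCoeff_eq_coeff, constCoeff_eq_coeff, ← coeff_embDomain_rename e, Finsupp.embDomain_zero]

/-! ### Partial derivatives -/

/-- The partial derivative as a derivation. -/
def pderivation (i : σ) : Derivation ℂ (ConvSeries σ) (ConvSeries σ) where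
  toFun := pderiv i
  map_add' p q := Subtype.ext (map_add (MvPowerSeries.pderiv ℂ i) p.1 q.1)
  map_smul' c p := Subtype.ext ((MvPowerSeries.pderiv ℂ i).toLinearMap.map_smul c p.1)
  map_one_eq_zero' := Subtype.ext (Derivation.map_one_eq_zero (MvPowerSeries.pderiv ℂ i))
  leibniz' p q := Subtype.ext (Derivation.leibniz (MvPowerSeries.pderiv ℂ i) p.1 q.1)

theorem coeff_pderiv (i : σ) (p : ConvSeries σ) (α : σ →₀ ℕ) :
    coeff α (pderiv i p) = coeff (α + Finsupp.single i 1) p * (α i + 1) :=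
  MvPowerSeries.coeff_pderiv p.1 α

theorem pderiv_add (i : σ) (p q : ConvSeries σ) : pderiv i (p + q) = pderiv i p + pderiv i q :=
  map_add (pderivation i) p q

theorem pderiv_mul (i : σ) (p q : ConvSeries σ) :
    pderiv i (p * q) = p * pderiv i q + q * pderiv i p :=
  (pderivation i).leibniz p q

theorem pderiv_sum (i : σ) {L : Type} (s : Finset L) (p : L → ConvSeries σ) :
    pderiv i (∑ l ∈ s, p l) = ∑ l ∈ s, pderiv i (p l) :=
  map_sum (pderivation i) p s

theorem pderiv_X [DecidableEq σ] (i j : σ) :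
    pderiv i (X j) = if j = i then (1 : ConvSeries σ) else 0 := by
  split_ifs with h
  · subst h
    exact Subtype.ext MvPowerSeries.pderiv_X_self
  · exact Subtype.ext (MvPowerSeries.pderiv_X_of_ne h)

theorem pderiv_comm (i j : σ) (p : ConvSeries σ) :
    pderiv i (pderiv j p) = pderiv j (pderiv i p) := by
  classical
  refine ext_coeff fun α => ?_
  simp only [coeff_pderiv, Finsupp.add_apply, Finsupp.single_apply]
  rw [add_right_comm]
  by_cases h : i = j
  · subst h; ring
  · simp only [h, Ne.symm h, if_false]
    push_cast
    ring

theorem pderiv_rename (e : σ ↪ τ) (i : σ) (p : ConvSeries σ) :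
    pderiv (e i) (rename e p) = rename e (pderiv i p) := by
  refine ext_coeff fun α => ?_
  by_cases h : ∀ j ∉ Set.range e, α j = 0
  · obtain ⟨β, rfl⟩ := exists_embDomain_eq e h
    have h1 : Finsupp.embDomain e β + Finsupp.single (e i) 1 =
        Finsupp.embDomain e (β + Finsupp.single i 1) := by
      simp [Finsupp.embDomain_eq_mapDomain, Finsupp.mapDomain_add]
    rw [coeff_pderiv, h1, coeff_embDomain_rename, coeff_embDomain_rename, coeff_pderiv,
      Finsupp.embDomain_apply_self]
  · push Not at h
    obtain ⟨j, hj, hα⟩ := h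
    rw [coeff_pderiv, coeff_rename_eq_zero e _ hj hα, coeff_rename_eq_zero e _ hj, zero_mul]
    exact fun h => hα (Nat.eq_zero_of_add_eq_zero_right h)

theorem pderiv_rename_of_notMem (e : σ ↪ τ) {j : τ} (hj : j ∉ Set.range e) (p : ConvSeries σ) :
    pderiv j (rename e p) = 0 := by
  refine ext_coeff fun α => ?_
  rw [coeff_pderiv, coeff_rename_eq_zero e _ hj, zero_mul, map_zero]
  simp

/-- A nonzero proper ideal of convergent power series is not stable under all partial
derivatives. -/
theorem exists_pderiv_notMem [Finite σ] {K : Ideal (ConvSeries σ)} (h0 : K ≠ ⊥) (h1 : K ≠ ⊤) :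
    ∃ p ∈ K, ∃ i, pderiv i p ∉ K := by
  obtain ⟨p, hp, hp0⟩ := Submodule.exists_mem_ne_zero_of_ne_bot h0
  have h2 : {α : σ →₀ ℕ | ∃ p ∈ K, coeff α p ≠ 0}.Nonempty := by
    by_contra h
    rw [Set.not_nonempty_iff_eq_empty, Set.eq_empty_iff_forall_notMem] at h
    exact hp0 (ext_coeff fun α => by
      by_contra h3
      exact h α ⟨p, hp, h3⟩)
  -- Take a monomial of least degree among all those occurring in elements of `K`. A derivative of
  -- `p` contains one of smaller degree.
  obtain ⟨α, ⟨p, hp, hα⟩, hmin⟩ := (measure (Finsupp.degree (σ := σ) (R := ℕ))).wf.has_min _ h2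
  have hα0 : α ≠ 0 := by
    rintro rfl
    exact h1 (Ideal.eq_top_of_isUnit_mem K hp (isUnit_iff.2 hα))
  obtain ⟨i, hi⟩ := Finsupp.ne_iff.1 hα0
  have h3 : α - Finsupp.single i 1 + Finsupp.single i 1 = α :=
    tsub_add_cancel_of_le (by simpa [Nat.one_le_iff_ne_zero] using hi)
  refine ⟨p, hp, i, fun h4 => hmin (α - Finsupp.single i 1) ⟨_, h4, ?_⟩ ?_⟩
  · rw [coeff_pderiv, h3]
    exact mul_ne_zero hα (Nat.cast_add_one_ne_zero _)
  · change (α - Finsupp.single i 1).degree < α.degree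
    conv_rhs => rw [← h3]
    simp

/-! ### Monomials -/

/-- The monomial `z^α`. -/
def monomial (α : σ →₀ ℕ) : ConvSeries σ :=
  ⟨MvPowerSeries.monomial α 1, by
    classical
    exact IsConvergentSeries.of_finite {α} fun β hβ => by
      rw [MvPowerSeries.coeff_monomial, if_neg (by simpa using hβ)]⟩

theorem monomial_add (α β : σ →₀ ℕ) : monomial (α + β) = monomial α * monomial β :=
  Subtype.ext (by
    have := MvPowerSeries.monomial_mul_monomial α β (1 : ℂ) 1
    rw [one_mul] at this
    exact this.symm)

theorem rename_monomial (e : σ ↪ τ) (α : σ →₀ ℕ) :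
    rename e (monomial α) = monomial (Finsupp.embDomain e α) :=
  Subtype.ext (by rw [Finsupp.embDomain_eq_mapDomain]; exact MvPowerSeries.rename_monomial _ _ _)

theorem monomial_mem_pow {I : Ideal (ConvSeries σ)} (hI : ∀ i, X i ∈ I) (α : σ →₀ ℕ) :
    monomial α ∈ I ^ α.degree := by
  induction α using Finsupp.induction_linear with
  | zero => simp
  | add α β hα hβ =>
    rw [map_add, pow_add, monomial_add]
    exact Ideal.mul_mem_mul hα hβ
  | single i n =>
    rw [Finsupp.degree_single, show monomial (Finsupp.single i n) = (X i : ConvSeries σ) ^ n from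
      Subtype.ext (MvPowerSeries.X_pow_eq i n).symm]
    exact Ideal.pow_mem_pow (hI i) n

theorem coeff_mul_monomial (p : ConvSeries σ) (α β : σ →₀ ℕ) :
    coeff β (p * monomial α) = open Classical in if α ≤ β then coeff (β - α) p else 0 := by
  classical
  have := MvPowerSeries.coeff_mul_monomial β α p.1 1
  rw [mul_one] at this
  refine this.trans ?_
  split_ifs <;> rfl

theorem mem_maximalIdeal_iff_mem_span_X [Finite σ] {p : ConvSeries σ} :
    p ∈ IsLocalRing.maximalIdeal (ConvSeries σ) ↔ p ∈ Ideal.span (Set.range (X (σ := σ))) := by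
  rw [mem_maximalIdeal, ← Set.image_univ, mem_span_X_iff, constCoeff_eq_coeff]
  refine ⟨fun h α hα => ?_, fun h => h 0 fun _ _ => rfl⟩
  rwa [show α = 0 from Finsupp.ext fun i => hα i trivial]

theorem maximalIdeal_eq_span_X [Finite σ] :
    IsLocalRing.maximalIdeal (ConvSeries σ) = Ideal.span (Set.range X) :=
  Ideal.ext fun _ => mem_maximalIdeal_iff_mem_span_X

/-! ### Finiteness over the base -/

variable {ι κ : Type}

/-- The coefficient of `x^β` of a function of `x` and `u`. -/
def fibreCoeff (β : ι →₀ ℕ) (p : ConvSeries (ι ⊕ κ)) : ConvSeries κ :=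
  ⟨fun γ => coeff (Finsupp.embDomain .inl β + Finsupp.embDomain .inr γ) p, by
    obtain ⟨r, hr, hp⟩ := p.2
    refine ⟨r, hr, ((hp.comp_injective ((add_right_injective (Finsupp.embDomain .inl β)).comp
      (Finsupp.embDomain_injective (.inr : κ ↪ ι ⊕ κ)))).mul_right ((r ^ β.degree)⁻¹)).congr
        fun γ => ?_⟩
    simp only [Function.comp_apply, map_add, degree_embDomain, pow_add]
    rw [mul_comm (r ^ β.degree), ← mul_assoc, mul_assoc, mul_inv_cancel₀ (by positivity), mul_one]
    rfl⟩

theorem coeff_fibreCoeff (β : ι →₀ ℕ) (p : ConvSeries (ι ⊕ κ)) (γ : κ →₀ ℕ) :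
    coeff γ (fibreCoeff β p) = coeff (Finsupp.embDomain .inl β + Finsupp.embDomain .inr γ) p := rfl

theorem exists_eq_embDomain_inl_add_inr (δ : ι ⊕ κ →₀ ℕ) :
    ∃ (β : ι →₀ ℕ) (γ : κ →₀ ℕ), δ = Finsupp.embDomain .inl β + Finsupp.embDomain .inr γ := by
  refine ⟨δ.comapDomain Sum.inl Sum.inl_injective.injOn,
    δ.comapDomain Sum.inr Sum.inr_injective.injOn, ?_⟩
  ext (i | j)
  · have h1 := Finsupp.embDomain_apply_self (.inl : ι ↪ ι ⊕ κ)
      (δ.comapDomain Sum.inl Sum.inl_injective.injOn) i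
    have h2 := Finsupp.embDomain_of_notMem_range (.inr : κ ↪ ι ⊕ κ)
      (δ.comapDomain Sum.inr Sum.inr_injective.injOn) (Sum.inl i) (by simp)
    simp only [Function.Embedding.inl_apply] at h1
    rw [Finsupp.add_apply, h1, h2, Finsupp.comapDomain_apply, add_zero]
  · have h1 := Finsupp.embDomain_apply_self (.inr : κ ↪ ι ⊕ κ)
      (δ.comapDomain Sum.inr Sum.inr_injective.injOn) j
    have h2 := Finsupp.embDomain_of_notMem_range (.inl : ι ↪ ι ⊕ κ)
      (δ.comapDomain Sum.inl Sum.inl_injective.injOn) (Sum.inr j) (by simp)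
    simp only [Function.Embedding.inr_apply] at h1
    rw [Finsupp.add_apply, h1, h2, Finsupp.comapDomain_apply, zero_add]

theorem embDomain_inl_add_inr_apply_inl (β : ι →₀ ℕ) (γ : κ →₀ ℕ) (i : ι) :
    (Finsupp.embDomain .inl β + Finsupp.embDomain .inr γ : ι ⊕ κ →₀ ℕ) (.inl i) = β i := by
  rw [Finsupp.add_apply, Finsupp.embDomain_of_notMem_range (.inr : κ ↪ ι ⊕ κ) γ _ (by simp),
    add_zero]
  exact Finsupp.embDomain_apply_self (.inl : ι ↪ ι ⊕ κ) β i

/-- Sort the monomials by their x-part; only those with x-exponent in `S` occur. -/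
theorem eq_sum_fibreCoeff {S : Finset (ι →₀ ℕ)} {p : ConvSeries (ι ⊕ κ)}
    (h : ∀ β ∉ S, fibreCoeff β p = 0) :
    p = ∑ β ∈ S, rename .inr (fibreCoeff β p) * monomial (Finsupp.embDomain .inl β) := by
  classical
  refine ext_coeff fun δ => ?_
  obtain ⟨β, γ, rfl⟩ := exists_eq_embDomain_inl_add_inr δ
  have key (β' : ι →₀ ℕ) : coeff (Finsupp.embDomain .inl β + Finsupp.embDomain .inr γ)
      (rename .inr (fibreCoeff β' p) * monomial (Finsupp.embDomain .inl β')) =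
        if β' = β then coeff (Finsupp.embDomain .inl β + Finsupp.embDomain .inr γ) p else 0 := by
    rw [coeff_mul_monomial]
    split_ifs with h1 h2 h2
    · subst h2
      rw [add_tsub_cancel_left, coeff_embDomain_rename, coeff_fibreCoeff]
    · have h3 : ∃ i, β' i ≠ β i := Finsupp.ne_iff.1 h2
      obtain ⟨i, hi⟩ := h3
      refine coeff_rename_eq_zero _ _ (j := .inl i) (by simp) ?_
      have h4 := h1 (.inl i)
      have h5 := Finsupp.embDomain_apply_self (.inl : ι ↪ ι ⊕ κ) β' i
      simp only [Function.Embedding.inl_apply] at h5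
      rw [embDomain_inl_add_inr_apply_inl, h5] at h4
      rw [Finsupp.tsub_apply, embDomain_inl_add_inr_apply_inl, h5]
      lia
    · subst h2
      exact absurd le_self_add h1
    · rfl
  rw [map_sum]
  simp only [key]
  rw [Finset.sum_ite_eq']
  split_ifs with h1
  · rfl
  · rw [← coeff_fibreCoeff, h β h1, map_zero]

/-- **Weierstrass finiteness**: a space germ over `ℂ^κ` whose fibre over the origin is a fat point
is finite over `ℂ^κ`. -/
theorem exists_sum_sub_mem [Finite ι] [Finite κ] {I : Ideal (ConvSeries (ι ⊕ κ))} {k : ℕ}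
    (hI : ∀ α : ι →₀ ℕ, α.degree = k →
      rename .inl (monomial α) ∈ I ⊔ Ideal.span (Set.range fun j : κ => X (.inr j))) :
    ∃ S : Finset (ι →₀ ℕ), ∀ q : ConvSeries (ι ⊕ κ), ∃ c : (ι →₀ ℕ) → ConvSeries κ,
      q - ∑ β ∈ S, rename .inr (c β) * rename .inl (monomial β) ∈ I := by
  classical
  have := Fintype.ofFinite κ
  have := (Finsupp.finite_of_degree_eq (σ := ι) k).fintype
  let L := {α : ι →₀ ℕ | α.degree = k}
  have h1 (α : L) : ∃ f ∈ I, ∃ b : κ → ConvSeries (ι ⊕ κ),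
      rename .inl (monomial α.1) = f + ∑ j, b j * X (.inr j) := by
    obtain ⟨f, hf, g, hg, hfg⟩ := Submodule.mem_sup.1 (hI α.1 α.2)
    obtain ⟨b, rfl⟩ := Ideal.mem_span_range_iff_exists_fun.1 hg
    exact ⟨f, hf, b, hfg.symm⟩
  choose f hf b hb using h1
  refine ⟨(Finsupp.finite_of_degree_le (σ := ι) k).toFinset, fun q => ?_⟩
  obtain ⟨s, hs, hsq⟩ := exists_wnorm_ne_top q
  obtain ⟨s', hs', hsb⟩ := exists_forall_wnorm_ne_top fun x : L × κ => b x.1 x.2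
  set r := min s s'
  have hr : 0 < r := lt_min hs hs'
  let W : ℝ≥0∞ := ∑ α : L, ∑ j, wnorm (fun _ => r) (b α j).1
  have hW : W ≠ ⊤ := ENNReal.sum_ne_top.2 fun α _ => ENNReal.sum_ne_top.2 fun j _ =>
    hsb _ (fun _ => min_le_right _ _) (α, j)
  -- The element `f α` of the ideal is x^α minus ∑ b_j u_j. With radius `r` in the fibre the weight
  -- of x^α is r^k, and a small enough radius `t` in the base makes the perturbation at most half of
  -- it.
  obtain ⟨t, ht, htW⟩ := ENNReal.exists_nnreal_pos_mul_lt (b := 2⁻¹ * (r : ℝ≥0∞) ^ k) hW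
    (mul_ne_zero (by simp) (pow_ne_zero _ (by simpa using hr.ne')))
  let ρ : ι ⊕ κ → ℝ≥0 := Sum.elim (fun _ => r) (fun _ => min r t)
  have hρ : ∀ i, 0 < ρ i := by
    rintro (i | j)
    · exact hr
    · exact lt_min hr ht
  have hρr : ∀ i, ρ i ≤ r := by
    rintro (i | j)
    · exact le_rfl
    · exact min_le_left _ _
  have hw (α : ι →₀ ℕ) : weight ρ (Finsupp.embDomain .inl α) = (r : ℝ≥0∞) ^ α.degree := by
    rw [weight, Finsupp.prod_embDomain, ← MvPowerSeries.weight_const]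
    rfl
  obtain ⟨c, q', hq', hq⟩ := exists_division (fun α : L => Finsupp.embDomain .inl α.1) hρ f
    (fun α => by
      have h2 : (f α).1 - MvPowerSeries.monomial (Finsupp.embDomain .inl α.1) 1 =
          -∑ j, (b α j).1 * (X (.inr j) : ConvSeries (ι ⊕ κ)).1 := by
        have h3 := hb α
        rw [rename_monomial] at h3
        have h4 := congrArg Subtype.val h3
        rw [show (monomial (Finsupp.embDomain .inl α.1) : ConvSeries (ι ⊕ κ)).1 =
          MvPowerSeries.monomial (Finsupp.embDomain .inl α.1) 1 from rfl] at h4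
        rw [h4]
        simp
      rw [h2, MvPowerSeries.wnorm_neg, hw, show α.1.degree = k from α.2]
      refine le_trans ?_ htW.le
      refine (MvPowerSeries.wnorm_sum_le _ _ _).trans ?_
      refine le_trans ?_ (mul_le_mul_right (Finset.single_le_sum
        (f := fun α : L => ∑ j, wnorm (fun _ => r) (b α j).1) (fun _ _ => zero_le)
        (Finset.mem_univ α)) _)
      rw [Finset.mul_sum]
      refine Finset.sum_le_sum fun j _ => (MvPowerSeries.wnorm_mul_le _ _ _).trans ?_
      rw [mul_comm]
      refine mul_le_mul' ?_ (MvPowerSeries.wnorm_mono hρr _)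
      have h5 : wnorm ρ (X (.inr j) : ConvSeries (ι ⊕ κ)).1 = ρ (.inr j) := by
        have := MvPowerSeries.wnorm_monomial ρ (Finsupp.single (.inr j) 1) 1
        rw [MvPowerSeries.weight_single, pow_one, enorm_one, one_mul] at this
        exact this
      rw [h5]
      exact ENNReal.coe_le_coe.2 (min_le_right _ _))
    (q := q) (hsq _ fun i => (hρr i).trans (min_le_left _ _))
  refine ⟨fun β => fibreCoeff β q', ?_⟩
  -- The remainder contains no monomial divisible by any x^α of degree `k`, so it is a polynomial in
  -- x with coefficients from the base.
  have h6 : q' = ∑ β ∈ (Finsupp.finite_of_degree_le (σ := ι) k).toFinset,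
      rename .inr (fibreCoeff β q') * monomial (Finsupp.embDomain .inl β) := by
    refine eq_sum_fibreCoeff fun β hβ => ext_coeff fun γ => ?_
    rw [coeff_fibreCoeff, map_zero]
    have hβ' : k ≤ β.degree := by
      simp only [Set.Finite.mem_toFinset, Set.mem_ofPred_eq, not_le] at hβ
      exact hβ.le
    obtain ⟨α, hα, hαβ⟩ : ∃ α : ι →₀ ℕ, α ≤ β ∧ α.degree = k :=
      Finsupp.exists_le_degree_eq β k hβ'
    refine hq' _ ⟨⟨α, hαβ⟩, ?_⟩
    refine le_trans (fun j => ?_) le_self_add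
    by_cases hj : j ∈ Set.range (.inl : ι ↪ ι ⊕ κ)
    · obtain ⟨i, rfl⟩ := hj
      rw [Finsupp.embDomain_apply_self, Finsupp.embDomain_apply_self]
      exact hα i
    · rw [Finsupp.embDomain_of_notMem_range _ _ _ hj]
      exact zero_le
  simp only [rename_monomial]
  rw [← h6]
  have h7 : q - q' = ∑ α : L, c α * f α := by
    nth_rewrite 1 [hq]
    ring
  rw [h7]
  exact sum_mem fun α _ => Ideal.mul_mem_left _ _ (hf α)

end ConvSeries

/-! ### Regular sequences in Noetherian local rings -/

section RegularSequences

open IsLocalRing RingTheory.Sequence Pointwise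

variable {R : Type} [CommRing R]

theorem mem_smul_top_iff {M : Type} [AddCommGroup M] [Module R M] {r : R} {v : M} :
    v ∈ r • (⊤ : Submodule R M) ↔ ∃ w, v = r • w := by
  rw [Submodule.mem_smul_pointwise_iff_exists]
  exact ⟨fun ⟨w, _, h⟩ => ⟨w, h.symm⟩, fun ⟨w, h⟩ => ⟨w, trivial, h.symm⟩⟩

theorem ofList_singleton_smul_top (M : Type) [AddCommGroup M] [Module R M] (r : R) :
    (Ideal.ofList [r] • ⊤ : Submodule R M) = r • ⊤ := by
  rw [Ideal.ofList_singleton, Submodule.ideal_span_singleton_smul]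

/-- The order of the quotients by two elements may be interchanged. -/
def quotSMulTopComm (M : Type) [AddCommGroup M] [Module R M] (y w : R) :
    QuotSMulTop w (QuotSMulTop y M) ≃ₗ[R] QuotSMulTop y (QuotSMulTop w M) :=
  (QuotSMulTop.congr w (Submodule.quotEquivOfEq _ _ (ofList_singleton_smul_top M y).symm)) ≪≫ₗ
    (Submodule.quotOfListConsSMulTopEquivQuotSMulTopOuter M w [y]).symm ≪≫ₗ
    Submodule.quotOfListConsSMulTopEquivQuotSMulTopInner M w [y] ≪≫ₗ
    Submodule.quotEquivOfEq _ _ (ofList_singleton_smul_top _ y)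

theorem mem_smul_top_self_iff {I : Ideal R} {x : R} : x ∈ (I • ⊤ : Submodule R R) ↔ x ∈ I := by
  rw [smul_eq_mul, Ideal.mul_top]

variable [IsLocalRing R]

/-- The socle of `M` is a cyclic module. -/
def SocleIsCyclic (R : Type) [CommRing R] [IsLocalRing R] (M : Type) [AddCommGroup M]
    [Module R M] : Prop :=
  ∃ s : M, (∀ r ∈ maximalIdeal R, r • s = 0) ∧
    ∀ t : M, (∀ r ∈ maximalIdeal R, r • t = 0) → ∃ c : R, t = c • s

/-- There is an `M`-regular sequence of length `d` in the maximal ideal, modulo which `M` has a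
cyclic socle. -/
def HasDepthSocle (R : Type) [CommRing R] [IsLocalRing R] :
    ℕ → (M : Type) → [AddCommGroup M] → [Module R M] → Prop
  | 0, M, _, _ => SocleIsCyclic R M
  | d + 1, M, _, _ => ∃ y ∈ maximalIdeal R, IsSMulRegular M y ∧ HasDepthSocle R d (QuotSMulTop y M)

theorem SocleIsCyclic.congr {M N : Type} [AddCommGroup M] [Module R M] [AddCommGroup N]
    [Module R N] (e : M ≃ₗ[R] N) (h : SocleIsCyclic R M) : SocleIsCyclic R N := by
  obtain ⟨s, hs, h⟩ := h
  refine ⟨e s, fun r hr => by rw [← map_smul, hs r hr, map_zero], fun t ht => ?_⟩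
  obtain ⟨c, hc⟩ := h (e.symm t) fun r hr => by rw [← map_smul, ht r hr, map_zero]
  exact ⟨c, by rw [← map_smul, ← hc, e.apply_symm_apply]⟩

theorem HasDepthSocle.congr {d : ℕ} {M N : Type} [AddCommGroup M] [Module R M] [AddCommGroup N]
    [Module R N] (e : M ≃ₗ[R] N) (h : HasDepthSocle R d M) : HasDepthSocle R d N := by
  induction d generalizing M N with
  | zero => exact SocleIsCyclic.congr e h
  | succ d ih =>
    obtain ⟨y, hy, hreg, h⟩ := h
    exact ⟨y, hy, (e.isSMulRegular_congr y).1 hreg, ih (QuotSMulTop.congr y e) h⟩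

theorem hasDepthSocle_of_isWeaklyRegular {as : List R} {M : Type} [AddCommGroup M] [Module R M]
    (has : ∀ a ∈ as, a ∈ maximalIdeal R) (h : IsWeaklyRegular M as)
    (hs : SocleIsCyclic R (M ⧸ (Ideal.ofList as • ⊤ : Submodule R M))) :
    HasDepthSocle R as.length M := by
  induction as generalizing M with
  | nil =>
    exact hs.congr (Submodule.quotEquivOfEqBot _ (by rw [Ideal.ofList_nil, Submodule.bot_smul]))
  | cons a as ih =>
    rw [isWeaklyRegular_cons_iff] at h
    exact ⟨a, has a (by simp), h.1, ih (fun b hb => has b (by simp [hb])) h.2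
      (hs.congr (Submodule.quotOfListConsSMulTopEquivQuotSMulTopInner M a as))⟩

/-- The two socles correspond: if `s` represents a socle element modulo `y`, then z s = y s' for
some `s'`, and `s'` represents a socle element modulo `z`. The rule is symmetric in `y` and `z`;
both socles compute Ext¹ of the residue field into `M`. -/
theorem socleIsCyclic_quotSMulTop {M : Type} [AddCommGroup M] [Module R M] {y z : R}
    (hy : y ∈ maximalIdeal R) (hz : z ∈ maximalIdeal R) (hyM : IsSMulRegular M y)
    (hzM : IsSMulRegular M z) (h : SocleIsCyclic R (QuotSMulTop y M)) :
    SocleIsCyclic R (QuotSMulTop z M) := by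
  have key {y : R} (v : M) : (∀ r ∈ maximalIdeal R, r • (Submodule.Quotient.mk v :
      QuotSMulTop y M) = 0) ↔ ∀ r ∈ maximalIdeal R, ∃ w, r • v = y • w := by
    simp only [← Submodule.Quotient.mk_smul, Submodule.Quotient.mk_eq_zero, mem_smul_top_iff]
  obtain ⟨s, hs, h⟩ := h
  obtain ⟨s, rfl⟩ := Submodule.Quotient.mk_surjective _ s
  rw [key] at hs
  obtain ⟨s', hs'⟩ := hs z hz
  refine ⟨Submodule.Quotient.mk s', (key s').2 fun r hr => ?_, fun t' ht' => ?_⟩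
  · obtain ⟨w, hw⟩ := hs r hr
    refine ⟨w, hyM ?_⟩
    change y • r • s' = y • z • w
    rw [smul_comm y r, ← hs', smul_comm r z, hw, smul_comm]
  · obtain ⟨t', rfl⟩ := Submodule.Quotient.mk_surjective _ t'
    rw [key] at ht'
    obtain ⟨t, ht⟩ := ht' y hy
    obtain ⟨c, hc⟩ := h (Submodule.Quotient.mk t) ((key t).2 fun r hr => by
      obtain ⟨w, hw⟩ := ht' r hr
      refine ⟨w, hzM ?_⟩
      change z • r • t = z • y • w
      rw [smul_comm z r, ← ht, smul_comm r y, hw, smul_comm])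
    rw [← Submodule.Quotient.mk_smul, ← sub_eq_zero, ← Submodule.Quotient.mk_sub,
      Submodule.Quotient.mk_eq_zero, mem_smul_top_iff] at hc
    obtain ⟨w, hw⟩ := hc
    refine ⟨c, ?_⟩
    rw [← Submodule.Quotient.mk_smul, ← sub_eq_zero, ← Submodule.Quotient.mk_sub,
      Submodule.Quotient.mk_eq_zero, mem_smul_top_iff]
    refine ⟨w, hyM ?_⟩
    change y • (t' - c • s') = y • z • w
    rw [smul_sub, ht, smul_comm y c, ← hs', smul_comm c z, ← smul_sub, hw, smul_comm]

/-- The socle of `M / y M` vanishes if that of `M / z M` does. -/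
theorem socle_quotSMulTop_eq_zero {M : Type} [AddCommGroup M] [Module R M] {y z : R}
    (hy : y ∈ maximalIdeal R) (hyM : IsSMulRegular M y)
    (hzM : IsSMulRegular M z)
    (h : ∀ t : QuotSMulTop y M, (∀ r ∈ maximalIdeal R, r • t = 0) → t = 0)
    (t : QuotSMulTop z M) (ht : ∀ r ∈ maximalIdeal R, r • t = 0) : t = 0 := by
  have key {y : R} (v : M) : (∀ r ∈ maximalIdeal R, r • (Submodule.Quotient.mk v :
      QuotSMulTop y M) = 0) ↔ ∀ r ∈ maximalIdeal R, ∃ w, r • v = y • w := by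
    simp only [← Submodule.Quotient.mk_smul, Submodule.Quotient.mk_eq_zero, mem_smul_top_iff]
  obtain ⟨t, rfl⟩ := Submodule.Quotient.mk_surjective _ t
  rw [key] at ht
  obtain ⟨t', ht'⟩ := ht y hy
  have h1 := h (Submodule.Quotient.mk t') ((key t').2 fun r hr => by
    obtain ⟨w, hw⟩ := ht r hr
    refine ⟨w, hzM ?_⟩
    change z • r • t' = z • y • w
    rw [smul_comm z r, ← ht', smul_comm r y, hw, smul_comm])
  rw [Submodule.Quotient.mk_eq_zero, mem_smul_top_iff] at h1 ⊢
  obtain ⟨w, hw⟩ := h1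
  refine ⟨w, hyM ?_⟩
  change y • t = y • z • w
  rw [ht', hw, smul_comm]

variable [IsNoetherianRing R]

/-- The socle is the module of homomorphisms from the residue field, and its vanishing is equivalent
to the existence of a regular element in the maximal ideal. -/
theorem exists_isSMulRegular_of_socle_eq_zero {M : Type} [AddCommGroup M] [Module R M]
    [Module.Finite R M] (h : ∀ t : M, (∀ r ∈ maximalIdeal R, r • t = 0) → t = 0) :
    ∃ w ∈ maximalIdeal R, IsSMulRegular M w := by
  have : Subsingleton ((R ⧸ maximalIdeal R) →ₗ[R] M) := by
    refine subsingleton_of_forall_eq 0 fun f => ?_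
    have h1 : f 1 = 0 := h _ fun r hr => by
      rw [← map_smul, Algebra.smul_def, mul_one, show algebraMap R (R ⧸ maximalIdeal R) r = 0 from
        Ideal.Quotient.eq_zero_iff_mem.2 hr, map_zero]
    ext
    simpa using h1
  obtain ⟨r, hr, hreg⟩ := IsSMulRegular.subsingleton_linearMap_iff.1 this
  exact ⟨r, by rwa [Ideal.annihilator_quotient] at hr, hreg⟩

theorem isSMulRegular_swap {M : Type} [AddCommGroup M] [Module R M] [Module.Finite R M] {y w : R}
    (hy : y ∈ maximalIdeal R) (hw : w ∈ maximalIdeal R) (hyM : IsSMulRegular M y)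
    (hwM : IsSMulRegular (QuotSMulTop y M) w) :
    IsSMulRegular M w ∧ IsSMulRegular (QuotSMulTop w M) y := by
  have h : IsWeaklyRegular M [y, w] := by
    rw [isWeaklyRegular_cons_iff, isWeaklyRegular_singleton_iff]
    exact ⟨hyM, hwM⟩
  have h1 := IsLocalRing.isWeaklyRegular_of_perm_of_subset_maximalIdeal h (List.Perm.swap w y [])
    (by simpa using ⟨(mem_maximalIdeal y).1 hy, (mem_maximalIdeal w).1 hw⟩)
  rwa [isWeaklyRegular_cons_iff, isWeaklyRegular_singleton_iff] at h1

/-- Any regular element may serve as the first element of the regular sequence. -/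
theorem HasDepthSocle.quotSMulTop {d : ℕ} {M : Type} [AddCommGroup M] [Module R M]
    [Module.Finite R M] (h : HasDepthSocle R (d + 1) M) {z : R} (hz : z ∈ maximalIdeal R)
    (hzM : IsSMulRegular M z) : HasDepthSocle R d (QuotSMulTop z M) := by
  induction d generalizing M z with
  | zero =>
    obtain ⟨y, hy, hyM, h⟩ := h
    exact socleIsCyclic_quotSMulTop hy hz hyM hzM h
  | succ d ih =>
    obtain ⟨y, hy, hyM, h⟩ := h
    obtain ⟨y', hy', hy'M, _⟩ := id h
    have h1 (t : QuotSMulTop y M) (ht : ∀ r ∈ maximalIdeal R, r • t = 0) : t = 0 :=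
      hy'M.right_eq_zero_of_smul (ht y' hy')
    -- Both quotients have zero socle, and applying the criterion to their product gives one `w`
    -- regular on both. The exchange then goes from `y` to `w` and from `w` to `z`, each time by
    -- induction on a quotient.
    obtain ⟨w, hw, hwM⟩ := exists_isSMulRegular_of_socle_eq_zero
      (M := QuotSMulTop y M × QuotSMulTop z M) fun t ht => Prod.ext
        (h1 _ fun r hr => congrArg Prod.fst (ht r hr))
        (socle_quotSMulTop_eq_zero hy hyM hzM h1 _ fun r hr => congrArg Prod.snd (ht r hr))
    have hwy : IsSMulRegular (QuotSMulTop y M) w :=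
      hwM.of_injective (LinearMap.inl R _ _) LinearMap.inl_injective
    have hwz : IsSMulRegular (QuotSMulTop z M) w :=
      hwM.of_injective (LinearMap.inr R _ _) LinearMap.inr_injective
    obtain ⟨hwM', hyw⟩ := isSMulRegular_swap hy hw hyM hwy
    obtain ⟨-, hzw⟩ := isSMulRegular_swap hz hw hzM hwz
    have h2 : HasDepthSocle R (d + 1) (QuotSMulTop w M) :=
      ⟨y, hy, hyw, (ih h hw hwy).congr (quotSMulTopComm M y w)⟩
    exact ⟨w, hw, hwz, (ih h2 hz hzw).congr (quotSMulTopComm M w z)⟩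

/-- Let `N` be the submodule killed by `p`. If `N` were contained in yM, regularity of `y` would
give N = yN, and Nakayama's lemma N = 0. So some element of `N` survives modulo `y`; it is killed by
`p` and by `y`, and any associated prime above its annihilator will do. -/
theorem exists_associatedPrime_quotSMulTop {M : Type} [AddCommGroup M] [Module R M]
    [Module.Finite R M] {y : R} (hy : y ∈ maximalIdeal R) (hyM : IsSMulRegular M y) {p : Ideal R}
    (hp : p ∈ associatedPrimes R M) :
    ∃ q ∈ associatedPrimes R (QuotSMulTop y M), p ≤ q ∧ y ∈ q := by
  obtain ⟨hprime, x, hx⟩ := isAssociatedPrime_iff.1 (AssociatedPrimes.mem_iff.1 hp)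
  let N : Submodule R M :=
    { carrier := {v | ∀ r ∈ p, r • v = 0}
      zero_mem' := fun r _ => smul_zero r
      add_mem' := fun ha hb r hr => by rw [smul_add, ha r hr, hb r hr, add_zero]
      smul_mem' := fun c v hv r hr => by rw [smul_comm, hv r hr, smul_zero] }
  have hxN : x ∈ N := fun r hr => by
    rw [hx, Submodule.mem_colon_singleton] at hr
    simpa using hr
  have hx0 : x ≠ 0 := by
    rintro rfl
    refine hprime.ne_top (eq_top_iff.2 fun r _ => ?_)
    rw [hx, Submodule.mem_colon_singleton]
    simp
  obtain ⟨z, hz, hzy⟩ : ∃ z ∈ N, z ∉ y • (⊤ : Submodule R M) := by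
    by_contra! h
    have h1 : N ≤ Ideal.span {y} • N := fun z hz => by
      obtain ⟨w, rfl⟩ := mem_smul_top_iff.1 (h z hz)
      refine Submodule.smul_mem_smul (Ideal.mem_span_singleton_self y) fun r hr => hyM ?_
      change y • r • w = y • 0
      rw [smul_zero, smul_comm, hz r hr]
    have h2 := Submodule.eq_bot_of_le_smul_of_le_jacobson_bot _ N (IsNoetherian.noetherian N) h1
      ((Ideal.span_singleton_le_iff_mem _).2 (maximalIdeal_le_jacobson _ hy))
    exact hx0 (by simpa [h2] using hxN)
  obtain ⟨q, hq, hzq⟩ := exists_le_isAssociatedPrime_of_isNoetherianRing R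
    (Submodule.Quotient.mk z : QuotSMulTop y M)
    fun h => hzy ((Submodule.Quotient.mk_eq_zero _).1 h)
  refine ⟨q, hq, fun r hr => hzq ?_, hzq ?_⟩
  · rw [Submodule.mem_colon_singleton, ← Submodule.Quotient.mk_smul, hz r hr]
    simp
  · rw [Submodule.mem_colon_singleton, ← Submodule.Quotient.mk_smul, Submodule.mem_bot,
      Submodule.Quotient.mk_eq_zero]
    exact mem_smul_top_iff.2 ⟨z, rfl⟩

/-- Passing to the quotient by `y` enlarges `p` to an associated prime containing `y`, while `y` is
not in `p`. So the dimension drops by at least one for each element of the regular sequence. -/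
theorem HasDepthSocle.le_ringKrullDim {d : ℕ} {M : Type} [AddCommGroup M] [Module R M]
    [Module.Finite R M] (h : HasDepthSocle R d M) {p : Ideal R} (hp : p ∈ associatedPrimes R M) :
    (d : WithBot ℕ∞) ≤ ringKrullDim (R ⧸ p) := by
  induction d generalizing M p with
  | zero =>
    have := (AssociatedPrimes.mem_iff.1 hp).isPrime
    simpa using ringKrullDim_nonneg_of_nontrivial
  | succ d ih =>
    obtain ⟨y, hy, hyM, h⟩ := h
    obtain ⟨q, hq, hpq, hyq⟩ := exists_associatedPrime_quotSMulTop hy hyM hp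
    have hprime := (AssociatedPrimes.mem_iff.1 hp).isPrime
    have hyp : y ∉ p := fun h1 => by
      have h2 : y ∈ ⋃ p ∈ associatedPrimes R M, (p : Set R) := Set.mem_biUnion hp h1
      rw [biUnion_associatedPrimes_eq_compl_regular] at h2
      exact h2 hyM
    have h3 : Ideal.Quotient.mk p y ∈ nonZeroDivisors (R ⧸ p) :=
      mem_nonZeroDivisors_of_ne_zero fun h4 => hyp (Ideal.Quotient.eq_zero_iff_mem.1 h4)
    have h4 := ringKrullDim_quotient_succ_le_of_nonZeroDivisor h3
    refine le_trans ?_ h4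
    push_cast
    gcongr
    refine (ih h hq).trans ?_
    refine ringKrullDim_le_of_surjective (Ideal.Quotient.lift (Ideal.span {Ideal.Quotient.mk p y})
      (Ideal.Quotient.factor hpq) fun a ha => ?_) ?_
    · obtain ⟨b, rfl⟩ := Ideal.mem_span_singleton'.1 ha
      rw [map_mul, Ideal.Quotient.factor_mk, Ideal.Quotient.eq_zero_iff_mem.2 hyq, mul_zero]
    · exact Ideal.Quotient.lift_surjective_of_surjective _ _ (Ideal.Quotient.factor_surjective hpq)

/-- Krull's height theorem in R/p: the maximal ideal is minimal over the images of `as`. -/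
theorem ringKrullDim_quotient_le_length {p : Ideal R} (hp : p ≠ ⊤) {as : List R}
    (has : ∀ a ∈ as, a ∈ maximalIdeal R) (h : maximalIdeal R ≤ (p ⊔ Ideal.ofList as).radical) :
    ringKrullDim (R ⧸ p) ≤ as.length := by
  classical
  have : Nontrivial (R ⧸ p) := Ideal.Quotient.nontrivial_iff.2 hp
  have := IsLocalRing.of_surjective' (Ideal.Quotient.mk p) Ideal.Quotient.mk_surjective
  rw [← IsLocalRing.maximalIdeal_height_eq_ringKrullDim]
  let s : Finset (R ⧸ p) := (as.map (Ideal.Quotient.mk p)).toFinset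
  have hs : s.card ≤ as.length := (List.toFinset_card_le _).trans (by simp)
  have hmin : maximalIdeal (R ⧸ p) ∈ (Ideal.span (s : Set (R ⧸ p))).minimalPrimes := by
    refine ⟨⟨inferInstance, Ideal.span_le.2 fun b hb => ?_⟩, fun q ⟨hq, hqs⟩ _ => ?_⟩
    · simp only [s, List.coe_toFinset, List.mem_map, Set.mem_ofPred_eq] at hb
      obtain ⟨a, ha, rfl⟩ := hb
      exact (mem_maximalIdeal _).2 fun hu => ((mem_maximalIdeal a).1 (has a ha))
        (by
          obtain ⟨b, hb⟩ := hu.exists_right_inv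
          obtain ⟨b, rfl⟩ := Ideal.Quotient.mk_surjective b
          rw [← map_mul, ← map_one (Ideal.Quotient.mk p), Ideal.Quotient.eq] at hb
          have h1 := le_maximalIdeal hp hb
          by_contra h2
          have h3 := sub_mem ((maximalIdeal R).mul_mem_right b ((mem_maximalIdeal a).2 h2)) h1
          rw [sub_sub_cancel] at h3
          exact (Ideal.ne_top_iff_one _).1 (maximalIdeal.isMaximal R).ne_top h3)
    · intro b hb
      obtain ⟨b, rfl⟩ := Ideal.Quotient.mk_surjective b
      have hb' : b ∈ maximalIdeal R := (mem_maximalIdeal b).2 fun hu =>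
        (mem_maximalIdeal _).1 hb (hu.map _)
      have h1 : (p ⊔ Ideal.ofList as) ≤ q.comap (Ideal.Quotient.mk p) := by
        refine sup_le (fun c hc => ?_) (Ideal.span_le.2 fun c hc => hqs (Ideal.subset_span ?_))
        · rw [Ideal.mem_comap, Ideal.Quotient.eq_zero_iff_mem.2 hc]
          exact zero_mem _
        · simp only [s, List.coe_toFinset, List.mem_map, Set.mem_ofPred_eq]
          exact ⟨c, hc, rfl⟩
      have := hq.comap (Ideal.Quotient.mk p)
      exact (Ideal.IsPrime.radical_le_iff this).2 h1 (h hb')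
  have := Ideal.height_le_card_of_mem_minimalPrimes_span_finset hmin
  exact_mod_cast this.trans (by exact_mod_cast hs)

/-- In a Noetherian local ring with a regular sequence of length `d` (as in `HasDepthSocle`), all
systems of parameters of length `d` are regular sequences, and their quotients have cyclic socles. -/
theorem HasDepthSocle.isWeaklyRegular {as : List R} {M : Type} [AddCommGroup M] [Module R M]
    [Module.Finite R M] (h : HasDepthSocle R as.length M) (has : ∀ a ∈ as, a ∈ maximalIdeal R)
    (hrad : maximalIdeal R ≤ (Module.annihilator R M ⊔ Ideal.ofList as).radical) :
    IsWeaklyRegular M as ∧ SocleIsCyclic R (M ⧸ (Ideal.ofList as • ⊤ : Submodule R M)) := by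
  induction as generalizing M with
  | nil =>
    refine ⟨IsWeaklyRegular.nil R M, SocleIsCyclic.congr
      (Submodule.quotEquivOfEqBot _ ?_).symm h⟩
    rw [Ideal.ofList_nil, Submodule.bot_smul]
  | cons a as ih =>
    have hreg : IsSMulRegular M a := by
      -- Otherwise `a` lies in an associated prime `p`, so the remaining elements alone are
      -- parameters for R/p. Its dimension is then at most their number, one less than the lower
      -- bound from `HasDepthSocle.le_ringKrullDim`.
      by_contra hnot
      have h1 : a ∈ ⋃ p ∈ associatedPrimes R M, (p : Set R) := by
        rw [biUnion_associatedPrimes_eq_compl_regular]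
        exact hnot
      obtain ⟨p, hp, hap⟩ := Set.mem_iUnion₂.1 h1
      have h2 := h.le_ringKrullDim hp
      have hann : Module.annihilator R M ≤ p :=
        Submodule.annihilator_top.ge.trans (AssociatedPrimes.mem_iff.1 hp).annihilator_le
      have h3 := ringKrullDim_quotient_le_length (p := p) (as := as)
        (AssociatedPrimes.mem_iff.1 hp).isPrime.ne_top (fun b hb => has b (by simp [hb]))
        (hrad.trans (Ideal.radical_mono (by
          rw [Ideal.ofList_cons]
          exact sup_le (hann.trans le_sup_left) (sup_le
            (((Ideal.span_singleton_le_iff_mem _).2 hap).trans le_sup_left) le_sup_right))))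
      have h4 := h2.trans h3
      rw [List.length_cons] at h4
      exact absurd (WithBot.coe_le_coe.1 h4) (by norm_cast; lia)
    obtain ⟨h1, h2⟩ := ih (M := QuotSMulTop a M) (h.quotSMulTop (has a (by simp)) hreg)
      (fun b hb => has b (by simp [hb])) (hrad.trans (Ideal.radical_mono (by
        rw [Ideal.ofList_cons]
        refine sup_le (le_trans ?_ le_sup_left) (sup_le (le_trans ?_ le_sup_left) le_sup_right)
        · exact LinearMap.annihilator_le_of_surjective _ (Submodule.mkQ_surjective _)
        · exact (Ideal.span_singleton_le_iff_mem _).2 (QuotSMulTop.mem_annihilator M a))))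
    exact ⟨(isWeaklyRegular_cons_iff M a as).2 ⟨hreg, h1⟩,
      h2.congr (Submodule.quotOfListConsSMulTopEquivQuotSMulTopInner M a as).symm⟩

/-- Krull's intersection theorem. -/
theorem mem_of_forall_mem_sup_span_pow {I : Ideal R} {a : R} (ha : a ∈ maximalIdeal R) {x : R}
    (h : ∀ k : ℕ, x ∈ I ⊔ Ideal.span {a ^ k}) : x ∈ I := by
  have h1 : (Submodule.Quotient.mk x : R ⧸ I) ∈
      (⨅ i : ℕ, maximalIdeal R ^ i • (⊤ : Submodule R (R ⧸ I))) := by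
    rw [Submodule.mem_iInf]
    intro k
    obtain ⟨y, hy, z, hz, rfl⟩ := Submodule.mem_sup.1 (h k)
    obtain ⟨c, rfl⟩ := Ideal.mem_span_singleton'.1 hz
    rw [Submodule.Quotient.mk_add, (Submodule.Quotient.mk_eq_zero I).2 hy, zero_add, mul_comm,
      ← smul_eq_mul, Submodule.Quotient.mk_smul]
    exact Submodule.smul_mem_smul (Ideal.pow_mem_pow ha k) trivial
  rw [Ideal.iInf_pow_smul_eq_bot_of_isLocalRing _ (maximalIdeal.isMaximal R).ne_top] at h1
  exact (Submodule.Quotient.mk_eq_zero I).1 h1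

/-- By Krull's intersection theorem every x outside `I` is a^k x' modulo `I` with x' outside I +
(a). A product in `I` then yields, after cancelling the powers of `a`, a product in the prime I +
(a). -/
theorem isPrime_of_isPrime_sup_span {I : Ideal R} {a : R} (ha : a ∈ maximalIdeal R)
    (hreg : ∀ x, a * x ∈ I → x ∈ I) (h : (I ⊔ Ideal.span {a}).IsPrime) : I.IsPrime := by
  have key (x : R) (hx : x ∉ I) : ∃ k x', x' ∉ I ⊔ Ideal.span {a} ∧ x - a ^ k * x' ∈ I := by
    by_contra! hne
    refine hx (mem_of_forall_mem_sup_span_pow ha fun k => ?_)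
    induction k with
    | zero => simp
    | succ k ih =>
      obtain ⟨y, hy, z, hz, rfl⟩ := Submodule.mem_sup.1 ih
      obtain ⟨c, rfl⟩ := Ideal.mem_span_singleton'.1 hz
      have hc : c ∈ I ⊔ Ideal.span {a} := by
        by_contra hc
        exact hne k c hc (by rwa [mul_comm c, add_sub_cancel_right])
      obtain ⟨y', hy', z', hz', rfl⟩ := Submodule.mem_sup.1 hc
      obtain ⟨c', rfl⟩ := Ideal.mem_span_singleton'.1 hz'
      rw [add_mul, ← add_assoc]
      refine add_mem (Ideal.mem_sup_left (add_mem hy (I.mul_mem_right _ hy')))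
        (Ideal.mem_sup_right (Ideal.mem_span_singleton'.2 ⟨c', by ring⟩))
  have hpow (k : ℕ) (x : R) (hx : a ^ k * x ∈ I) : x ∈ I := by
    induction k with
    | zero => simpa using hx
    | succ k ih => exact ih (hreg _ (by rwa [← mul_assoc, ← pow_succ']))
  refine ⟨fun htop => h.ne_top (by rw [htop, top_sup_eq]), fun {x y} hxy => ?_⟩
  by_contra! hne
  obtain ⟨k, x', hx', hx⟩ := key x hne.1
  obtain ⟨l, y', hy', hy⟩ := key y hne.2
  have h1 : a ^ (k + l) * (x' * y') ∈ I := by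
    have h2 : a ^ (k + l) * (x' * y') = x * y - (x - a ^ k * x') * y -
        a ^ k * x' * (y - a ^ l * y') := by ring
    rw [h2]
    exact sub_mem (sub_mem hxy (I.mul_mem_right _ hx)) (I.mul_mem_left _ hy)
  rcases h.mem_or_mem (Ideal.mem_sup_left (hpow _ _ h1)) with h3 | h3
  · exact hx' h3
  · exact hy' h3

theorem isPrime_ofList_of_append {as bs : List R} (hbs : ∀ b ∈ bs, b ∈ maximalIdeal R)
    (hreg : IsWeaklyRegular R (as ++ bs)) (h : (Ideal.ofList (as ++ bs)).IsPrime) :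
    (Ideal.ofList as).IsPrime := by
  induction bs using List.reverseRecOn with
  | nil => simpa using h
  | append_singleton bs b ih =>
    rw [← List.append_assoc] at h hreg
    obtain ⟨h1, h2⟩ := (isWeaklyRegular_append_iff R _ _).1 hreg
    refine ih (fun c hc => hbs c (by simp [hc])) h1 ?_
    rw [Ideal.ofList_append, Ideal.ofList_singleton] at h
    refine isPrime_of_isPrime_sup_span (hbs b (by simp)) (fun x hx => ?_) h
    rw [isWeaklyRegular_singleton_iff, isSMulRegular_quotient_iff_mem_of_smul_mem] at h2
    exact mem_smul_top_self_iff.1 (h2 x (mem_smul_top_self_iff.2 hx))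

/-- Linear independence may be checked modulo a regular sequence. -/
theorem mem_of_sum_smul_mem {M J : Type} [AddCommGroup M] [Module R M] [Fintype J] (v : J → M)
    {I : Ideal R} {a : R} (ha : a ∈ maximalIdeal R)
    (hreg : ∀ x : M, a • x ∈ I • (⊤ : Submodule R M) → x ∈ I • (⊤ : Submodule R M))
    (h : ∀ c : J → R, ∑ j, c j • v j ∈ (I ⊔ Ideal.span {a}) • (⊤ : Submodule R M) →
      ∀ j, c j ∈ I ⊔ Ideal.span {a}) (c : J → R) (hc : ∑ j, c j • v j ∈ I • (⊤ : Submodule R M))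
    (j : J) : c j ∈ I := by
  have hpow (k : ℕ) (x : M) (hx : a ^ k • x ∈ I • (⊤ : Submodule R M)) :
      x ∈ I • (⊤ : Submodule R M) := by
    induction k with
    | zero => simpa using hx
    | succ k ih => exact ih (hreg _ (by rwa [← mul_smul, ← pow_succ']))
  -- The coefficients are divisible by every power of `a` modulo `I`: once a^k has been split off it
  -- may be cancelled, and the assumption modulo `a` gives the next factor.
  suffices key : ∀ k : ℕ, ∃ b d : J → R, (∀ j, b j ∈ I) ∧ ∀ j, c j = b j + a ^ k * d j by
    refine mem_of_forall_mem_sup_span_pow ha fun k => ?_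
    obtain ⟨b, d, hb, hbd⟩ := key k
    rw [hbd]
    exact add_mem (Ideal.mem_sup_left (hb j))
      (Ideal.mem_sup_right (Ideal.mem_span_singleton'.2 ⟨d j, mul_comm _ _⟩))
  intro k
  induction k with
  | zero => exact ⟨0, c, fun j => zero_mem _, fun j => by simp⟩
  | succ k ih =>
    obtain ⟨b, d, hb, hbd⟩ := ih
    have h1 : a ^ k • ∑ j, d j • v j ∈ I • (⊤ : Submodule R M) := by
      have h2 : a ^ k • ∑ j, d j • v j = ∑ j, c j • v j - ∑ j, b j • v j := by
        rw [← Finset.sum_sub_distrib, Finset.smul_sum]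
        refine Finset.sum_congr rfl fun j _ => ?_
        rw [hbd, add_smul, mul_smul, add_sub_cancel_left]
      rw [h2]
      exact sub_mem hc (sum_mem fun j _ => Submodule.smul_mem_smul (hb j) trivial)
    have h3 := h d (Submodule.smul_mono_left le_sup_left (hpow k _ h1))
    have h4 (j : J) : ∃ y ∈ I, ∃ e, d j = y + a * e := by
      obtain ⟨y, hy, z, hz, h5⟩ := Submodule.mem_sup.1 (h3 j)
      obtain ⟨e, rfl⟩ := Ideal.mem_span_singleton'.1 hz
      exact ⟨y, hy, e, by rw [← h5, mul_comm e]⟩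
    choose y hy e he using h4
    refine ⟨fun j => b j + a ^ k * y j, e, fun j => add_mem (hb j) (I.mul_mem_left _ (hy j)),
      fun j => ?_⟩
    rw [hbd, he]
    ring

theorem linearIndependent_of_isWeaklyRegular {M J : Type} [AddCommGroup M] [Module R M] [Fintype J]
    (v : J → M) {as : List R} (has : ∀ a ∈ as, a ∈ maximalIdeal R) (hreg : IsWeaklyRegular M as)
    (h : ∀ c : J → R, ∑ j, c j • v j ∈ Ideal.ofList as • (⊤ : Submodule R M) →
      ∀ j, c j ∈ Ideal.ofList as) : LinearIndependent R v := by
  rw [Fintype.linearIndependent_iff]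
  induction as using List.reverseRecOn with
  | nil =>
    intro c hc j
    simpa using h c (by simp [hc]) j
  | append_singleton as a ih =>
    obtain ⟨h1, h2⟩ := (isWeaklyRegular_append_iff M _ _).1 hreg
    rw [isWeaklyRegular_singleton_iff, isSMulRegular_quotient_iff_mem_of_smul_mem] at h2
    rw [Ideal.ofList_append, Ideal.ofList_singleton] at h
    exact ih (fun b hb => has b (by simp [hb])) h1
      (mem_of_sum_smul_mem v (has a (by simp)) h2 h)

end RegularSequences

/-! ### The self-extensions of a module with a symmetric presentation matrix -/

section Ext

variable {R B : Type} [CommRing R] [CommRing B] [Algebra R B]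

/-- Post-composition of a homomorphism with values in `B` with the connecting homomorphism of a
presentation of `B`. -/
def connectingHom (p : ℕ) (π : (Fin p → R) →ₗ[R] B) (hπ : Function.Surjective π) :
    (LinearMap.ker π →ₗ[R] B) →ₗ[B] SelfExt R B 1 where
  toFun f := (LinearMap.shortExact_shortComplexKer hπ).extClass.comp
    (Abelian.Ext.mk₀ (ModuleCat.ofHom f)) (add_zero 1)
  map_add' f f' := by
    rw [ModuleCat.ofHom_add, Abelian.Ext.mk₀_add, Abelian.Ext.comp_add]
    rfl
  map_smul' b f := by
    change _ = Abelian.Ext.comp (Abelian.Ext.comp _ _ _) (Abelian.Ext.mk₀ (mulEnd R B b)) _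
    rw [Abelian.Ext.comp_assoc_of_third_deg_zero, Abelian.Ext.mk₀_comp_mk₀]
    rfl

/-- The middle term of the presentation is free, so its first extension group vanishes. -/
theorem connectingHom_surjective (p : ℕ) (π : (Fin p → R) →ₗ[R] B) (hπ : Function.Surjective π) :
    Function.Surjective (connectingHom p π hπ) := by
  intro x
  have : Projective (LinearMap.shortComplexKer π).X₂ :=
    (IsProjective.iff_projective (Fin p → R)).1 inferInstance
  obtain ⟨y, hy⟩ := precomp_extClass_surjective_of_projective_X₂ (ModuleCat.of R B)
    (LinearMap.shortExact_shortComplexKer hπ) 0 x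
  obtain ⟨f, rfl⟩ := Abelian.Ext.addEquiv₀.symm.surjective y
  exact ⟨f.hom, hy⟩

/-- Exactness of the long sequence at Hom(ker π, B): the kernel consists of the restrictions from
the free module. -/
theorem mem_ker_connectingHom (p : ℕ) (π : (Fin p → R) →ₗ[R] B) (hπ : Function.Surjective π)
    (f : LinearMap.ker π →ₗ[R] B) :
    f ∈ LinearMap.ker (connectingHom p π hπ) ↔
      ∃ v : (Fin p → R) →ₗ[R] B, f = v ∘ₗ (LinearMap.ker π).subtype := by
  constructor
  · intro h
    obtain ⟨y, hy⟩ := Abelian.Ext.contravariant_sequence_exact₁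
      (LinearMap.shortExact_shortComplexKer hπ) (ModuleCat.of R B) _ (add_zero 1) h
    obtain ⟨v, rfl⟩ := Abelian.Ext.addEquiv₀.symm.surjective y
    refine ⟨v.hom, ?_⟩
    rw [Abelian.Ext.addEquiv₀_symm_apply, Abelian.Ext.mk₀_comp_mk₀] at hy
    have := Abelian.Ext.addEquiv₀.symm.injective hy
    exact (congrArg ModuleCat.Hom.hom this).symm
  · rintro ⟨v, rfl⟩
    have h1 : (LinearMap.shortExact_shortComplexKer hπ).extClass.comp
        ((Abelian.Ext.mk₀ (LinearMap.shortComplexKer π).f).comp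
          (Abelian.Ext.mk₀ (ModuleCat.ofHom v)) (zero_add 0)) (add_zero 1) = 0 := by
      rw [ShortComplex.ShortExact.extClass_comp_assoc]
    rw [Abelian.Ext.mk₀_comp_mk₀] at h1
    exact h1

end Ext

/-! ### Conductor elements, relations between the rows, and the reduced matrix -/

section SymmetricPresentation

variable {R B : Type} [CommRing R] [CommRing B] [Algebra R B] {m : ℕ}

/-- `χ` is a symmetric matrix whose rows generate the relations between the generators `g` of the
`R`-module `B`. -/
structure IsSymmetricPresentation (g : Fin (m + 1) → B)
    (χ : Matrix (Fin (m + 1)) (Fin (m + 1)) R) : Prop where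
  isSymm : χ.IsSymm
  last_eq_one : g (Fin.last m) = 1
  generates : ∀ b : B, ∃ a : Fin (m + 1) → R, ∑ j, a j • g j = b
  relation : ∀ i, ∑ j, χ i j • g j = 0
  exists_of_relation : ∀ a : Fin (m + 1) → R, ∑ j, a j • g j = 0 →
    ∃ c : Fin (m + 1) → R, ∀ j, a j = ∑ i, c i * χ i j

variable {g : Fin (m + 1) → B} {χ : Matrix (Fin (m + 1)) (Fin (m + 1)) R}

namespace IsSymmetricPresentation

/-- The matrix over `B` without its last row and column. -/
abbrev reduced (B : Type) [CommRing B] [Algebra R B] (χ : Matrix (Fin (m + 1)) (Fin (m + 1)) R) :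
    Matrix (Fin m) (Fin m) B :=
  (χ.submatrix Fin.castSucc Fin.castSucc).map (algebraMap R B)

theorem relation_last (h : IsSymmetricPresentation g χ) (i : Fin (m + 1)) :
    algebraMap R B (χ i (Fin.last m)) =
      -∑ j : Fin m, algebraMap R B (χ i j.castSucc) * g j.castSucc := by
  have := h.relation i
  rw [Fin.sum_univ_castSucc, h.last_eq_one] at this
  simp only [Algebra.smul_def, mul_one] at this
  linear_combination this

/-- An element of the conductor gives a matrix which is inverse to `χ` up to this element. -/
theorem exists_of_mem_conductor (h : IsSymmetricPresentation g χ) {b : B}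
    (hb : b ∈ conductorIdeal R B) : ∃ Y : Matrix (Fin (m + 1)) (Fin (m + 1)) R, ∀ j k,
      algebraMap R B (∑ i, Y j i * χ i k) =
        (if k = j then b else 0) - if k = Fin.last m then b * g j else 0 := by
  choose d hd using fun j => hb (g j)
  -- Both b and b g_j come from elements of `R`, and b·g_j - (b g_j)·1 = 0 is a relation between the
  -- generators. Its expression through the rows of χ is the j-th row of `Y`.
  have h1 (j : Fin (m + 1)) : ∃ c : Fin (m + 1) → R, ∀ k,
      (if k = j then d (Fin.last m) else 0) - (if k = Fin.last m then d j else 0) =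
        ∑ i, c i * χ i k := by
    refine h.exists_of_relation _ ?_
    simp only [sub_smul, Finset.sum_sub_distrib, ite_smul, zero_smul, Finset.sum_ite_eq',
      Finset.mem_univ, if_true]
    rw [Algebra.smul_def, Algebra.smul_def, hd, hd, h.last_eq_one]
    ring
  choose Y hY using h1
  refine ⟨Y, fun j k => ?_⟩
  rw [← hY j k, map_sub, apply_ite (algebraMap R B), apply_ite (algebraMap R B), hd, hd, map_zero,
    h.last_eq_one, mul_one]

/-- In Yχ ≡ b, symmetry turns the last row of χ into its last column, which `relation_last`
expresses through the other columns. Hence the entries X_ji = Y_ji - Y_{j,last} g_i. -/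
theorem exists_mul_reduced (h : IsSymmetricPresentation g χ) {b : B}
    (hb : b ∈ conductorIdeal R B) : ∃ X : Matrix (Fin m) (Fin m) B,
      X * reduced B χ = Matrix.scalar (Fin m) b := by
  obtain ⟨Y, hY⟩ := h.exists_of_mem_conductor hb
  refine ⟨Matrix.of fun j i => algebraMap R B (Y j.castSucc i.castSucc) -
    algebraMap R B (Y j.castSucc (Fin.last m)) * g i.castSucc, ?_⟩
  ext j k
  have h2 := hY j.castSucc k.castSucc
  rw [Fin.sum_univ_castSucc, map_add, map_sum, map_mul,
    show χ (Fin.last m) k.castSucc = χ k.castSucc (Fin.last m) from h.isSymm.apply _ _,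
    h.relation_last, if_neg (Fin.castSucc_lt_last k).ne, sub_zero] at h2
  rw [Matrix.mul_apply, Matrix.scalar_apply, Matrix.diagonal_apply]
  simp only [Fin.castSucc_inj] at h2
  rw [show (if j = k then b else 0) = if k = j then b else 0 by simp [eq_comm], ← h2, mul_neg,
    ← sub_eq_add_neg, Finset.mul_sum, ← Finset.sum_sub_distrib]
  refine Finset.sum_congr rfl fun i _ => ?_
  simp only [Matrix.of_apply, reduced, Matrix.map_apply, Matrix.submatrix_apply]
  rw [h.isSymm.apply k.castSucc i.castSucc, map_mul]
  ring

theorem transpose_reduced (h : IsSymmetricPresentation g χ) :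
    (reduced B χ).transpose = reduced B χ := by
  ext i j
  simp [reduced, h.isSymm.apply i.castSucc j.castSucc]

/-- Transposing Xχ̃ = b gives χ̃Xᵀ = b. -/
theorem smul_mem_range_reduced (h : IsSymmetricPresentation g χ) {b : B}
    (hb : b ∈ conductorIdeal R B) (v : Fin m → B) :
    b • v ∈ LinearMap.range (reduced B χ).mulVecLin := by
  obtain ⟨X, hX⟩ := h.exists_mul_reduced hb
  have h1 : reduced B χ * X.transpose = Matrix.scalar (Fin m) b := by
    rw [← h.transpose_reduced, ← Matrix.transpose_mul, hX]
    simp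
  refine ⟨X.transpose.mulVec v, ?_⟩
  rw [Matrix.mulVecLin_apply, Matrix.mulVec_mulVec, h1]
  ext i
  simp [Matrix.mulVec_diagonal]

/-- The surjection given by the generators. -/
def proj (R : Type) [CommRing R] {B : Type} [CommRing B] [Algebra R B] (g : Fin (m + 1) → B) :
    (Fin (m + 1) → R) →ₗ[R] B := Fintype.linearCombination R g

theorem proj_surjective (h : IsSymmetricPresentation g χ) : Function.Surjective (proj R g) :=
  h.generates

/-- The rows of `χ` as elements of the module of relations. -/
def row (h : IsSymmetricPresentation g χ) (i : Fin (m + 1)) : LinearMap.ker (proj R g) :=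
  ⟨χ i, h.relation i⟩

theorem linearCombination_row_surjective (h : IsSymmetricPresentation g χ) :
    Function.Surjective (Fintype.linearCombination R h.row) := by
  rintro ⟨a, ha⟩
  obtain ⟨c, hc⟩ := h.exists_of_relation a ha
  refine ⟨c, Subtype.ext (funext fun j => ?_)⟩
  simp [Fintype.linearCombination_apply, row, hc]

/-- By symmetry `c` is also annihilated by χ from the left. Multiplying by the matrix `Y` of
`exists_of_mem_conductor` gives d c_j = d g_j c_last, and `d` cancels in the domain `B`. -/
theorem eq_mul_of_sum_smul_row_eq_zero [IsDomain B] (h : IsSymmetricPresentation g χ) {d : B}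
    (hd : d ∈ conductorIdeal R B) (hd0 : d ≠ 0) {c : Fin (m + 1) → R}
    (hc : ∀ k, ∑ i, c i * χ i k = 0) (j : Fin (m + 1)) :
    algebraMap R B (c j) = algebraMap R B (c (Fin.last m)) * g j := by
  obtain ⟨Y, hY⟩ := h.exists_of_mem_conductor hd
  have h1 : ∑ i, c i * ∑ k, Y j k * χ k i = 0 := by
    have : ∑ i, c i * ∑ k, Y j k * χ k i = ∑ k, Y j k * ∑ i, c i * χ i k := by
      simp only [Finset.mul_sum]
      rw [Finset.sum_comm]
      refine Finset.sum_congr rfl fun k _ => Finset.sum_congr rfl fun i _ => ?_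
      rw [h.isSymm.apply i k]
      ring
    rw [this]
    simp [hc]
  have h2 := congrArg (algebraMap R B) h1
  simp only [map_sum, map_mul, map_zero] at h2
  simp only [map_sum, map_mul] at hY
  simp only [hY, mul_sub, mul_ite, mul_zero, Finset.sum_sub_distrib, Finset.sum_ite_eq',
    Finset.mem_univ, if_true] at h2
  refine mul_left_cancel₀ hd0 ?_
  linear_combination h2

/-- The values of a homomorphism at all rows but the last one. -/
def evalRows (h : IsSymmetricPresentation g χ) :
    (LinearMap.ker (proj R g) →ₗ[R] B) →ₗ[B] MatrixCokernel (reduced B χ) :=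
  (LinearMap.range (reduced B χ).mulVecLin).mkQ ∘ₗ
    { toFun := fun f i => f (h.row i.castSucc)
      map_add' := fun _ _ => rfl
      map_smul' := fun _ _ => rfl }

/-- All relations between the rows are proportional to the vector of generators. So prescribed
values w'_i define a homomorphism as soon as ∑ g_i w'_i = 0, a condition that only determines the
last value. -/
theorem evalRows_surjective [IsDomain B] (h : IsSymmetricPresentation g χ) {d : B}
    (hd : d ∈ conductorIdeal R B) (hd0 : d ≠ 0) : Function.Surjective h.evalRows := by
  intro x
  obtain ⟨w, rfl⟩ := Submodule.mkQ_surjective _ x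
  let w' : Fin (m + 1) → B := Fin.snoc w (-∑ i, g i.castSucc * w i)
  have hw' : ∑ i, g i * w' i = 0 := by
    rw [Fin.sum_univ_castSucc]
    simp [w', h.last_eq_one]
  let ψ := Fintype.linearCombination R h.row
  have hψ : Function.Surjective ψ := h.linearCombination_row_surjective
  have hle : LinearMap.ker ψ ≤ LinearMap.ker (Fintype.linearCombination R w') := by
    intro c hc
    have h1 (k) : ∑ i, c i * χ i k = 0 := by
      have h2 := congrFun (congrArg Subtype.val (LinearMap.mem_ker.1 hc)) k
      simpa [ψ, Fintype.linearCombination_apply, row] using h2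
    have h3 := h.eq_mul_of_sum_smul_row_eq_zero hd hd0 h1
    rw [LinearMap.mem_ker, Fintype.linearCombination_apply]
    simp only [Algebra.smul_def]
    rw [Finset.sum_congr rfl fun i _ => by rw [h3 i, mul_assoc], ← Finset.mul_sum, hw', mul_zero]
  let f := (LinearMap.ker ψ).liftQ _ hle ∘ₗ (ψ.quotKerEquivOfSurjective hψ).symm.toLinearMap
  have hf (i) : f (h.row i) = w' i := by
    have h1 : h.row i = ψ (Pi.single i 1) := by
      simp [ψ, Fintype.linearCombination_apply_single]
    have h2 : (ψ.quotKerEquivOfSurjective hψ).symm (ψ (Pi.single i 1)) =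
        Submodule.Quotient.mk (Pi.single i 1) := by
      rw [LinearEquiv.symm_apply_eq]
      rfl
    rw [h1]
    simp only [f, LinearMap.comp_apply, LinearEquiv.coe_coe]
    rw [h2, Submodule.liftQ_apply, Fintype.linearCombination_apply_single, one_smul]
  refine ⟨f, ?_⟩
  simp only [evalRows, LinearMap.comp_apply]
  congr 1
  ext i
  simp [hf, w']

/-- Restrictions from the free module land in the image of the reduced matrix by elimination of the
last column. Conversely, a preimage under the reduced matrix defines an extension that agrees with
the given homomorphism on all rows but the last, and the last row is then forced. -/
theorem ker_evalRows [IsDomain B] (h : IsSymmetricPresentation g χ)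
    (hinj : Function.Injective (algebraMap R B)) {d : B}
    (hd : d ∈ conductorIdeal R B) (hd0 : d ≠ 0) :
    LinearMap.ker (connectingHom (m + 1) (proj R g) h.proj_surjective) =
      LinearMap.ker h.evalRows := by
  ext f
  rw [mem_ker_connectingHom]
  simp only [LinearMap.mem_ker, evalRows, LinearMap.comp_apply, Submodule.mkQ_apply,
    Submodule.Quotient.mk_eq_zero]
  constructor
  · rintro ⟨v, rfl⟩
    have hv (a : Fin (m + 1) → R) : v a = ∑ j, algebraMap R B (a j) * v (Pi.single j 1) := by
      have h1 : a = ∑ j, a j • (Pi.single j 1 : Fin (m + 1) → R) := by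
        ext k
        simp [Finset.sum_apply, Pi.single_apply]
      conv_lhs => rw [h1, map_sum]
      exact Finset.sum_congr rfl fun j _ => by rw [map_smul, Algebra.smul_def]
    -- Substitute χ_{i,last} = -∑ χ_ij g_j into v(χ_i) and collect the coefficients of the χ_ij.
    refine ⟨fun j => v (Pi.single j.castSucc 1) - g j.castSucc * v (Pi.single (Fin.last m) 1), ?_⟩
    ext i
    simp only [Matrix.mulVecLin_apply, Matrix.mulVec, dotProduct, LinearMap.coe_mk, AddHom.coe_mk,
      LinearMap.comp_apply, Submodule.subtype_apply, row]
    rw [hv (χ i.castSucc), Fin.sum_univ_castSucc, h.relation_last, neg_mul, ← sub_eq_add_neg, Finset.sum_mul,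
      ← Finset.sum_sub_distrib]
    refine Finset.sum_congr rfl fun j _ => ?_
    simp only [reduced, Matrix.map_apply, Matrix.submatrix_apply]
    ring
  · rintro ⟨v, hv⟩
    let V : (Fin (m + 1) → R) →ₗ[R] B := Fintype.linearCombination R (Fin.snoc v 0 : _ → B)
    have hV (i : Fin m) : f (h.row i.castSucc) = V (h.row i.castSucc) := by
      have h1 := congrFun hv i
      simp only [LinearMap.coe_mk, AddHom.coe_mk] at h1
      rw [← h1, Fintype.linearCombination_apply, Fin.sum_univ_castSucc]
      simp [Matrix.mulVec, dotProduct, reduced, row, Algebra.smul_def]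
    have hlast : f (h.row (Fin.last m)) = V (h.row (Fin.last m)) := by
      -- By symmetry ∑ (d g_i) χ_i = 0 is a relation between the rows over `R`. Its last coefficient
      -- is d ≠ 0, so the value on the last row is determined by the others.
      choose r hr using fun i => hd (g i)
      have h1 : ∑ i, r i • h.row i = 0 := by
        refine Subtype.ext (funext fun k => hinj ?_)
        have h2 := h.relation k
        simp only [Submodule.coe_sum, Submodule.coe_smul, Finset.sum_apply, Pi.smul_apply, row,
          smul_eq_mul, map_sum, map_mul, hr, ZeroMemClass.coe_zero, Pi.zero_apply, map_zero]
        rw [← mul_zero d, ← h2, Finset.mul_sum]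
        refine Finset.sum_congr rfl fun i _ => ?_
        rw [h.isSymm.apply k i, Algebra.smul_def]
        ring
      have h2 := congrArg (f - V ∘ₗ (LinearMap.ker (proj R g)).subtype) h1
      simp only [map_sum, map_smul, map_zero, LinearMap.sub_apply, LinearMap.comp_apply,
        Submodule.subtype_apply] at h2
      rw [Fin.sum_univ_castSucc, Finset.sum_eq_zero, zero_add, Algebra.smul_def, hr,
        h.last_eq_one, mul_one] at h2
      · exact sub_eq_zero.1 ((mul_eq_zero.1 h2).resolve_left hd0)
      · intro i _
        rw [hV, sub_self, smul_zero]
    refine ⟨V, LinearMap.ext fun k => ?_⟩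
    obtain ⟨c, rfl⟩ := h.linearCombination_row_surjective k
    rw [Fintype.linearCombination_apply, map_sum, map_sum]
    refine Finset.sum_congr rfl fun i _ => ?_
    rw [map_smul, map_smul]
    congr 1
    refine Fin.lastCases hlast hV i

/-- The module of self-extensions is presented by the reduced matrix. -/
theorem nonempty_selfExt_equiv [IsDomain B] (h : IsSymmetricPresentation g χ)
    (hinj : Function.Injective (algebraMap R B)) {d : B}
    (hd : d ∈ conductorIdeal R B) (hd0 : d ≠ 0) :
    Nonempty (SelfExt R B 1 ≃ₗ[B] MatrixCokernel (reduced B χ)) :=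
  ⟨(LinearMap.quotKerEquivOfSurjective _
      (connectingHom_surjective (m + 1) (proj R g) h.proj_surjective)).symm ≪≫ₗ
    Submodule.quotEquivOfEq _ _ (h.ker_evalRows hinj hd hd0) ≪≫ₗ
    LinearMap.quotKerEquivOfSurjective _ (h.evalRows_surjective hd hd0)⟩

theorem isTorsionBySet (h : IsSymmetricPresentation g χ) {E : Type} [AddCommGroup E] [Module B E]
    (e : E ≃ₗ[B] MatrixCokernel (reduced B χ)) :
    Module.IsTorsionBySet B E (conductorIdeal R B : Set B) := by
  rintro x ⟨b, hb⟩
  refine e.injective ?_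
  rw [map_zero, map_smul]
  obtain ⟨v, hv⟩ := Submodule.mkQ_surjective _ (e x)
  rw [← hv]
  change b • _ = _
  rw [← map_smul, Submodule.mkQ_apply, Submodule.Quotient.mk_eq_zero]
  exact h.smul_mem_range_reduced hb v

/-- If the reduced matrix is invertible then the algebra is equal to the base ring. -/
theorem conductorIdeal_eq_top_of_isUnit_det (h : IsSymmetricPresentation g χ)
    [IsLocalHom (algebraMap R B)] (hdet : IsUnit (reduced B χ).det) :
    conductorIdeal R B = ⊤ := by
  let χ₀ := χ.submatrix Fin.castSucc Fin.castSucc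
  have h1 : IsUnit χ₀.det := by
    refine isUnit_of_map_unit (algebraMap R B) _ ?_
    rw [RingHom.map_det]
    exact hdet
  have h2 : (algebraMap R B).range = ⊤ := by
    have h3 (j : Fin (m + 1)) : g j ∈ (algebraMap R B).range := by
      refine Fin.lastCases ?_ (fun j => ?_) j
      · rw [h.last_eq_one]; exact one_mem _
      -- The relations of all rows but the last are a linear system over `R` for the generators, and
      -- its matrix is invertible over `R` because `R → B` is local.
      · have h4 : (reduced B χ).mulVec (fun j => g j.castSucc) =
            fun i : Fin m => -algebraMap R B (χ i.castSucc (Fin.last m)) := by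
          ext i
          rw [h.relation_last, neg_neg]
          rfl
        have h5 := congrArg (reduced B χ)⁻¹.mulVec h4
        rw [Matrix.mulVec_mulVec, Matrix.nonsing_inv_mul _ hdet, Matrix.one_mulVec] at h5
        have h6 : (reduced B χ)⁻¹ = χ₀⁻¹.map (algebraMap R B) := by
          refine Matrix.inv_eq_left_inv ?_
          rw [reduced, ← Matrix.map_mul, Matrix.nonsing_inv_mul _ h1]
          simp
        have h7 := congrFun h5 j
        rw [h7, h6]
        simp only [Matrix.mulVec, dotProduct, Matrix.map_apply]
        exact sum_mem fun i _ => mul_mem ⟨_, rfl⟩ (neg_mem ⟨_, rfl⟩)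
    refine eq_top_iff.2 fun b _ => ?_
    obtain ⟨a, rfl⟩ := h.generates b
    refine sum_mem fun j _ => ?_
    rw [Algebra.smul_def]
    exact mul_mem ⟨_, rfl⟩ (h3 j)
  refine eq_top_iff.2 fun b _ c => ?_
  rw [h2]
  trivial

end IsSymmetricPresentation

end SymmetricPresentation

/-! ### Cokernels of square matrices are maximal Cohen–Macaulay -/

section Cokernel

open IsLocalRing RingTheory.Sequence Pointwise

variable {B : Type} [CommRing B]

theorem mem_smul_top_pi_iff {p : Type} [Fintype p] {I : Ideal B} {v : p → B} :
    v ∈ I • (⊤ : Submodule B (p → B)) ↔ ∀ i, v i ∈ I := by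
  classical
  constructor
  · intro hv i
    refine Submodule.smul_induction_on hv (fun a ha w _ => ?_) (fun _ _ h1 h2 => add_mem h1 h2)
    exact I.mul_mem_right _ ha
  · intro hv
    have h1 : v = ∑ j, v j • (Pi.single j 1 : p → B) := by
      ext k
      simp [Finset.sum_apply, Pi.single_apply]
    rw [h1]
    exact sum_mem fun j _ => Submodule.smul_mem_smul (hv j) trivial

theorem mkQ_mem_smul_top_iff {M : Type} [AddCommGroup M] [Module B M] {I : Ideal B}
    {N : Submodule B M} {v : M} :
    N.mkQ v ∈ I • (⊤ : Submodule B (M ⧸ N)) ↔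
      ∃ w ∈ N, ∃ e ∈ I • (⊤ : Submodule B M), v = w + e := by
  rw [← Submodule.range_mkQ N, LinearMap.range_eq_map, ← Submodule.map_smul'']
  constructor
  · rintro ⟨e, he, h⟩
    refine ⟨v - e, ?_, e, he, by simp⟩
    rw [← Submodule.ker_mkQ N, LinearMap.mem_ker, map_sub, h, sub_self]
  · rintro ⟨w, hw, e, he, rfl⟩
    refine ⟨e, he, ?_⟩
    rw [← Submodule.ker_mkQ N] at hw
    rw [map_add, LinearMap.mem_ker.1 hw, zero_add]

/-- If y v = M w modulo `I`, the adjugate gives det(M) w ∈ I + (y). So w = a + y b with a in `I`,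
and cancelling `y` gives v ≡ M b modulo `I`. -/
theorem smul_mem_smul_top_matrixCokernel {p : Type} [Fintype p] [DecidableEq p] (M : Matrix p p B)
    {I : Ideal B} {y : B} (hy : ∀ x, y * x ∈ I → x ∈ I)
    (hdet : ∀ x, M.det * x ∈ I ⊔ Ideal.span {y} → x ∈ I ⊔ Ideal.span {y}) (x : MatrixCokernel M)
    (hx : y • x ∈ I • (⊤ : Submodule B (MatrixCokernel M))) :
    x ∈ I • (⊤ : Submodule B (MatrixCokernel M)) := by
  obtain ⟨v, rfl⟩ := Submodule.mkQ_surjective _ x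
  rw [← map_smul, mkQ_mem_smul_top_iff] at hx
  obtain ⟨_, ⟨w, rfl⟩, e, he, h⟩ := hx
  rw [mem_smul_top_pi_iff] at he
  rw [Matrix.mulVecLin_apply] at h
  have h1 (i) : M.mulVec w i ∈ I ⊔ Ideal.span {y} := by
    have h2 : M.mulVec w i = y * v i - e i := by
      have := congrFun h i
      simp only [Pi.smul_apply, smul_eq_mul, Pi.add_apply] at this
      rw [this, add_sub_cancel_right]
    rw [h2]
    exact sub_mem (Ideal.mem_sup_right (Ideal.mul_mem_right _ _ (Ideal.mem_span_singleton_self y)))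
      (Ideal.mem_sup_left (he i))
  have h3 (i) : ∃ a ∈ I, ∃ b, w i = a + y * b := by
    have h4 : M.det * w i ∈ I ⊔ Ideal.span {y} := by
      have h5 : M.det * w i = M.adjugate.mulVec (M.mulVec w) i := by
        rw [Matrix.mulVec_mulVec, Matrix.adjugate_mul, Matrix.smul_mulVec, Matrix.one_mulVec]
        rfl
      rw [h5]
      exact sum_mem fun j _ => Ideal.mul_mem_left _ _ (h1 j)
    obtain ⟨a, ha, z, hz, h6⟩ := Submodule.mem_sup.1 (hdet _ h4)
    obtain ⟨b, rfl⟩ := Ideal.mem_span_singleton'.1 hz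
    exact ⟨a, ha, b, by rw [← h6, mul_comm b]⟩
  choose a ha b hab using h3
  rw [mkQ_mem_smul_top_iff]
  refine ⟨_, ⟨b, rfl⟩, v - M.mulVec b, ?_, by simp⟩
  rw [mem_smul_top_pi_iff]
  intro i
  refine hy _ ?_
  have h7 : w = a + y • b := funext hab
  have h8 : y * (v - M.mulVec b) i = M.mulVec a i + e i := by
    have := congrFun h i
    rw [h7, Matrix.mulVec_add, Matrix.mulVec_smul] at this
    simp only [Pi.smul_apply, smul_eq_mul, Pi.add_apply] at this
    rw [Pi.sub_apply]
    linear_combination this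
  rw [h8]
  exact add_mem (sum_mem fun j _ => I.mul_mem_left _ (ha j)) (he i)

theorem isSMulRegular_quotient_ofList_iff {I : Ideal B} {y : B} :
    IsSMulRegular (B ⧸ (I • ⊤ : Submodule B B)) y ↔ ∀ x, y * x ∈ I → x ∈ I := by
  rw [isSMulRegular_quotient_iff_mem_of_smul_mem]
  exact forall_congr' fun x => by
    rw [mem_smul_top_self_iff, mem_smul_top_self_iff, smul_eq_mul]

/-- This replaces counting depth along 0 → B^p → B^p → coker M → 0. Since regular sequences in a
Noetherian local ring may be permuted, the determinant can be moved past each `y` in the induction.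
-/
theorem isWeaklyRegular_matrixCokernel [IsLocalRing B] [IsNoetherianRing B] {p : Type} [Fintype p]
    [DecidableEq p] (M : Matrix p p B) {ys : List B} (hys : ∀ y ∈ ys, y ∈ maximalIdeal B)
    (hdet : M.det ∈ maximalIdeal B) (h : IsWeaklyRegular B (ys ++ [M.det])) :
    IsWeaklyRegular (MatrixCokernel M) ys := by
  induction ys using List.reverseRecOn with
  | nil => exact IsWeaklyRegular.nil _ _
  | append_singleton ys y ih =>
    have h1 := h
    rw [isWeaklyRegular_append_iff, isWeaklyRegular_append_iff] at h1
    obtain ⟨⟨_, hy⟩, hd⟩ := h1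
    rw [isWeaklyRegular_singleton_iff, isSMulRegular_quotient_ofList_iff] at hy hd
    have h2 : IsWeaklyRegular B (ys ++ [M.det] ++ [y]) := by
      refine isWeaklyRegular_of_perm_of_subset_maximalIdeal h ?_ ?_
      · rw [List.append_assoc, List.append_assoc]
        exact (List.Perm.swap _ _ _).append_left ys
      · intro r hr
        rw [List.mem_append] at hr
        rcases hr with hr | hr
        · exact hys r hr
        · rw [List.mem_singleton.1 hr]; exact hdet
    refine (isWeaklyRegular_append_iff _ _ _).2
      ⟨ih (fun z hz => hys z (by simp [hz])) ((isWeaklyRegular_append_iff _ _ _).1 h2).1, ?_⟩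
    rw [isWeaklyRegular_singleton_iff, isSMulRegular_quotient_iff_mem_of_smul_mem]
    rw [Ideal.ofList_append, Ideal.ofList_singleton] at hd
    exact smul_mem_smul_top_matrixCokernel M hy hd

variable [IsLocalRing B] [IsNoetherianRing B]

/-- Parameters of a quotient ring. -/
theorem exists_parameters [IsDomain B] {m : ℕ} (hm : ringKrullDim B ≤ (m + 1 : ℕ)) {δ : B}
    (hδ : δ ∈ maximalIdeal B) (hδ0 : δ ≠ 0) : ∃ ys : List B, ys.length = m ∧
      (∀ y ∈ ys, y ∈ maximalIdeal B) ∧ maximalIdeal B ≤ (Ideal.ofList (ys ++ [δ])).radical := by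
  classical
  have hne : Ideal.span {δ} ≠ ⊤ := fun h => by
    rw [Ideal.span_singleton_eq_top] at h
    exact hδ h
  have : Nontrivial (B ⧸ Ideal.span {δ}) := Ideal.Quotient.nontrivial_iff.2 hne
  have := IsLocalRing.of_surjective' (Ideal.Quotient.mk (Ideal.span {δ}))
    Ideal.Quotient.mk_surjective
  have hdim : ringKrullDim (B ⧸ Ideal.span {δ}) ≤ m := by
    have h1 := (ringKrullDim_quotient_succ_le_of_nonZeroDivisor
      (mem_nonZeroDivisors_of_ne_zero hδ0)).trans hm
    rw [← IsLocalRing.maximalIdeal_height_eq_ringKrullDim] at h1 ⊢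
    generalize (maximalIdeal (B ⧸ Ideal.span {δ})).height = e at h1 ⊢
    have h2 : e + 1 ≤ (m : ℕ∞) + 1 := by exact_mod_cast h1
    exact_mod_cast (ENat.add_le_add_iff_right (by simp)).1 h2
  obtain ⟨s, hs, hcard⟩ := Ideal.exists_finset_card_eq_height_of_isNoetherianRing
    (maximalIdeal (B ⧸ Ideal.span {δ}))
  rw [← IsLocalRing.maximalIdeal_height_eq_ringKrullDim, ← hcard] at hdim
  replace hdim : s.card ≤ m := by exact_mod_cast hdim
  let lift := Function.surjInv (Ideal.Quotient.mk_surjective (I := Ideal.span {δ}))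
  have hlift (x) : Ideal.Quotient.mk (Ideal.span {δ}) (lift x) = x := Function.surjInv_eq _ x
  have hmem {x : B} (hx : Ideal.Quotient.mk (Ideal.span {δ}) x ∈ maximalIdeal _) :
      x ∈ maximalIdeal B := fun hu => hx (hu.map _)
  -- Padding by zeros makes the length exactly `m` and does not change the ideal.
  refine ⟨s.toList.map lift ++ List.replicate (m - s.card) 0, ?_, ?_, ?_⟩
  · simp; lia
  · intro y hy
    rw [List.mem_append, List.mem_map] at hy
    rcases hy with ⟨x, hx, rfl⟩ | hy
    · exact hmem (by rw [hlift]; exact hs.1.2 (Ideal.subset_span (by simpa using hx)))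
    · rw [List.eq_of_mem_replicate hy]; exact zero_mem _
  · intro x hx
    by_contra hnot
    rw [Ideal.radical_eq_sInf, Submodule.mem_sInf] at hnot
    push Not at hnot
    obtain ⟨q, ⟨hq, hqp⟩, hxq⟩ := hnot
    have hδq : δ ∈ q := hq (Ideal.subset_span (by simp))
    have hle : Ideal.span {δ} ≤ q := (Ideal.span_singleton_le_iff_mem _).2 hδq
    have hprime : (Ideal.map (Ideal.Quotient.mk (Ideal.span {δ})) q).IsPrime :=
      Ideal.map_isPrime_of_surjective Ideal.Quotient.mk_surjective (by rwa [Ideal.mk_ker])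
    have hsub : Ideal.span (s : Set (B ⧸ Ideal.span {δ})) ≤
        Ideal.map (Ideal.Quotient.mk (Ideal.span {δ})) q := by
      refine Ideal.span_le.2 fun y hy => ?_
      rw [← hlift y]
      refine Ideal.mem_map_of_mem _ (hq (Ideal.subset_span ?_))
      simp only [Set.mem_ofPred_eq, List.mem_append, List.mem_map, Finset.mem_toList]
      exact Or.inl (Or.inl ⟨y, hy, rfl⟩)
    have h3 := hs.2 ⟨hprime, hsub⟩ (le_maximalIdeal hprime.ne_top)
    have h4 : Ideal.Quotient.mk (Ideal.span {δ}) x ∈ maximalIdeal _ := fun hu => by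
      have h5 : IsUnit x := by
        by_contra h6
        obtain ⟨z, hz⟩ := hu.exists_right_inv
        obtain ⟨z, rfl⟩ := Ideal.Quotient.mk_surjective z
        rw [← map_mul, ← map_one (Ideal.Quotient.mk _), Ideal.Quotient.eq] at hz
        have h7 := sub_mem ((maximalIdeal B).mul_mem_right z hx) (le_maximalIdeal hne hz)
        rw [sub_sub_cancel] at h7
        exact (Ideal.ne_top_iff_one _).1 (maximalIdeal.isMaximal B).ne_top h7
      exact hx h5
    obtain ⟨z, hz, hzx⟩ := (Ideal.mem_map_iff_of_surjective _ Ideal.Quotient.mk_surjective).1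
      (h3 h4)
    rw [Ideal.Quotient.eq] at hzx
    exact hxq (by simpa using sub_mem hz (hle hzx))

/-- The cokernel of a square matrix over a Cohen–Macaulay local domain `B` is a maximal
Cohen–Macaulay module over any proper quotient of `B` by a nonzero ideal which annihilates it. -/
theorem isMaximalCohenMacaulay_matrixCokernel [IsDomain B] {k : ℕ}
    (hdim : ringKrullDim B ≤ k)
    (hCM : ∀ as : List B, as.length = k → (∀ a ∈ as, a ∈ maximalIdeal B) →
      maximalIdeal B ≤ (Ideal.ofList as).radical → IsWeaklyRegular B as)
    {p : Type} [Fintype p] [DecidableEq p] (M : Matrix p p B) (C : Ideal B) (hC0 : C ≠ ⊥)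
    (hdet0 : M.det ≠ 0) (hdet : C ≠ ⊤ → M.det ∈ maximalIdeal B)
    {E : Type} [AddCommGroup E] [Module B E] [Module (B ⧸ C) E] [IsScalarTower B (B ⧸ C) E]
    (e : E ≃ₗ[B] MatrixCokernel M) : IsMaximalCohenMacaulay (B ⧸ C) E := by
  have hfin : Module.Finite B E := Module.Finite.equiv e.symm
  have hfin' : Module.Finite (B ⧸ C) E := Module.Finite.of_restrictScalars_finite B _ _
  refine ⟨hfin', fun 𝔫 h𝔫 => ?_⟩
  have hCtop : C ≠ ⊤ := fun h => h𝔫.ne_top (by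
    have : Subsingleton (B ⧸ C) := Ideal.Quotient.subsingleton_iff.2 h
    exact Subsingleton.elim _ _)
  have hδ := hdet hCtop
  have : Nontrivial (B ⧸ C) := Ideal.Quotient.nontrivial_iff.2 hCtop
  have := IsLocalRing.of_surjective' (Ideal.Quotient.mk C) Ideal.Quotient.mk_surjective
  obtain rfl := IsLocalRing.eq_maximalIdeal h𝔫
  obtain ⟨c, hcC, hc0⟩ := Submodule.exists_mem_ne_zero_of_ne_bot hC0
  -- Killing a nonzero element of a domain lowers the dimension by at least one.
  have hheight : (maximalIdeal (B ⧸ C)).height + 1 ≤ k := by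
    have h1 := (ringKrullDim_quotient_succ_le_of_nonZeroDivisor
      (mem_nonZeroDivisors_of_ne_zero hc0)).trans hdim
    have h2 : ringKrullDim (B ⧸ C) ≤ ringKrullDim (B ⧸ Ideal.span {c}) :=
      ringKrullDim_le_of_surjective (Ideal.Quotient.factor
        ((Ideal.span_singleton_le_iff_mem _).2 hcC)) (Ideal.Quotient.factor_surjective _)
    have h3 := (add_le_add_left h2 1).trans h1
    rw [← IsLocalRing.maximalIdeal_height_eq_ringKrullDim] at h3
    exact_mod_cast h3
  obtain ⟨d, hd⟩ : ∃ d : ℕ, (maximalIdeal (B ⧸ C)).height = d :=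
    ⟨_, (ENat.natCast_toNat (Ideal.height_ne_top Ideal.IsPrime.ne_top')).symm⟩
  rw [hd] at hheight ⊢
  replace hheight : d + 1 ≤ k := by exact_mod_cast hheight
  obtain ⟨k, rfl⟩ : ∃ k', k = k' + 1 := ⟨k - 1, by lia⟩
  obtain ⟨ys, hlen, hys, hrad⟩ := exists_parameters hdim hδ hdet0
  have hall : ∀ a ∈ ys ++ [M.det], a ∈ maximalIdeal B := by
    intro a ha
    rw [List.mem_append, List.mem_singleton] at ha
    rcases ha with ha | rfl
    exacts [hys a ha, hδ]
  have hreg := isWeaklyRegular_matrixCokernel M hys hδ (hCM _ (by simp [hlen]) hall hrad)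
  -- The sequence `ys` is regular on the cokernel and at least as long as the height `d`; its first
  -- `d` elements are the ones required.
  rw [← List.take_append_drop d ys, isWeaklyRegular_append_iff] at hreg
  have hregE := (e.isWeaklyRegular_congr _).2 hreg.1
  have hnt : Nontrivial E := by
    rw [e.toEquiv.nontrivial_congr, Submodule.Quotient.nontrivial_iff]
    intro htop
    refine hδ ?_
    rw [LinearMap.range_eq_top] at htop
    exact (Matrix.isUnit_iff_isUnit_det _).1 (Matrix.mulVec_surjective_iff_isUnit.1 htop)
  have hmem : ∀ r ∈ (ys.take d).map (algebraMap B (B ⧸ C)), r ∈ maximalIdeal (B ⧸ C) := by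
    intro r hr
    obtain ⟨y, hy, rfl⟩ := List.mem_map.1 hr
    have := IsLocalHom.of_surjective (algebraMap B (B ⧸ C)) Ideal.Quotient.mk_surjective
    exact fun hu => hys y (List.mem_of_mem_take hy) (isUnit_of_map_unit _ _ hu)
  refine ⟨_, hmem, (isRegular_iff_isWeaklyRegular_of_subset_maximalIdeal hmem).2
    ((isWeaklyRegular_map_algebraMap_iff (B ⧸ C) E _).2 hregE), ?_⟩
  simp only [List.length_map, List.length_take, hlen]
  exact_mod_cast min_eq_left (by lia)

end Cokernel

/-! ### Finite dimensional quotients of local rings -/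

section FiniteDimensional

open IsLocalRing RingTheory.Sequence


/-- The quotient is Artinian, so its Jacobson radical is nilpotent. -/
theorem exists_pow_maximalIdeal_le (K : Type) {P : Type} [Field K] [CommRing P] [Algebra K P] [IsLocalRing P] (J : Ideal P)
    [Module.Finite K (P ⧸ J)] : ∃ k, maximalIdeal P ^ k ≤ J := by
  have : IsArtinianRing (P ⧸ J) := IsArtinianRing.of_finite K _
  obtain ⟨k, hk⟩ := IsArtinianRing.isNilpotent_jacobson_bot (R := P ⧸ J)
  refine ⟨k, ?_⟩
  have h1 : (maximalIdeal P).map (Ideal.Quotient.mk J) ≤ Ideal.jacobson ⊥ := by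
    refine Ideal.map_le_iff_le_comap.2 fun p hp => ?_
    rw [Ideal.mem_comap, Ideal.mem_jacobson_bot]
    intro q
    obtain ⟨q, rfl⟩ := Ideal.Quotient.mk_surjective q
    rw [← map_mul, ← map_one (Ideal.Quotient.mk J), ← map_add]
    refine IsUnit.map _ ?_
    by_contra hu
    have h2 := sub_mem (show p * q + 1 ∈ maximalIdeal P from hu)
      (Ideal.mul_mem_right q _ hp)
    rw [add_sub_cancel_left] at h2
    exact (Ideal.ne_top_iff_one _).1 (maximalIdeal.isMaximal _).ne_top h2
  have h3 := Ideal.pow_right_mono h1 k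
  rw [hk, ← Ideal.map_pow, Ideal.zero_eq_bot, Ideal.map_le_iff_le_comap] at h3
  exact h3.trans (fun p hp => Ideal.Quotient.eq_zero_iff_mem.1 hp)

/-- A functional inducing a nondegenerate form on a quotient with a cyclic socle. -/
theorem exists_nondegenerate (K : Type) {P : Type} [Field K] [CommRing P] [Algebra K P] [IsLocalRing P] {J : Ideal P} {k : ℕ}
    (hk : maximalIdeal P ^ k ≤ J)
    (hs : SocleIsCyclic P (P ⧸ J)) :
    ∃ ℓ : (P ⧸ J) →ₗ[K] K, ∀ x, (∀ y, ℓ (x * y) = 0) → x = 0 := by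
  classical
  obtain ⟨s, hs0, hs⟩ := hs
  -- With `e` the last exponent for which 𝔪^e does not kill x, some nonzero multiple q x is in the
  -- socle, hence equals c s with c a unit. So every nonzero ideal contains `s`, and a functional
  -- with ℓ(s) ≠ 0 is nondegenerate.
  have key (x : P ⧸ J) (hx : x ≠ 0) : s ≠ 0 ∧ ∃ y, x * y = s := by
    have hex : ∃ e, ∀ q ∈ maximalIdeal P ^ e, q • x = 0 := by
      refine ⟨k, fun q hq => ?_⟩
      rw [Algebra.smul_def, Ideal.Quotient.algebraMap_eq,
        Ideal.Quotient.eq_zero_iff_mem.2 (hk hq), zero_mul]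
    obtain ⟨e, he, hmin⟩ : ∃ e, (∀ q ∈ maximalIdeal P ^ (e + 1), q • x = 0) ∧
        ¬ ∀ q ∈ maximalIdeal P ^ e, q • x = 0 := by
      have h0 : Nat.find hex ≠ 0 := fun h0 => hx (by
        have := Nat.find_spec hex 1 (by simp [h0])
        rwa [one_smul] at this)
      obtain ⟨e, he⟩ := Nat.exists_eq_succ_of_ne_zero h0
      exact ⟨e, by rw [← Nat.succ_eq_add_one, ← he]; exact Nat.find_spec hex,
        Nat.find_min hex (by lia)⟩
    push Not at hmin
    obtain ⟨q, hq, hqx⟩ := hmin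
    obtain ⟨c, hc⟩ := hs (q • x) fun r hr => by
      rw [smul_smul]
      exact he _ (by rw [pow_succ']; exact Ideal.mul_mem_mul hr hq)
    have hcu : IsUnit c := by
      by_contra hcu
      exact hqx (by rw [hc, hs0 c hcu])
    obtain ⟨d, hd⟩ := hcu.exists_left_inv
    refine ⟨fun h => hqx (by rw [hc, h, smul_zero]), Ideal.Quotient.mk J (d * q), ?_⟩
    rw [mul_comm, ← Ideal.Quotient.algebraMap_eq, ← Algebra.smul_def, mul_smul, hc, smul_smul, hd,
      one_smul]
  by_cases hs1 : s = 0
  · refine ⟨0, fun x _ => ?_⟩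
    by_contra hx
    exact (key x hx).1 hs1
  · obtain ⟨ℓ, hℓ⟩ : ∃ ℓ : Module.Dual K (P ⧸ J), ℓ s ≠ 0 := by
      by_contra h
      push Not at h
      exact hs1 ((Module.forall_dual_apply_eq_zero_iff K s).1 h)
    refine ⟨ℓ, fun x hx => ?_⟩
    by_contra hx0
    obtain ⟨-, y, hy⟩ := key x hx0
    exact hℓ (hy ▸ hx y)

theorem HasDepthSocle.isWeaklyRegular_self {R : Type} [CommRing R] [IsLocalRing R]
    [IsNoetherianRing R] {as : List R} (h : HasDepthSocle R as.length R)
    (has : ∀ a ∈ as, a ∈ maximalIdeal R) (hrad : maximalIdeal R ≤ (Ideal.ofList as).radical) :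
    IsWeaklyRegular R as ∧ SocleIsCyclic R (R ⧸ Ideal.ofList as) := by
  obtain ⟨h1, h2⟩ := h.isWeaklyRegular has (hrad.trans (Ideal.radical_mono le_sup_right))
  exact ⟨h1, h2.congr (Submodule.quotEquivOfEq _ _ (by rw [smul_eq_mul, Ideal.mul_top]))⟩

theorem hasDepthSocle_of_ofList_eq {R : Type} [CommRing R] [IsLocalRing R]
    {as : List R} (h : IsWeaklyRegular R as) (has : Ideal.ofList as = maximalIdeal R) :
    HasDepthSocle R as.length R := by
  refine hasDepthSocle_of_isWeaklyRegular (fun a ha => has ▸ Ideal.subset_span ha) h ?_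
  rw [has]
  refine ⟨Submodule.Quotient.mk 1, fun r hr => ?_, fun t _ => ?_⟩
  · rw [← Submodule.Quotient.mk_smul, Submodule.Quotient.mk_eq_zero, mem_smul_top_self_iff,
      smul_eq_mul, mul_one]
    exact hr
  · obtain ⟨c, rfl⟩ := Submodule.Quotient.mk_surjective _ t
    refine ⟨c, ?_⟩
    rw [← Submodule.Quotient.mk_smul]
    exact congrArg _ (mul_one c).symm

end FiniteDimensional

namespace ConvSeries

open IsLocalRing RingTheory.Sequence

variable {σ : Type}

instance (J : Ideal (ConvSeries σ)) : CommRing (ConvSeries σ ⧸ J) := Ideal.Quotient.commRing J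

instance (J : Ideal (ConvSeries σ)) : Module (ConvSeries σ) (ConvSeries σ ⧸ J) :=
  Submodule.Quotient.module J

instance (J : Ideal (ConvSeries σ)) : Algebra ℂ (ConvSeries σ ⧸ J) := Ideal.Quotient.algebra ℂ

/-! ### Values and linear parts at the origin -/

/-- Evaluation at the origin. -/
def evalZero (σ : Type) : ConvSeries σ →ₐ[ℂ] ℂ :=
  { (MvPowerSeries.constantCoeff (σ := σ) (R := ℂ)).comp (convSubalgebra σ).val.toRingHom with
    commutes' := fun c => by
      have h := MvPowerSeries.constantCoeff_C (σ := σ) (R := ℂ) c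
      rw [MvPowerSeries.c_eq_algebraMap] at h
      exact h }

@[simp] theorem evalZero_X (i : σ) : evalZero σ (X i) = 0 := MvPowerSeries.constantCoeff_X i

theorem mem_maximalIdeal_iff_evalZero [Finite σ] {p : ConvSeries σ} :
    p ∈ maximalIdeal (ConvSeries σ) ↔ evalZero σ p = 0 := mem_maximalIdeal

theorem X_mem_maximalIdeal [Finite σ] (i : σ) : X i ∈ maximalIdeal (ConvSeries σ) :=
  mem_maximalIdeal_iff_evalZero.2 (evalZero_X i)

/-- The partial derivatives at the origin. -/
def linearPart (σ : Type) : ConvSeries σ →ₗ[ℂ] σ → ℂ :=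
  LinearMap.pi fun i => (evalZero σ).toLinearMap ∘ₗ (pderivation i).toLinearMap

theorem linearPart_apply (p : ConvSeries σ) (i : σ) :
    linearPart σ p i = evalZero σ (pderiv i p) := rfl

/-- The linear form with given coefficients. -/
def linearForm [Fintype σ] (w : σ → ℂ) : ConvSeries σ := ∑ i, w i • X i

theorem linearForm_mem [Fintype σ] (w : σ → ℂ) : linearForm w ∈ maximalIdeal (ConvSeries σ) := by
  rw [mem_maximalIdeal_iff_evalZero, linearForm, map_sum]
  simp

theorem linearPart_linearForm [Fintype σ] (w : σ → ℂ) : linearPart σ (linearForm w) = w := by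
  classical
  ext i
  rw [linearForm, map_sum]
  simp [linearPart_apply, pderiv_X, Finset.sum_apply, apply_ite (evalZero σ)]

theorem mem_sq_of_linearPart_eq_zero [Fintype σ] {p : ConvSeries σ}
    (hp : p ∈ maximalIdeal (ConvSeries σ)) (h : linearPart σ p = 0) :
    p ∈ maximalIdeal (ConvSeries σ) • maximalIdeal (ConvSeries σ) := by
  classical
  rw [maximalIdeal_eq_span_X, Ideal.mem_span_range_iff_exists_fun] at hp
  obtain ⟨c, rfl⟩ := hp
  refine sum_mem fun i _ => Submodule.smul_mem_smul ?_ (X_mem_maximalIdeal i)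
  have h1 := congrFun h i
  simp only [linearPart_apply, pderiv_sum, pderiv_mul, pderiv_X, map_sum, map_add, map_mul,
    evalZero_X, zero_mul, add_zero, apply_ite (evalZero σ), map_zero, mul_ite, mul_one,
    mul_zero, Finset.sum_ite_eq', Finset.mem_univ, if_true, Pi.zero_apply] at h1
  exact mem_maximalIdeal_iff_evalZero.2 h1

/-- Elements of the maximal ideal with the same linear part agree modulo its square, so Nakayama's
lemma applies. -/
theorem maximalIdeal_le_of_linearPart [Fintype σ] {I : Ideal (ConvSeries σ)}
    (h : ∀ w, ∃ p ∈ I, p ∈ maximalIdeal (ConvSeries σ) ∧ linearPart σ p = w) :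
    maximalIdeal (ConvSeries σ) ≤ I := by
  refine Submodule.le_of_le_smul_of_le_jacobson_bot (IsNoetherian.noetherian _)
    (maximalIdeal_le_jacobson _) fun p hp => ?_
  obtain ⟨q, hqI, hq, hpq⟩ := h (linearPart σ p)
  rw [← add_sub_cancel q p]
  exact add_mem (Ideal.mem_sup_left hqI) (Ideal.mem_sup_right
    (mem_sq_of_linearPart_eq_zero (sub_mem hp hq) (by rw [map_sub, hpq, sub_self])))

/-- Functions with linearly independent linear parts belong to a system of coordinates. -/
theorem exists_linearForms [Fintype σ] {L : Type} [Fintype L] (v : L → ConvSeries σ)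
    (hv : ∀ l, v l ∈ maximalIdeal (ConvSeries σ))
    (hli : LinearIndependent ℂ fun l => linearPart σ (v l)) {m : ℕ}
    (hm : Fintype.card σ = Fintype.card L + m) :
    ∃ ys : List (ConvSeries σ), ys.length = m ∧ (∀ y ∈ ys, y ∈ maximalIdeal (ConvSeries σ)) ∧
      maximalIdeal (ConvSeries σ) ≤ Ideal.span (Set.range v) ⊔ Ideal.ofList ys := by
  let V := Submodule.span ℂ (Set.range fun l => linearPart σ (v l))
  obtain ⟨W, hW⟩ := Submodule.exists_isCompl V
  have hdim : Module.finrank ℂ W = m := by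
    have h1 := Submodule.finrank_add_eq_of_isCompl hW
    rw [finrank_span_eq_card hli, Module.finrank_fintype_fun_eq_card, hm] at h1
    lia
  let b := Module.finBasisOfFinrankEq ℂ W hdim
  refine ⟨List.ofFn fun k => linearForm (b k : σ → ℂ), by simp, ?_, ?_⟩
  · intro y hy
    obtain ⟨k, rfl⟩ := (List.mem_ofFn' _ _).1 hy
    exact linearForm_mem _
  · refine maximalIdeal_le_of_linearPart fun w => ?_
    obtain ⟨w1, hw1, w2, hw2, rfl⟩ := Submodule.mem_sup.1
      (show w ∈ V ⊔ W by rw [hW.sup_eq_top]; trivial)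
    obtain ⟨c, rfl⟩ := (Submodule.mem_span_range_iff_exists_fun ℂ).1 hw1
    refine ⟨∑ l, c l • v l + linearForm w2, ?_, ?_, ?_⟩
    · refine add_mem (Ideal.mem_sup_left (sum_mem fun l _ => ?_)) (Ideal.mem_sup_right ?_)
      · exact Submodule.smul_of_tower_mem _ (c l) (Ideal.subset_span ⟨l, rfl⟩)
      · have h2 : linearForm w2 = ∑ k, b.repr ⟨w2, hw2⟩ k • linearForm (b k : σ → ℂ) := by
          have h3 := congrArg Subtype.val (b.sum_repr ⟨w2, hw2⟩)
          simp only [Submodule.coe_sum, Submodule.coe_smul] at h3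
          conv_lhs => rw [← h3]
          simp only [linearForm, Finset.sum_apply, Pi.smul_apply, Finset.sum_smul, Finset.smul_sum,
            smul_smul, smul_eq_mul]
          exact Finset.sum_comm
        rw [h2]
        exact sum_mem fun k _ => Submodule.smul_of_tower_mem _ _
          (Ideal.subset_span ((List.mem_ofFn' _ _).2 ⟨k, rfl⟩))
    · refine add_mem (sum_mem fun l _ => ?_) (linearForm_mem _)
      exact Submodule.smul_of_tower_mem _ (c l) (hv l)
    · rw [map_add, linearPart_linearForm, map_sum]
      simp only [map_smul]

/-! ### Regular sequences of convergent power series -/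

theorem isWeaklyRegular_map_X [Finite σ] {l : List σ} (hl : l.Nodup) :
    IsWeaklyRegular (ConvSeries σ) (l.map X) := by
  have hspan (l : List σ) : Ideal.ofList (l.map X) =
      Ideal.span (X '' {i | i ∈ l} : Set (ConvSeries σ)) := by
    rw [Ideal.ofList]
    congr 1
    ext p
    simp
  induction l using List.reverseRecOn with
  | nil => exact IsWeaklyRegular.nil _ _
  | append_singleton l i ih =>
    rw [List.nodup_append] at hl
    have hi : i ∉ l := fun h => hl.2.2 i h i (by simp) rfl
    rw [List.map_append, isWeaklyRegular_append_iff]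
    refine ⟨ih hl.1, ?_⟩
    rw [List.map_singleton, isWeaklyRegular_singleton_iff, isSMulRegular_quotient_ofList_iff, hspan]
    simp only [mem_span_X_iff]
    intro p hp α hα
    rw [← coeff_mul_X p i, mul_comm]
    refine hp _ fun j hj => ?_
    have hij : i ≠ j := fun h => hi (h ▸ hj)
    rw [Finsupp.add_apply, hα j hj, Finsupp.single_eq_of_ne (Ne.symm hij), add_zero]

theorem hasDepthSocle [Fintype σ] :
    HasDepthSocle (ConvSeries σ) (Fintype.card σ) (ConvSeries σ) := by
  have hspan : Ideal.ofList ((Finset.univ : Finset σ).toList.map X) =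
      maximalIdeal (ConvSeries σ) := by
    rw [maximalIdeal_eq_span_X, Ideal.ofList]
    congr 1
    ext p
    simp
  have h := hasDepthSocle_of_ofList_eq (isWeaklyRegular_map_X (Finset.nodup_toList _)) hspan
  rwa [List.length_map, Finset.length_toList] at h

/-- The ring of convergent power series is Gorenstein: systems of parameters are regular sequences
and their quotients have cyclic socles. -/
theorem isWeaklyRegular_of_le_radical [Fintype σ] {as : List (ConvSeries σ)}
    (hlen : as.length = Fintype.card σ) (has : ∀ a ∈ as, a ∈ maximalIdeal (ConvSeries σ))
    (hrad : maximalIdeal (ConvSeries σ) ≤ (Ideal.ofList as).radical) :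
    IsWeaklyRegular (ConvSeries σ) as ∧
      SocleIsCyclic (ConvSeries σ) (ConvSeries σ ⧸ Ideal.ofList as) :=
  HasDepthSocle.isWeaklyRegular_self (hlen ▸ hasDepthSocle) has hrad

end ConvSeries

namespace ConvSeries

open IsLocalRing RingTheory.Sequence

variable {ι κ : Type}

/-! ### The relative critical space of a deformation -/

/-- Pull-back of functions from the base. -/
instance baseAlgebra : Algebra (ConvSeries κ) (ConvSeries (ι ⊕ κ)) :=
  (rename (Function.Embedding.inr : κ ↪ ι ⊕ κ)).toRingHom.toAlgebra

theorem algebraMap_base (a : ConvSeries κ) :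
    algebraMap (ConvSeries κ) (ConvSeries (ι ⊕ κ)) a = rename .inr a := rfl

theorem smul_base (a : ConvSeries κ) (p : ConvSeries (ι ⊕ κ)) : a • p = rename .inr a * p := rfl

instance baseAlgebraQuotient (J : Ideal (ConvSeries (ι ⊕ κ))) :
    Algebra (ConvSeries κ) (ConvSeries (ι ⊕ κ) ⧸ J) := Ideal.Quotient.algebra _

instance baseModuleQuotient (J : Ideal (ConvSeries (ι ⊕ κ))) :
    Module (ConvSeries κ) (ConvSeries (ι ⊕ κ) ⧸ J) := (baseAlgebraQuotient J).toModule

instance baseSMulQuotient (J : Ideal (ConvSeries (ι ⊕ κ))) :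
    SMul (ConvSeries κ) (ConvSeries (ι ⊕ κ) ⧸ J) := (baseAlgebraQuotient J).toSMul

instance (J : Ideal (ConvSeries (ι ⊕ κ))) :
    IsScalarTower (ConvSeries κ) (ConvSeries (ι ⊕ κ)) (ConvSeries (ι ⊕ κ) ⧸ J) :=
  Ideal.Quotient.isScalarTower _ _ _

theorem smul_mk (J : Ideal (ConvSeries (ι ⊕ κ))) (a : ConvSeries κ) (p : ConvSeries (ι ⊕ κ)) :
    a • Ideal.Quotient.mk J p = Ideal.Quotient.mk J (rename .inr a * p) := rfl

/-- The ideal of the fibre over the origin. -/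
def fibreIdeal (ι κ : Type) : Ideal (ConvSeries (ι ⊕ κ)) :=
  Ideal.span (Set.range fun j : κ => X (.inr j))

/-- The ideal of the relative critical space. -/
def relIdeal (F : ConvSeries (ι ⊕ κ)) : Ideal (ConvSeries (ι ⊕ κ)) :=
  Ideal.span (Set.range fun i : ι => pderiv (.inl i) F)

theorem pderiv_mem_relIdeal (F : ConvSeries (ι ⊕ κ)) (i : ι) : pderiv (.inl i) F ∈ relIdeal F :=
  Ideal.subset_span ⟨i, rfl⟩

theorem criticalZeroIdeal_eq (F : ConvSeries (ι ⊕ κ)) :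
    criticalZeroIdeal F = relIdeal F ⊔ Ideal.span {F} := rfl

theorem relIdeal_le (F : ConvSeries (ι ⊕ κ)) : relIdeal F ≤ criticalZeroIdeal F := le_sup_left

theorem self_mem_criticalZeroIdeal (F : ConvSeries (ι ⊕ κ)) : F ∈ criticalZeroIdeal F :=
  Ideal.mem_sup_right (Ideal.mem_span_singleton_self F)

theorem sub_rename_restrict_mem [Finite ι] [Finite κ] (p : ConvSeries (ι ⊕ κ)) :
    p - rename .inl (restrict .inl p) ∈ fibreIdeal ι κ := by
  have h : fibreIdeal ι κ = Ideal.span (X '' Set.range (Sum.inr : κ → ι ⊕ κ)) := by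
    rw [← Set.range_comp]
    rfl
  rw [h, mem_span_X_iff]
  intro α hα
  obtain ⟨β, rfl⟩ := exists_embDomain_eq (Function.Embedding.inl : ι ↪ ι ⊕ κ) (α := α) (by
    rintro (i | j) hj
    · exact absurd ⟨i, rfl⟩ hj
    · exact hα _ ⟨j, rfl⟩)
  rw [map_sub, coeff_embDomain_rename, coeff_restrict, sub_self]

theorem restrict_inl_rename_inr (a : ConvSeries κ) :
    restrict (.inl : ι ↪ ι ⊕ κ) (rename .inr a) = algebraMap ℂ _ (evalZero κ a) := by
  classical
  refine ext_coeff fun α => ?_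
  rw [coeff_restrict]
  have h0 : algebraMap ℂ (ConvSeries ι) (evalZero κ a) = evalZero κ a • monomial 0 := by
    rw [Algebra.algebraMap_eq_smul_one]
    rfl
  rw [h0, map_smul]
  by_cases hα : α = 0
  · subst hα
    have h1 : Finsupp.embDomain (.inl : ι ↪ ι ⊕ κ) (0 : ι →₀ ℕ) =
        Finsupp.embDomain (.inr : κ ↪ ι ⊕ κ) (0 : κ →₀ ℕ) := by
      simp
    rw [h1, coeff_embDomain_rename]
    have h2 : coeff (0 : ι →₀ ℕ) (monomial (0 : ι →₀ ℕ)) = 1 := by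
      rw [coeff_apply]
      exact MvPowerSeries.coeff_monomial_same _ _
    rw [h2, smul_eq_mul, mul_one]
    rfl
  · obtain ⟨i, hi⟩ := Finsupp.ne_iff.1 hα
    rw [coeff_rename_eq_zero (.inr : κ ↪ ι ⊕ κ) a (j := .inl i) (by simp)
      (by rw [show (Sum.inl i : ι ⊕ κ) = (.inl : ι ↪ ι ⊕ κ) i from rfl,
        Finsupp.embDomain_apply_self]; exact hi)]
    have h2 : coeff α (monomial (0 : ι →₀ ℕ)) = 0 := by
      rw [coeff_apply]
      exact (MvPowerSeries.coeff_monomial_ne hα _)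
    rw [h2, smul_zero]

/-- The list of relative partial derivatives. -/
def relList [Fintype ι] (F : ConvSeries (ι ⊕ κ)) : List (ConvSeries (ι ⊕ κ)) :=
  (Finset.univ : Finset ι).toList.map fun i => pderiv (.inl i) F

theorem length_relList [Fintype ι] (F : ConvSeries (ι ⊕ κ)) :
    (relList F).length = Fintype.card ι := by
  rw [relList, List.length_map, Finset.length_toList, Finset.card_univ]

theorem mem_relList [Fintype ι] {F p : ConvSeries (ι ⊕ κ)} :
    p ∈ relList F ↔ ∃ i : ι, pderiv (.inl i) F = p := by
  simp [relList]

theorem ofList_relList [Fintype ι] (F : ConvSeries (ι ⊕ κ)) :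
    Ideal.ofList (relList F) = relIdeal F := by
  rw [Ideal.ofList, relIdeal]
  congr 1
  ext p
  exact mem_relList

/-- The coordinates of the base. -/
def baseList (κ : Type) [Fintype κ] : List (ConvSeries κ) :=
  (Finset.univ : Finset κ).toList.map X

theorem length_baseList [Fintype κ] : (baseList κ).length = Fintype.card κ := by
  rw [baseList, List.length_map, Finset.length_toList, Finset.card_univ]

theorem ofList_baseList [Fintype κ] : Ideal.ofList (baseList κ) = maximalIdeal (ConvSeries κ) := by
  rw [maximalIdeal_eq_span_X, Ideal.ofList]
  congr 1
  ext p
  simp [baseList]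

theorem map_maximalIdeal_base [Finite κ] :
    (maximalIdeal (ConvSeries κ)).map (algebraMap (ConvSeries κ) (ConvSeries (ι ⊕ κ))) =
      fibreIdeal ι κ := by
  rw [maximalIdeal_eq_span_X, Ideal.map_span, fibreIdeal, ← Set.range_comp]
  congr 2
  ext1 j
  simp [algebraMap_base, rename_X]

/-! ### Derivatives of the deformation and its fibre over the origin -/

section Deformation

variable [Fintype κ] (f : ConvSeries ι) (g : κ → ConvSeries ι)

theorem pderiv_inl_deformation (i : ι) : pderiv (.inl i) (deformation f g) =
    rename .inl (pderiv i f) + ∑ j, X (.inr j) * rename .inl (pderiv i (g j)) := by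
  classical
  rw [deformation, pderiv_add, pderiv_sum]
  congr 1
  · exact pderiv_rename (.inl : ι ↪ ι ⊕ κ) i f
  · refine Finset.sum_congr rfl fun j _ => ?_
    rw [pderiv_mul, pderiv_X, if_neg (by simp), mul_zero, add_zero]
    congr 1
    exact pderiv_rename (.inl : ι ↪ ι ⊕ κ) i (g j)

theorem pderiv_inr_deformation (j : κ) :
    pderiv (.inr j) (deformation f g) = rename .inl (g j) := by
  classical
  rw [deformation, pderiv_add, pderiv_sum, pderiv_rename_of_notMem _ (by simp), zero_add,
    Finset.sum_eq_single j]
  · rw [pderiv_mul, pderiv_rename_of_notMem _ (by simp), pderiv_X, if_pos rfl, mul_zero, zero_add,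
      mul_one]
  · intro k _ hk
    rw [pderiv_mul, pderiv_rename_of_notMem _ (by simp), pderiv_X, if_neg (by simpa using hk),
      mul_zero, zero_add, mul_zero]
  · simp

theorem restrict_deformation : restrict .inl (deformation f g) = f := by
  rw [deformation, map_add, map_sum, restrict_rename, Finset.sum_eq_zero, add_zero]
  intro j _
  rw [map_mul, restrict_X_of_notMem _ (by simp), zero_mul]

theorem restrict_pderiv_deformation (i : ι) :
    restrict .inl (pderiv (.inl i) (deformation f g)) = pderiv i f := by
  rw [pderiv_inl_deformation, map_add, map_sum, restrict_rename, Finset.sum_eq_zero, add_zero]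
  intro j _
  rw [map_mul, restrict_X_of_notMem _ (by simp), zero_mul]

theorem rename_mem_of_mem_jacobianIdeal {p : ConvSeries ι} (hp : p ∈ jacobianIdeal f) :
    rename .inl p ∈ relIdeal (deformation f g) ⊔ fibreIdeal ι κ := by
  suffices h : jacobianIdeal f ≤ (relIdeal (deformation f g) ⊔ fibreIdeal ι κ).comap
      (rename (.inl : ι ↪ ι ⊕ κ)) from h hp
  refine Ideal.span_le.2 ?_
  rintro _ ⟨i, rfl⟩
  change rename (Function.Embedding.inl : ι ↪ ι ⊕ κ) (pderiv i f) ∈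
    relIdeal (deformation f g) ⊔ fibreIdeal ι κ
  rw [← sub_eq_of_eq_add (pderiv_inl_deformation f g i)]
  refine sub_mem (Ideal.mem_sup_left (pderiv_mem_relIdeal _ i)) (Ideal.mem_sup_right ?_)
  exact sum_mem fun j _ => Ideal.mul_mem_right _ _ (Ideal.subset_span ⟨j, rfl⟩)

theorem restrict_mem_jacobianIdeal {p : ConvSeries (ι ⊕ κ)}
    (hp : p ∈ relIdeal (deformation f g)) : restrict .inl p ∈ jacobianIdeal f := by
  suffices h : relIdeal (deformation f g) ≤ (jacobianIdeal f).comap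
      (restrict (.inl : ι ↪ ι ⊕ κ)) from h hp
  refine Ideal.span_le.2 ?_
  rintro _ ⟨i, rfl⟩
  change restrict (Function.Embedding.inl : ι ↪ ι ⊕ κ) _ ∈ jacobianIdeal f
  rw [restrict_pderiv_deformation]
  exact Ideal.subset_span ⟨i, rfl⟩

/-- Restriction of functions on the relative critical space to the fibre over the origin. -/
def fibreRestrict : (ConvSeries (ι ⊕ κ) ⧸ relIdeal (deformation f g)) →+*
    (ConvSeries ι ⧸ jacobianIdeal f) :=
  Ideal.quotientMap _ (restrict (.inl : ι ↪ ι ⊕ κ)).toRingHom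
    fun _ hp => restrict_mem_jacobianIdeal f g hp

theorem fibreRestrict_mk (p : ConvSeries (ι ⊕ κ)) :
    fibreRestrict f g (Ideal.Quotient.mk _ p) = Ideal.Quotient.mk _ (restrict .inl p) := rfl

theorem fibreRestrict_smul (a : ConvSeries κ)
    (x : ConvSeries (ι ⊕ κ) ⧸ relIdeal (deformation f g)) :
    fibreRestrict f g (a • x) = evalZero κ a • fibreRestrict f g x := by
  obtain ⟨p, rfl⟩ := Ideal.Quotient.mk_surjective x
  rw [smul_mk, fibreRestrict_mk, fibreRestrict_mk, map_mul, map_mul, restrict_inl_rename_inr,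
    Algebra.smul_def]
  rfl

variable [Fintype ι]

theorem maximalIdeal_le_radical_rel_base {k : ℕ} (hk : maximalIdeal (ConvSeries ι) ^ k ≤ jacobianIdeal f) :
    maximalIdeal (ConvSeries (ι ⊕ κ)) ≤
    (relIdeal (deformation f g) ⊔ fibreIdeal ι κ).radical := by
  rw [maximalIdeal_eq_span_X]
  refine Ideal.span_le.2 ?_
  rintro _ ⟨i | j, rfl⟩
  · refine ⟨k, ?_⟩
    have h1 := rename_mem_of_mem_jacobianIdeal f g
      (hk (Ideal.pow_mem_pow (X_mem_maximalIdeal i) k))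
    rwa [map_pow, rename_X] at h1
  · exact Ideal.le_radical (Ideal.mem_sup_right (Ideal.subset_span ⟨j, rfl⟩))

/-- The coordinates of the base form a regular sequence on the relative critical space. -/
theorem isWeaklyRegular_baseList {k : ℕ} (hk : maximalIdeal (ConvSeries ι) ^ k ≤ jacobianIdeal f)
    (hJ : ∀ i, pderiv i f ∈ maximalIdeal (ConvSeries ι)) :
    IsWeaklyRegular (ConvSeries (ι ⊕ κ) ⧸ relIdeal (deformation f g)) (baseList κ) := by
  let us := (baseList κ).map (algebraMap (ConvSeries κ) (ConvSeries (ι ⊕ κ)))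
  have hus : Ideal.ofList us = fibreIdeal ι κ := by
    rw [← map_maximalIdeal_base, ← ofList_baseList, Ideal.map_ofList]
  -- The derivatives followed by the base coordinates are a system of parameters of ℂ{x,u}: modulo
  -- the latter, the former generate an ideal containing a power of the x-coordinates.
  have h1 := (isWeaklyRegular_of_le_radical (as := relList (deformation f g) ++ us) ?_ ?_ ?_).1
  · rw [isWeaklyRegular_append_iff] at h1
    rw [← isWeaklyRegular_map_algebraMap_iff (ConvSeries (ι ⊕ κ))]
    refine (LinearEquiv.isWeaklyRegular_congr (Submodule.quotEquivOfEq _ _ ?_) _).1 h1.2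
    rw [smul_eq_mul, Ideal.mul_top, ofList_relList]
  · rw [List.length_append, length_relList, List.length_map, length_baseList, Fintype.card_sum]
  · intro a ha
    rw [List.mem_append, mem_relList] at ha
    rcases ha with ⟨i, rfl⟩ | ha
    · have h2 := hJ i
      rw [← restrict_pderiv_deformation f g, mem_maximalIdeal_iff_evalZero] at h2
      rw [mem_maximalIdeal_iff_evalZero, ← h2]
      change coeff _ _ = coeff _ _
      rw [coeff_restrict]
      simp
    · obtain ⟨b, hb, rfl⟩ := List.mem_map.1 ha
      obtain ⟨j, -, rfl⟩ := List.mem_map.1 hb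
      rw [algebraMap_base, rename_X]
      exact X_mem_maximalIdeal _
  · rw [Ideal.ofList_append, ofList_relList, hus]
    exact maximalIdeal_le_radical_rel_base f g hk

/-- Over the origin the fibre is the jacobian algebra, in which all monomials of degree `k` vanish;
Weierstrass finiteness applies. -/
theorem finite_relativeCriticalRing {k : ℕ} (hk : maximalIdeal (ConvSeries ι) ^ k ≤ jacobianIdeal f) :
    Module.Finite (ConvSeries κ) (ConvSeries (ι ⊕ κ) ⧸ relIdeal (deformation f g)) := by
  obtain ⟨S, hS⟩ := exists_sum_sub_mem (I := relIdeal (deformation f g)) (k := k) fun α hα => by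
    refine rename_mem_of_mem_jacobianIdeal f g (hk ?_)
    rw [← hα]
    exact monomial_mem_pow X_mem_maximalIdeal α
  refine ⟨Submodule.fg_def.2 ⟨(fun β => Ideal.Quotient.mk (relIdeal (deformation f g))
    (rename .inl (monomial β))) '' S, S.finite_toSet.image _, eq_top_iff.2 fun x _ => ?_⟩⟩
  obtain ⟨q, rfl⟩ := Ideal.Quotient.mk_surjective x
  obtain ⟨c, hc⟩ := hS q
  rw [← Ideal.Quotient.eq] at hc
  rw [hc, map_sum]
  refine sum_mem fun β hβ => ?_
  rw [← smul_mk]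
  exact Submodule.smul_mem _ _ (Submodule.subset_span ⟨β, hβ, rfl⟩)

end Deformation

end ConvSeries

/-! ### Freeness of the relative critical ring and smoothness of the critical space -/

namespace ConvSeries

open IsLocalRing RingTheory.Sequence

variable {ι κ : Type}

theorem fibreIdeal_map_mk [Finite κ] (J : Ideal (ConvSeries (ι ⊕ κ))) {p : ConvSeries (ι ⊕ κ)}
    (hp : p ∈ fibreIdeal ι κ) : Ideal.Quotient.mk J p ∈
      (maximalIdeal (ConvSeries κ) • ⊤ : Submodule (ConvSeries κ) (ConvSeries (ι ⊕ κ) ⧸ J)) := by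
  rw [Ideal.smul_top_eq_map, Submodule.restrictScalars_mem,
    IsScalarTower.algebraMap_eq (ConvSeries κ) (ConvSeries (ι ⊕ κ)), ← Ideal.map_map,
    map_maximalIdeal_base]
  exact Ideal.mem_map_of_mem _ hp

theorem ofList_relList_append [Fintype ι] (F : ConvSeries (ι ⊕ κ)) :
    Ideal.ofList (relList F ++ [F]) = criticalZeroIdeal F := by
  rw [Ideal.ofList_append, ofList_relList, Ideal.ofList_singleton, criticalZeroIdeal_eq]

variable [Fintype κ] (f : ConvSeries ι) (g : κ → ConvSeries ι)

theorem pderiv_inl_pderiv_inr_deformation (i : ι) (j : κ) :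
    pderiv (.inr j) (pderiv (.inl i) (deformation f g)) = rename .inl (pderiv i (g j)) := by
  rw [pderiv_comm, pderiv_inr_deformation]
  exact pderiv_rename (.inl : ι ↪ ι ⊕ κ) i (g j)

variable [Fintype ι]

/-- Nakayama's lemma lifts generation from the special fibre, the jacobian algebra. -/
theorem span_relative_eq_top {k : ℕ} (hk : maximalIdeal (ConvSeries ι) ^ k ≤ jacobianIdeal f)
    (hspan : Submodule.span ℂ (Set.range fun j => Ideal.Quotient.mk f.jacobianIdeal (g j)) = ⊤) :
    Submodule.span (ConvSeries κ) (Set.range fun j =>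
      Ideal.Quotient.mk (relIdeal (deformation f g)) (rename .inl (g j))) = ⊤ := by
  have hfin := finite_relativeCriticalRing f g hk
  rw [eq_top_iff]
  refine Submodule.le_of_le_smul_of_le_jacobson_bot (I := maximalIdeal (ConvSeries κ))
    Module.Finite.fg_top (maximalIdeal_le_jacobson _) fun x _ => ?_
  obtain ⟨p, rfl⟩ := Ideal.Quotient.mk_surjective x
  have h1 : Ideal.Quotient.mk f.jacobianIdeal (restrict .inl p) ∈
      Submodule.span ℂ (Set.range fun j => Ideal.Quotient.mk f.jacobianIdeal (g j)) := by
    rw [hspan]; trivial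
  obtain ⟨c, hc⟩ := (Submodule.mem_span_range_iff_exists_fun ℂ).1 h1
  have h2 : restrict .inl p - ∑ j, algebraMap ℂ _ (c j) * g j ∈ f.jacobianIdeal := by
    rw [← Ideal.Quotient.eq, ← hc, map_sum]
    refine Finset.sum_congr rfl fun j _ => ?_
    rw [map_mul, Algebra.smul_def]
    rfl
  obtain ⟨a, ha, b, hb, hab⟩ := Submodule.mem_sup.1 (rename_mem_of_mem_jacobianIdeal f g h2)
  have h3 : p = (∑ j, rename .inl (algebraMap ℂ _ (c j) * g j)) + a +
      (b + (p - rename .inl (restrict .inl p))) := by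
    rw [map_sub, map_sum] at hab
    linear_combination -hab
  rw [h3, map_add, map_add, map_sum, Ideal.Quotient.eq_zero_iff_mem.2 ha, add_zero]
  refine add_mem (Submodule.mem_sup_left (sum_mem fun j _ => ?_)) (Submodule.mem_sup_right
    (fibreIdeal_map_mk _ (add_mem hb (sub_rename_restrict_mem p))))
  have h4 : Ideal.Quotient.mk (relIdeal (deformation f g)) (rename .inl
      (algebraMap ℂ (ConvSeries ι) (c j) * g j)) = (algebraMap ℂ (ConvSeries κ) (c j)) •
        Ideal.Quotient.mk (relIdeal (deformation f g)) (rename .inl (g j)) := by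
    rw [smul_mk, map_mul, AlgHom.commutes, AlgHom.commutes]
  rw [h4]
  exact Submodule.smul_mem _ _ (Submodule.subset_span ⟨j, rfl⟩)

-- The base coordinates are a regular sequence on the module, so independence may be checked modulo
-- them, that is, in the jacobian algebra.
set_option synthInstance.maxHeartbeats 100000 in
theorem linearIndependent_relative {k : ℕ}
    (hk : maximalIdeal (ConvSeries ι) ^ k ≤ jacobianIdeal f)
    (hJ : ∀ i, pderiv i f ∈ maximalIdeal (ConvSeries ι))
    (hli : LinearIndependent ℂ fun j => Ideal.Quotient.mk f.jacobianIdeal (g j)) :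
    LinearIndependent (ConvSeries κ) fun j =>
      Ideal.Quotient.mk (relIdeal (deformation f g)) (rename .inl (g j)) := by
  have hfin := finite_relativeCriticalRing f g hk
  refine linearIndependent_of_isWeaklyRegular _ (as := baseList κ) (fun a ha => ?_)
    (isWeaklyRegular_baseList f g hk hJ) fun c hc j => ?_
  · rw [← ofList_baseList]
    exact Ideal.subset_span ha
  · rw [ofList_baseList] at hc ⊢
    have h1 : ∀ x ∈ (maximalIdeal (ConvSeries κ) • ⊤ : Submodule (ConvSeries κ)
        (ConvSeries (ι ⊕ κ) ⧸ relIdeal (deformation f g))), fibreRestrict f g x = 0 := by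
      intro x hx
      refine Submodule.smul_induction_on hx (fun a ha y _ => ?_) (fun x y hx hy => ?_)
      · rw [fibreRestrict_smul, mem_maximalIdeal_iff_evalZero.1 ha, zero_smul]
      · rw [(fibreRestrict f g).map_add, hx, hy, add_zero]
    have h2 := h1 _ hc
    simp only [map_sum, fibreRestrict_smul, fibreRestrict_mk, restrict_rename] at h2
    exact mem_maximalIdeal_iff_evalZero.2 (Fintype.linearIndependent_iff.1 hli _ h2 j)

/-! ### Coordinates adapted to the critical space -/

theorem evalZero_restrict {σ τ : Type} (e : σ ↪ τ) (p : ConvSeries τ) :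
    evalZero σ (restrict e p) = evalZero τ p := by
  change coeff _ _ = coeff _ _
  rw [coeff_restrict]
  simp

theorem evalZero_rename {σ τ : Type} (e : σ ↪ τ) (p : ConvSeries σ) :
    evalZero τ (rename e p) = evalZero σ p := constCoeff_rename e p

/-- The equations of the critical space, indexed by the coordinates and one more element. -/
def criticalEquation (F : ConvSeries (ι ⊕ κ)) : Option ι → ConvSeries (ι ⊕ κ)
  | none => F
  | some i => pderiv (.inl i) F

/-- A dependence is a tangent vector `c` at the origin together with a coefficient of dF. The
u_j-component for g_j = 1 kills the latter. The x-components then put `c` in the kernel of the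
Hessian of `f`, and the other u_j-components say that `c` annihilates all g_j. -/
theorem linearIndependent_linearPart (hJ : ∀ i, pderiv i f ∈ maximalIdeal (ConvSeries ι))
    (hspan : Submodule.span ℂ (Set.range fun j => Ideal.Quotient.mk f.jacobianIdeal (g j)) = ⊤)
    {j₀ : κ} (hj₀ : g j₀ = 1) : LinearIndependent ℂ fun l =>
      linearPart (ι ⊕ κ) (criticalEquation (deformation f g) l) := by
  classical
  rw [Fintype.linearIndependent_iff]
  intro c hc
  rw [Fintype.sum_option] at hc
  have hinr (j : κ) : c none * evalZero ι (g j) +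
      ∑ i, c (some i) * evalZero ι (pderiv i (g j)) = 0 := by
    have h1 := congrFun hc (.inr j)
    simpa only [criticalEquation, Pi.add_apply, Pi.smul_apply, Finset.sum_apply, linearPart_apply,
      pderiv_inl_pderiv_inr_deformation, pderiv_inr_deformation, evalZero_rename, smul_eq_mul,
      Pi.zero_apply] using h1
  have hnone : c none = 0 := by
    have h1 := hinr j₀
    rw [hj₀] at h1
    have h2 (i : ι) : pderiv i (1 : ConvSeries ι) = 0 := (pderivation i).map_one_eq_zero
    simpa [h2] using h1
  have hinl (i' : ι) : ∑ i, c (some i) * evalZero ι (pderiv i (pderiv i' f)) = 0 := by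
    have h1 := congrFun hc (.inl i')
    simp only [criticalEquation, Pi.add_apply, Pi.smul_apply, Finset.sum_apply, linearPart_apply,
      smul_eq_mul, Pi.zero_apply, hnone, zero_mul, zero_add] at h1
    rw [← h1]
    refine Finset.sum_congr rfl fun i _ => ?_
    congr 1
    rw [pderiv_comm i i', ← restrict_pderiv_deformation f g i,
      ← evalZero_restrict (.inl : ι ↪ ι ⊕ κ) (pderiv (.inl i') (pderiv (.inl i) (deformation f g)))]
    rw [pderiv_inl_deformation, pderiv_add, pderiv_sum, map_add, map_add, map_sum, map_sum,
      show pderiv (.inl i') (rename (.inl : ι ↪ ι ⊕ κ) (pderiv i f)) =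
        rename .inl (pderiv i' (pderiv i f)) from pderiv_rename (.inl : ι ↪ ι ⊕ κ) i' _,
      restrict_rename, restrict_rename, Finset.sum_eq_zero, Finset.sum_eq_zero]
    · rw [add_zero, add_zero]
    · intro j _
      rw [pderiv_mul, pderiv_X, if_neg (by simp), mul_zero, add_zero, map_mul,
        restrict_X_of_notMem _ (by simp), zero_mul]
    · intro j _
      rw [map_mul, restrict_X_of_notMem _ (by simp), zero_mul]
  -- The derivation at the origin in the direction `c` kills the jacobian ideal by the Hessian
  -- condition and kills every g_j, so it kills everything, in particular the coordinates.
  let D : ConvSeries ι →ₗ[ℂ] ℂ :=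
    ∑ i, c (some i) • ((evalZero ι).toLinearMap ∘ₗ (pderivation i).toLinearMap)
  have hD (p : ConvSeries ι) : D p = ∑ i, c (some i) * evalZero ι (pderiv i p) := by
    simp only [D, LinearMap.sum_apply, LinearMap.smul_apply, smul_eq_mul]
    rfl
  have hDmul (p q : ConvSeries ι) :
      D (p * q) = evalZero ι p * D q + evalZero ι q * D p := by
    simp only [hD, pderiv_mul, map_add, map_mul, Finset.mul_sum, ← Finset.sum_add_distrib]
    exact Finset.sum_congr rfl fun i _ => by ring
  have hDJ (p : ConvSeries ι) (hp : p ∈ jacobianIdeal f) : D p = 0 := by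
    obtain ⟨a, rfl⟩ := Ideal.mem_span_range_iff_exists_fun.1 hp
    rw [map_sum]
    refine Finset.sum_eq_zero fun i _ => ?_
    rw [hDmul, hD (pderiv i f), hinl, mem_maximalIdeal_iff_evalZero.1 (hJ i), mul_zero, zero_mul,
      add_zero]
  have hD0 (p : ConvSeries ι) : D p = 0 := by
    have h1 : Ideal.Quotient.mk f.jacobianIdeal p ∈
        Submodule.span ℂ (Set.range fun j => Ideal.Quotient.mk f.jacobianIdeal (g j)) := by
      rw [hspan]; trivial
    obtain ⟨a, ha⟩ := (Submodule.mem_span_range_iff_exists_fun ℂ).1 h1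
    have h2 : p - ∑ j, a j • g j ∈ f.jacobianIdeal := by
      rw [← Ideal.Quotient.eq, ← ha, map_sum]
      rfl
    have h3 := hDJ _ h2
    rw [map_sub, map_sum, sub_eq_zero] at h3
    rw [h3]
    refine Finset.sum_eq_zero fun j _ => ?_
    rw [map_smul, hD, show ∑ i, c (some i) * evalZero ι (pderiv i (g j)) = 0 by
      simpa [hnone] using hinr j, smul_zero]
  intro l
  cases l with
  | none => exact hnone
  | some i =>
    have h1 := hD0 (X i)
    rw [hD] at h1
    simpa [pderiv_X, apply_ite (evalZero ι)] using h1

theorem criticalEquation_mem (hf : f ∈ maximalIdeal (ConvSeries ι))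
    (hJ : ∀ i, pderiv i f ∈ maximalIdeal (ConvSeries ι)) (l : Option ι) :
    criticalEquation (deformation f g) l ∈ maximalIdeal (ConvSeries (ι ⊕ κ)) := by
  rw [mem_maximalIdeal_iff_evalZero, ← evalZero_restrict (.inl : ι ↪ ι ⊕ κ)]
  cases l with
  | none =>
    rw [criticalEquation, restrict_deformation]
    exact mem_maximalIdeal_iff_evalZero.1 hf
  | some i =>
    rw [criticalEquation, restrict_pderiv_deformation]
    exact mem_maximalIdeal_iff_evalZero.1 (hJ i)

theorem mem_maximalIdeal_of_mem_relList_append (hf : f ∈ maximalIdeal (ConvSeries ι))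
    (hJ : ∀ i, pderiv i f ∈ maximalIdeal (ConvSeries ι)) {a : ConvSeries (ι ⊕ κ)}
    (ha : a ∈ relList (deformation f g) ++ [deformation f g]) :
    a ∈ maximalIdeal (ConvSeries (ι ⊕ κ)) := by
  rw [List.mem_append, mem_relList, List.mem_singleton] at ha
  rcases ha with ⟨i, rfl⟩ | rfl
  · exact criticalEquation_mem f g hf hJ (some i)
  · exact criticalEquation_mem f g hf hJ none

/-- The equations of the critical space are part of a system of coordinates. -/
theorem exists_coordinates (hf : f ∈ maximalIdeal (ConvSeries ι))
    (hJ : ∀ i, pderiv i f ∈ maximalIdeal (ConvSeries ι))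
    (hspan : Submodule.span ℂ (Set.range fun j => Ideal.Quotient.mk f.jacobianIdeal (g j)) = ⊤)
    {j₀ : κ} (hj₀ : g j₀ = 1) {m : ℕ} (hm : Fintype.card κ = m + 1) :
    ∃ ys : List (ConvSeries (ι ⊕ κ)), ys.length = m ∧
      (∀ y ∈ ys, y ∈ maximalIdeal (ConvSeries (ι ⊕ κ))) ∧
      Ideal.ofList (relList (deformation f g) ++ [deformation f g] ++ ys) =
        maximalIdeal (ConvSeries (ι ⊕ κ)) := by
  obtain ⟨ys, hlen, hys, hle⟩ := exists_linearForms _ (criticalEquation_mem f g hf hJ)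
    (linearIndependent_linearPart f g hJ hspan hj₀) (m := m) (by
      rw [Fintype.card_sum, Fintype.card_option, hm]; ring)
  refine ⟨ys, hlen, hys, le_antisymm (Ideal.span_le.2 fun a ha => ?_) (hle.trans ?_)⟩
  · rw [Set.mem_ofPred_eq, List.mem_append] at ha
    rcases ha with ha | ha
    exacts [mem_maximalIdeal_of_mem_relList_append f g hf hJ ha, hys a ha]
  · rw [Ideal.ofList_append]
    refine sup_le_sup_right (Ideal.span_le.2 ?_) _
    rintro _ ⟨_ | i, rfl⟩
    · exact Ideal.subset_span (by simp [criticalEquation])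
    · exact Ideal.subset_span (List.mem_append_left _ (mem_relList.2 ⟨i, rfl⟩))

theorem isWeaklyRegular_coordinates (hf : f ∈ maximalIdeal (ConvSeries ι))
    (hJ : ∀ i, pderiv i f ∈ maximalIdeal (ConvSeries ι)) {m : ℕ} (hm : Fintype.card κ = m + 1)
    {ys : List (ConvSeries (ι ⊕ κ))} (hlen : ys.length = m)
    (hys : ∀ y ∈ ys, y ∈ maximalIdeal (ConvSeries (ι ⊕ κ)))
    (hrad : maximalIdeal (ConvSeries (ι ⊕ κ)) ≤
      (Ideal.ofList (relList (deformation f g) ++ [deformation f g] ++ ys)).radical) :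
    IsWeaklyRegular (ConvSeries (ι ⊕ κ))
      (relList (deformation f g) ++ [deformation f g] ++ ys) := by
  refine (isWeaklyRegular_of_le_radical ?_ (fun a ha => ?_) hrad).1
  · rw [List.length_append, List.length_append, length_relList, List.length_singleton, hlen,
      Fintype.card_sum, hm]
    ring
  · rw [List.mem_append] at ha
    rcases ha with ha | ha
    exacts [mem_maximalIdeal_of_mem_relList_append f g hf hJ ha, hys a ha]

/-- The equations extend to generators of the maximal ideal, which is prime, and primality survives
dropping the complementary coordinates from the end of a regular sequence. -/
theorem isPrime_criticalZeroIdeal (hf : f ∈ maximalIdeal (ConvSeries ι))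
    (hJ : ∀ i, pderiv i f ∈ maximalIdeal (ConvSeries ι))
    (hspan : Submodule.span ℂ (Set.range fun j => Ideal.Quotient.mk f.jacobianIdeal (g j)) = ⊤)
    {j₀ : κ} (hj₀ : g j₀ = 1) : (criticalZeroIdeal (deformation f g)).IsPrime := by
  obtain ⟨m, hm⟩ : ∃ m, Fintype.card κ = m + 1 :=
    Nat.exists_eq_succ_of_ne_zero (Fintype.card_pos_iff.2 ⟨j₀⟩).ne'
  obtain ⟨ys, hlen, hys, h⟩ := exists_coordinates f g hf hJ hspan hj₀ hm
  rw [← ofList_relList_append]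
  refine isPrime_ofList_of_append hys (isWeaklyRegular_coordinates f g hf hJ hm hlen hys ?_) ?_
  · rw [h]; exact Ideal.le_radical
  · rw [h]; infer_instance

theorem mem_relIdeal_of_mul_mem (hf : f ∈ maximalIdeal (ConvSeries ι))
    (hJ : ∀ i, pderiv i f ∈ maximalIdeal (ConvSeries ι))
    (hspan : Submodule.span ℂ (Set.range fun j => Ideal.Quotient.mk f.jacobianIdeal (g j)) = ⊤)
    {j₀ : κ} (hj₀ : g j₀ = 1) {p : ConvSeries (ι ⊕ κ)}
    (hp : deformation f g * p ∈ relIdeal (deformation f g)) : p ∈ relIdeal (deformation f g) := by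
  obtain ⟨m, hm⟩ : ∃ m, Fintype.card κ = m + 1 :=
    Nat.exists_eq_succ_of_ne_zero (Fintype.card_pos_iff.2 ⟨j₀⟩).ne'
  obtain ⟨ys, hlen, hys, h⟩ := exists_coordinates f g hf hJ hspan hj₀ hm
  have h1 := isWeaklyRegular_coordinates f g hf hJ hm hlen hys (by rw [h]; exact Ideal.le_radical)
  rw [isWeaklyRegular_append_iff, isWeaklyRegular_append_iff, isWeaklyRegular_singleton_iff,
    isSMulRegular_quotient_ofList_iff, ofList_relList] at h1
  exact h1.1.2 p hp

end ConvSeries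

namespace ConvSeries

open IsLocalRing RingTheory.Sequence

variable {ι κ : Type}

/-! ### Functions vanishing on the discriminant -/

theorem mem_discriminantIdeal {F : ConvSeries (ι ⊕ κ)} {h : ConvSeries κ} :
    h ∈ discriminantIdeal F ↔ rename .inr h ∈ criticalZeroIdeal F :=
  Ideal.Quotient.eq_zero_iff_mem

/-- The partial derivatives along the fibres are linear over the base. -/
def relDerivation (i : ι) :
    Derivation (ConvSeries κ) (ConvSeries (ι ⊕ κ)) (ConvSeries (ι ⊕ κ)) :=
  Derivation.mk'
    { toFun := pderiv (.inl i)
      map_add' := pderiv_add _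
      map_smul' := fun a p => by
        rw [smul_base, pderiv_mul, pderiv_rename_of_notMem _ (by simp), mul_zero, add_zero]
        rfl }
    fun p q => pderiv_mul _ p q

theorem pderiv_inl_mem {F : ConvSeries (ι ⊕ κ)} (i : ι) : pderiv (.inl i) F ∈ criticalZeroIdeal F :=
  relIdeal_le F (pderiv_mem_relIdeal F i)

section Vanishing

variable [Fintype ι] {F : ConvSeries (ι ⊕ κ)}

theorem mem_criticalZeroIdeal_iff {p : ConvSeries (ι ⊕ κ)} : p ∈ criticalZeroIdeal F ↔
    ∃ (a : ι → ConvSeries (ι ⊕ κ)) (b : ConvSeries (ι ⊕ κ)),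
      p = ∑ i, a i * pderiv (.inl i) F + b * F := by
  rw [criticalZeroIdeal_eq, Submodule.mem_sup]
  constructor
  · rintro ⟨x, hx, y, hy, rfl⟩
    obtain ⟨a, rfl⟩ := Ideal.mem_span_range_iff_exists_fun.1 hx
    obtain ⟨b, rfl⟩ := Ideal.mem_span_singleton'.1 hy
    exact ⟨a, b, rfl⟩
  · rintro ⟨a, b, rfl⟩
    exact ⟨_, sum_mem fun i _ => Ideal.mul_mem_left _ _ (pderiv_mem_relIdeal F i), _,
      Ideal.mul_mem_left _ _ (Ideal.mem_span_singleton_self F), rfl⟩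

/-- The coefficients of the relative partial derivatives in the expression of a function on the
base which vanishes on the discriminant vanish on the critical space. -/
theorem mem_criticalZeroIdeal_of_rename_eq (hprime : (criticalZeroIdeal F).IsPrime)
    (hint : ∀ i, IsIntegral (ConvSeries κ) (Ideal.Quotient.mk (criticalZeroIdeal F) (X (.inl i))))
    {h : ConvSeries κ} {a : ι → ConvSeries (ι ⊕ κ)} {b : ConvSeries (ι ⊕ κ)}
    (hab : rename .inr h = ∑ i, a i * pderiv (.inl i) F + b * F) (k : ι) :
    a k ∈ criticalZeroIdeal F := by
  classical
  -- The vector field ∑ a_i ∂/∂x_i. It preserves the ideal of the critical space, its values on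
  -- ∂F/∂x_l being computed by differentiating `hab` along x_l, where the left side is constant.
  let D : Derivation (ConvSeries κ) (ConvSeries (ι ⊕ κ)) (ConvSeries (ι ⊕ κ)) :=
    ∑ i, a i • relDerivation i
  have hD (p : ConvSeries (ι ⊕ κ)) : D p = ∑ i, a i * pderiv (.inl i) p := by
    have h1 := congrFun (map_sum Derivation.coeFnAddMonoidHom (fun i => a i • relDerivation i)
      Finset.univ) p
    rw [Finset.sum_apply] at h1
    exact h1
  have hDF : D F ∈ criticalZeroIdeal F := by
    rw [hD]
    exact sum_mem fun i _ => Ideal.mul_mem_left _ _ (pderiv_inl_mem i)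
  have hDd (l : ι) : D (pderiv (.inl l) F) ∈ criticalZeroIdeal F := by
    have h1 := congrArg (pderiv (.inl l)) hab
    rw [pderiv_rename_of_notMem _ (by simp), pderiv_add, pderiv_sum] at h1
    simp only [pderiv_mul, Finset.sum_add_distrib] at h1
    have h2 : D (pderiv (.inl l) F) = -(∑ i, pderiv (.inl i) F * pderiv (.inl l) (a i) +
        (b * pderiv (.inl l) F + F * pderiv (.inl l) b)) := by
      rw [hD]
      simp only [pderiv_comm _ (.inl l : ι ⊕ κ)]
      linear_combination -h1
    rw [h2]
    exact neg_mem (add_mem (sum_mem fun i _ => Ideal.mul_mem_right _ _ (pderiv_inl_mem i))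
      (add_mem (Ideal.mul_mem_left _ _ (pderiv_inl_mem l))
        (Ideal.mul_mem_right _ _ (self_mem_criticalZeroIdeal F))))
  have hDI {p : ConvSeries (ι ⊕ κ)} (hp : p ∈ criticalZeroIdeal F) : D p ∈ criticalZeroIdeal F := by
    obtain ⟨c, e, rfl⟩ := mem_criticalZeroIdeal_iff.1 hp
    rw [map_add, map_sum, D.leibniz]
    refine add_mem (sum_mem fun i _ => ?_) (add_mem (Ideal.mul_mem_left _ _ hDF)
      (Ideal.mul_mem_right _ _ (self_mem_criticalZeroIdeal F)))
    rw [D.leibniz]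
    exact add_mem (Ideal.mul_mem_left _ _ (hDd i)) (Ideal.mul_mem_right _ _ (pderiv_inl_mem i))
  have hDX : D (X (.inl k)) = a k := by
    rw [hD]
    simp [pderiv_X]
  have : Nontrivial (ConvSeries (ι ⊕ κ) ⧸ criticalZeroIdeal F) :=
    Ideal.Quotient.nontrivial_iff.2 hprime.ne_top
  let P := minpoly (ConvSeries κ) (Ideal.Quotient.mk (criticalZeroIdeal F) (X (.inl k)))
  have haeval (Q : Polynomial (ConvSeries κ)) :
      Polynomial.aeval (Ideal.Quotient.mk (criticalZeroIdeal F) (X (.inl k))) Q =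
        Ideal.Quotient.mk (criticalZeroIdeal F) (Polynomial.aeval (X (.inl k)) Q) :=
    Polynomial.aeval_algHom_apply (Ideal.Quotient.mkₐ (ConvSeries κ) (criticalZeroIdeal F)) _ Q
  have hP : Polynomial.aeval (X (.inl k)) P ∈ criticalZeroIdeal F := by
    rw [← Ideal.Quotient.eq_zero_iff_mem, ← haeval]
    exact minpoly.aeval _ _
  have h3 := hDI hP
  rw [D.map_aeval, hDX, smul_eq_mul] at h3
  -- Applying `D` to P(x_k) = 0 gives P'(x_k) a_k = 0. The first factor cannot vanish, since P'
  -- divided by deg P is monic of smaller degree than the minimal polynomial.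
  refine (hprime.mem_or_mem h3).resolve_left fun h4 => ?_
  have hmonic : P.Monic := minpoly.monic (hint k)
  have hpos : 0 < P.natDegree := minpoly.natDegree_pos (hint k)
  have hc : (P.natDegree : ℂ) ≠ 0 := by exact_mod_cast hpos.ne'
  let Q := Polynomial.C (algebraMap ℂ (ConvSeries κ) (P.natDegree : ℂ)⁻¹) * P.derivative
  have hlead : P.derivative.coeff (P.natDegree - 1) =
      algebraMap ℂ (ConvSeries κ) (P.natDegree : ℂ) := by
    rw [Polynomial.coeff_derivative, Nat.sub_add_cancel hpos, hmonic.coeff_natDegree, one_mul,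
      map_natCast]
    have : (((P.natDegree - 1 : ℕ) : ConvSeries κ) + 1) = ((P.natDegree - 1 + 1 : ℕ) : _) := by
      push_cast; rfl
    rw [this, Nat.sub_add_cancel hpos]
  have hQdeg : Q.natDegree ≤ P.natDegree - 1 :=
    (Polynomial.natDegree_C_mul_le _ _).trans (Polynomial.natDegree_derivative_le P)
  have hQ : Q.Monic := by
    refine Polynomial.monic_of_natDegree_le_of_coeff_eq_one _ hQdeg ?_
    rw [Polynomial.coeff_C_mul, hlead, ← map_mul, inv_mul_cancel₀ hc, map_one]
  have hQ0 : Polynomial.aeval (Ideal.Quotient.mk (criticalZeroIdeal F) (X (.inl k))) Q = 0 := by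
    rw [map_mul, haeval P.derivative, Ideal.Quotient.eq_zero_iff_mem.2 h4, mul_zero]
  have h5 := Polynomial.natDegree_le_natDegree (minpoly.min _ _ hQ hQ0)
  change P.natDegree ≤ Q.natDegree at h5
  lia

/-- Differentiate h = ∑ a_i ∂F/∂x_i + bF along u_j; since the a_i vanish on the critical space, only
b ∂F/∂u_j remains there. -/
theorem exists_pderiv_sub_mem (hprime : (criticalZeroIdeal F).IsPrime)
    (hint : ∀ i, IsIntegral (ConvSeries κ) (Ideal.Quotient.mk (criticalZeroIdeal F) (X (.inl i))))
    {h : ConvSeries κ} (hh : h ∈ discriminantIdeal F) : ∃ b, ∀ j,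
      rename .inr (pderiv j h) - b * pderiv (.inr j) F ∈ criticalZeroIdeal F := by
  obtain ⟨a, b, hab⟩ := mem_criticalZeroIdeal_iff.1 (mem_discriminantIdeal.1 hh)
  have ha := mem_criticalZeroIdeal_of_rename_eq hprime hint hab
  refine ⟨b, fun j => ?_⟩
  have h1 : pderiv (.inr j) (rename .inr h) = rename .inr (pderiv j h) :=
    pderiv_rename (.inr : κ ↪ ι ⊕ κ) j h
  rw [← h1, hab, pderiv_add, pderiv_sum, pderiv_mul, add_comm (b * _), ← add_assoc,
    add_sub_cancel_right]
  refine add_mem (sum_mem fun i _ => ?_) (Ideal.mul_mem_right _ _ (self_mem_criticalZeroIdeal F))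
  rw [pderiv_mul]
  exact add_mem (Ideal.mul_mem_right _ _ (ha i)) (Ideal.mul_mem_right _ _ (pderiv_inl_mem i))

end Vanishing

/-- The constant coefficient of the minimal polynomial of `F` on the relative critical space
vanishes on D, being a multiple of `F` there. It is not zero, since otherwise the nonzerodivisor `F`
could be cancelled to lower the degree. -/
theorem discriminantIdeal_ne_bot {F : ConvSeries (ι ⊕ κ)}
    (hreg : ∀ p, F * p ∈ relIdeal F → p ∈ relIdeal F)
    (hint : IsIntegral (ConvSeries κ) (Ideal.Quotient.mk (relIdeal F) F)) :
    discriminantIdeal F ≠ ⊥ := by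
  let x := Ideal.Quotient.mk (relIdeal F) F
  let P := minpoly (ConvSeries κ) x
  have hmonic : P.Monic := minpoly.monic hint
  have h0 : Polynomial.aeval x P = 0 := minpoly.aeval _ _
  obtain ⟨q, hq⟩ := Ideal.Quotient.mk_surjective (Polynomial.aeval x P.divX)
  rw [← P.divX_mul_X_add, map_add, map_mul, Polynomial.aeval_X, Polynomial.aeval_C, ← hq] at h0
  have h1 : q * F + rename .inr (P.coeff 0) ∈ relIdeal F := Ideal.Quotient.eq_zero_iff_mem.1 h0
  have h2 : P.coeff 0 ≠ 0 := by
    intro h2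
    rw [h2, map_zero, add_zero, mul_comm] at h1
    have h3 := Ideal.Quotient.eq_zero_iff_mem.2 (hreg q h1)
    rw [hq] at h3
    have h4 : P.divX.Monic := by
      have h5 := hmonic
      rw [← P.divX_mul_X_add, h2, Polynomial.C_0, add_zero] at h5
      exact Polynomial.Monic.of_mul_monic_right Polynomial.monic_X h5
    exact absurd (minpoly.min _ _ h4 h3) (not_le.2 (Polynomial.degree_divX_lt hmonic.ne_zero))
  refine fun hbot => h2 ?_
  have h3 : P.coeff 0 ∈ discriminantIdeal F := by
    rw [mem_discriminantIdeal]
    have h4 := sub_mem (relIdeal_le F h1) (Ideal.mul_mem_left _ q (self_mem_criticalZeroIdeal F))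
    rwa [add_sub_cancel_left] at h4
  rwa [hbot] at h3

theorem discriminantIdeal_ne_top {F : ConvSeries (ι ⊕ κ)} (h : criticalZeroIdeal F ≠ ⊤) :
    discriminantIdeal F ≠ ⊤ := by
  rw [Ne, Ideal.eq_top_iff_one, mem_discriminantIdeal, map_one, ← Ideal.eq_top_iff_one]
  exact h

/-! ### Logarithmic vector fields and the conductor -/

section Conductor

variable [Fintype κ] {f : ConvSeries ι} {g : κ → ConvSeries ι}

/-- Functions on the critical space are generated by the `g j` over the base. -/
theorem exists_sub_sum_mem
    (hspan : Submodule.span (ConvSeries κ) (Set.range fun j =>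
      Ideal.Quotient.mk (relIdeal (deformation f g)) (rename .inl (g j))) = ⊤)
    (p : ConvSeries (ι ⊕ κ)) : ∃ a : κ → ConvSeries κ,
      p - ∑ j, rename .inr (a j) * rename .inl (g j) ∈ relIdeal (deformation f g) := by
  have h1 : Ideal.Quotient.mk (relIdeal (deformation f g)) p ∈
      Submodule.span (ConvSeries κ) (Set.range fun j =>
      Ideal.Quotient.mk (relIdeal (deformation f g)) (rename .inl (g j))) := by
    rw [hspan]; trivial
  obtain ⟨a, ha⟩ := (Submodule.mem_span_range_iff_exists_fun _).1 h1
  refine ⟨a, ?_⟩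
  rw [← Ideal.Quotient.eq, ← ha, map_sum]
  rfl

variable [Fintype ι]
  (hspan : Submodule.span (ConvSeries κ) (Set.range fun j =>
      Ideal.Quotient.mk (relIdeal (deformation f g)) (rename .inl (g j))) = ⊤)
  (hprime : (criticalZeroIdeal (deformation f g)).IsPrime)
  (hint : ∀ x : ConvSeries (ι ⊕ κ) ⧸ criticalZeroIdeal (deformation f g),
    IsIntegral (ConvSeries κ) x)
  (hint' : ∀ x : ConvSeries (ι ⊕ κ) ⧸ relIdeal (deformation f g), IsIntegral (ConvSeries κ) x)
  (hreg : ∀ p, deformation f g * p ∈ relIdeal (deformation f g) → p ∈ relIdeal (deformation f g))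

include hprime hint hint' hreg

/-- There is a function vanishing on the discriminant whose derivatives are, on the critical space,
those of the deformation up to a nonzero factor. -/
theorem exists_mem_discriminantIdeal : ∃ h ∈ discriminantIdeal (deformation f g), ∃ b,
    b ∉ criticalZeroIdeal (deformation f g) ∧ ∀ j,
      rename .inr (pderiv j h) - b * rename .inl (g j) ∈ criticalZeroIdeal (deformation f g) := by
  -- The ideal of D is proper and nonzero, so some derivative leaves it; a factor `b` vanishing on
  -- D̃ would keep all derivatives of `h` inside.
  obtain ⟨h, hh, j, hj⟩ := exists_pderiv_notMem (discriminantIdeal_ne_bot hreg (hint' _))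
    (discriminantIdeal_ne_top hprime.ne_top)
  obtain ⟨b, hb⟩ := exists_pderiv_sub_mem hprime (fun i => hint _) hh
  simp only [pderiv_inr_deformation] at hb
  refine ⟨h, hh, b, fun hb0 => hj ?_, hb⟩
  rw [mem_discriminantIdeal]
  have h1 := add_mem (hb j) (Ideal.mul_mem_right (rename .inl (g j)) _ hb0)
  rwa [sub_add_cancel] at h1

/-- The vector fields tangent to the discriminant. -/
theorem mem_logVectorFields_iff {a : κ → ConvSeries κ} :
    a ∈ logVectorFields (deformation f g) ↔
      ∑ j, rename .inr (a j) * rename .inl (g j) ∈ criticalZeroIdeal (deformation f g) := by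
  have key (h : ConvSeries κ) (b : ConvSeries (ι ⊕ κ)) (hb : ∀ j,
      rename .inr (pderiv j h) - b * rename .inl (g j) ∈ criticalZeroIdeal (deformation f g)) :
      ∑ j, a j * pderiv j h ∈ discriminantIdeal (deformation f g) ↔
        b * ∑ j, rename .inr (a j) * rename .inl (g j) ∈ criticalZeroIdeal (deformation f g) := by
    have h1 : rename .inr (∑ j, a j * pderiv j h) -
        b * ∑ j, rename .inr (a j) * rename .inl (g j) ∈ criticalZeroIdeal (deformation f g) := by
      rw [map_sum, Finset.mul_sum, ← Finset.sum_sub_distrib]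
      refine sum_mem fun j _ => ?_
      have h2 := Ideal.mul_mem_left _ (rename .inr (a j)) (hb j)
      rw [map_mul]
      convert h2 using 1
      ring
    rw [mem_discriminantIdeal]
    exact ⟨fun h2 => by simpa using sub_mem h2 h1, fun h2 => by simpa using add_mem h1 h2⟩
  constructor
  · intro ha
    obtain ⟨h, hh, b, hb0, hb⟩ := exists_mem_discriminantIdeal hprime hint hint' hreg
    exact (hprime.mem_or_mem ((key h b hb).1 (ha h hh))).resolve_left hb0
  · intro ha h hh
    obtain ⟨b, hb⟩ := exists_pderiv_sub_mem hprime (fun i => hint _) hh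
    simp only [pderiv_inr_deformation] at hb
    exact (key h b hb).2 (Ideal.mul_mem_left _ _ ha)

include hspan in
/-- The conductor is not zero. -/
theorem exists_mem_conductorIdeal :
    ∃ b ∈ conductorIdeal (DRing (deformation f g)) (DTildeRing (deformation f g)), b ≠ 0 := by
  obtain ⟨h, hh, b, hb0, hb⟩ := exists_mem_discriminantIdeal hprime hint hint' hreg
  refine ⟨Ideal.Quotient.mk (criticalZeroIdeal (deformation f g)) b, fun c => ?_,
    fun h0 => hb0 (Ideal.Quotient.eq_zero_iff_mem.1 h0)⟩
  obtain ⟨p, rfl⟩ := Ideal.Quotient.mk_surjective (I := criticalZeroIdeal (deformation f g)) c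
  obtain ⟨a, ha⟩ := exists_sub_sum_mem hspan p
  -- If p ≡ ∑ a_j g_j then b p ≡ ∑ a_j ∂h/∂u_j, a function on the base.
  refine ⟨Ideal.Quotient.mk (discriminantIdeal (deformation f g)) (∑ j, a j * pderiv j h), ?_⟩
  change Ideal.Quotient.mk (criticalZeroIdeal (deformation f g)) (rename .inr _) =
    Ideal.Quotient.mk (criticalZeroIdeal (deformation f g)) (b * p)
  rw [Ideal.Quotient.eq, map_sum]
  have h1 : ∑ j, rename .inr (a j * pderiv j h) - b * p =
      ∑ j, rename .inr (a j) * (rename .inr (pderiv j h) - b * rename .inl (g j)) -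
        b * (p - ∑ j, rename .inr (a j) * rename .inl (g j)) := by
    simp only [map_mul, mul_sub, Finset.sum_sub_distrib, Finset.mul_sum]
    have : ∑ j, b * (rename .inr (a j) * rename .inl (g j)) =
        ∑ j, rename (.inr : κ ↪ ι ⊕ κ) (a j) * (b * rename .inl (g j)) :=
      Finset.sum_congr rfl fun j _ => by ring
    rw [this]
    ring
  rw [h1]
  exact sub_mem (sum_mem fun j _ => Ideal.mul_mem_left _ _ (hb j))
    (Ideal.mul_mem_left _ _ (relIdeal_le _ ha))

end Conductor

end ConvSeries

/-! ### Symmetric matrices of multiplication maps -/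

section SymmetricMultiplication

variable {K A C Q κ : Type} [Field K] [CommRing A] [Algebra K A] [CommRing C] [Algebra A C]
  [CommRing Q] [Algebra K Q] [Fintype κ] [DecidableEq κ]

/-- Multiplication by an element of a free algebra is given by a symmetric matrix with respect to
suitable bases if the special fibre of the algebra is a Frobenius algebra. -/
theorem exists_isSymm_matrix (b : Module.Basis κ A C) (F : C) (hF : ∀ x, F * x = 0 → x = 0)
    (ε : A →ₐ[K] K) (hε : ∀ a, ε a ≠ 0 → IsUnit a) (ρ : C →+* Q)
    (hρ : ∀ (a : A) x, ρ (a • x) = ε a • ρ x) (hli : LinearIndependent K fun j => ρ (b j))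
    (hspan : Submodule.span K (Set.range fun j => ρ (b j)) = ⊤) (l : Q →ₗ[K] K)
    (hl : ∀ x, (∀ y, l (x * y) = 0) → x = 0) :
    ∃ χ : Matrix κ κ A, χ.IsSymm ∧ LinearIndependent A χ.row ∧
      ∀ a : κ → A, a ∈ Submodule.span A (Set.range χ.row) ↔ ∃ x, ∑ j, a j • b j = F * x := by
  -- The lift of `l` to `C`; its bilinear form t(xy) has Gram matrix `G`, invertible because it is
  -- so over the residue field.
  let t : C →ₗ[A] A := b.constr A fun j => algebraMap K A (l (ρ (b j)))
  have ht (x : C) : ε (t x) = l (ρ x) := by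
    conv_rhs => rw [← b.sum_repr x]
    rw [Module.Basis.constr_apply_fintype, map_sum, map_sum, map_sum]
    refine Finset.sum_congr rfl fun j _ => ?_
    rw [hρ, map_smul l, smul_eq_mul, smul_eq_mul, map_mul, AlgHom.commutes, b.equivFun_apply]
    rfl
  let G : Matrix κ κ A := Matrix.of fun i j => t (b i * b j)
  have hGsymm : G.transpose = G := by
    ext i j
    simp only [G, Matrix.transpose_apply, Matrix.of_apply, mul_comm]
  have hG : IsUnit G.det := by
    refine hε _ fun h0 => ?_
    have h1 : (ε.toRingHom.mapMatrix G).det = 0 := by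
      rw [← RingHom.map_det]
      exact h0
    obtain ⟨v, hv, hv0⟩ := Matrix.exists_vecMul_eq_zero_iff.2 h1
    refine hv (funext fun j => Fintype.linearIndependent_iff.1 hli v (hl _ fun y => ?_) j)
    have hy : y ∈ Submodule.span K (Set.range fun j => ρ (b j)) := by rw [hspan]; trivial
    obtain ⟨c, rfl⟩ := (Submodule.mem_span_range_iff_exists_fun K).1 hy
    rw [Finset.mul_sum, map_sum]
    refine Finset.sum_eq_zero fun k _ => ?_
    rw [mul_smul_comm, map_smul, Finset.sum_mul, map_sum]
    have h2 := congrFun hv0 k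
    simp only [Matrix.vecMul, dotProduct, Pi.zero_apply] at h2
    rw [show ∑ i, l (v i • ρ (b i) * ρ (b k)) = 0 from h2 ▸ Finset.sum_congr rfl fun i _ => ?_,
      smul_zero]
    rw [smul_mul_assoc, map_smul, ← map_mul, ← ht]
    rfl
  let n : Matrix κ κ A := Matrix.of fun i k => b.repr (F * b i) k
  have hn (c : κ → A) : ∑ k, Matrix.vecMul c n k • b k = F * ∑ i, c i • b i := by
    simp only [Matrix.vecMul, dotProduct, Finset.sum_smul, Finset.mul_sum]
    rw [Finset.sum_comm]
    refine Finset.sum_congr rfl fun i _ => ?_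
    conv_rhs => rw [mul_smul_comm, ← b.sum_repr (F * b i), Finset.smul_sum]
    refine Finset.sum_congr rfl fun k _ => ?_
    rw [mul_smul]
    rfl
  have hnG : (n * G).transpose = n * G := by
    have h1 (i j : κ) : (n * G) i j = t (F * b i * b j) := by
      conv_rhs => rw [← b.sum_repr (F * b i), Finset.sum_mul, map_sum]
      refine Finset.sum_congr rfl fun k _ => ?_
      rw [smul_mul_assoc, map_smul]
      rfl
    ext i j
    rw [Matrix.transpose_apply, h1, h1]
    congr 1
    ring
  have hvec (c : κ → A) : Matrix.vecMul (Matrix.vecMul c G⁻¹) n = Matrix.vecMul c (G⁻¹ * n) :=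
    Matrix.vecMul_vecMul _ _ _
  have hcomb {a : κ → A} (h : ∑ j, a j • b j = 0) : a = 0 :=
    funext (Fintype.linearIndependent_iff.1 b.linearIndependent a h)
  -- The matrix n G has entries t(F b_i b_j) and is symmetric, hence so is G⁻¹ n = G⁻¹ (n G) G⁻¹. As
  -- `G` is invertible, the row span is that of `n`, the image of multiplication by `F`.
  refine ⟨G⁻¹ * n, ?_, ?_, fun a => ?_⟩
  · rw [Matrix.transpose_mul, hGsymm] at hnG
    rw [Matrix.IsSymm, Matrix.transpose_mul, Matrix.transpose_nonsing_inv, hGsymm]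
    calc n.transpose * G⁻¹ = G⁻¹ * (G * n.transpose) * G⁻¹ := by
          rw [Matrix.nonsing_inv_mul_cancel_left _ _ hG]
      _ = G⁻¹ * n := by
          rw [hnG, Matrix.mul_assoc, Matrix.mul_assoc, Matrix.mul_nonsing_inv _ hG, Matrix.mul_one]
  · rw [← Matrix.vecMul_injective_iff, ← Matrix.coe_vecMulLinear,
      injective_iff_map_eq_zero]
    intro c hc
    rw [Matrix.vecMulLinear_apply, ← hvec] at hc
    have h1 := hn (Matrix.vecMul c G⁻¹)
    rw [hc] at h1
    simp only [Pi.zero_apply, zero_smul, Finset.sum_const_zero] at h1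
    have h2 := congrArg (fun v => Matrix.vecMul v G) (hcomb (hF _ h1.symm))
    simpa [Matrix.vecMul_vecMul, Matrix.nonsing_inv_mul _ hG] using h2
  · rw [← range_vecMulLinear]
    constructor
    · rintro ⟨c, rfl⟩
      exact ⟨_, by rw [Matrix.vecMulLinear_apply, ← hvec]; exact hn _⟩
    · rintro ⟨x, hx⟩
      refine ⟨Matrix.vecMul (b.repr x) G, ?_⟩
      rw [Matrix.vecMulLinear_apply, Matrix.vecMul_vecMul, ← Matrix.mul_assoc,
        Matrix.mul_nonsing_inv _ hG, Matrix.one_mul]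
      have h1 := hn (b.repr x)
      rw [b.sum_repr, ← hx, ← sub_eq_zero, ← Finset.sum_sub_distrib] at h1
      simp only [← sub_smul] at h1
      exact sub_eq_zero.1 (hcomb h1)

end SymmetricMultiplication

section QuotientParameters

open IsLocalRing RingTheory.Sequence

/-- If all systems of parameters containing `bs` are regular sequences then all systems of
parameters of the quotient by `bs` are regular sequences. -/
theorem isWeaklyRegular_quotient_of_le_radical {P : Type} [CommRing P] [IsLocalRing P] {I : Ideal P}
    [IsLocalRing (P ⧸ I)] {bs : List P} (hI : Ideal.ofList bs = I) {k : ℕ}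
    (h : ∀ as : List P, as.length = k → (∀ a ∈ as, a ∈ maximalIdeal P) →
      maximalIdeal P ≤ (Ideal.ofList (bs ++ as)).radical → IsWeaklyRegular P (bs ++ as))
    (as : List (P ⧸ I)) (hlen : as.length = k) (has : ∀ a ∈ as, a ∈ maximalIdeal (P ⧸ I))
    (hrad : maximalIdeal (P ⧸ I) ≤ (Ideal.ofList as).radical) : IsWeaklyRegular (P ⧸ I) as := by
  obtain ⟨as, rfl⟩ := List.map_surjective_iff.2 (Ideal.Quotient.mk_surjective (I := I)) as
  have h1 : IsWeaklyRegular P (bs ++ as) := by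
    refine h as (by simpa using hlen) (fun a ha hu => ?_) fun x hx => ?_
    · exact has _ (List.mem_map.2 ⟨a, ha, rfl⟩) (hu.map _)
    · have h2 : Ideal.Quotient.mk I x ∈ maximalIdeal (P ⧸ I) := by
        intro hu
        have := IsLocalHom.of_surjective (Ideal.Quotient.mk I) Ideal.Quotient.mk_surjective
        exact hx (isUnit_of_map_unit (Ideal.Quotient.mk I) _ hu)
      obtain ⟨e, he⟩ := hrad h2
      rw [← map_pow, ← Ideal.map_ofList,
        Ideal.mem_map_iff_of_surjective _ Ideal.Quotient.mk_surjective] at he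
      obtain ⟨y, hy, hyx⟩ := he
      refine ⟨e, ?_⟩
      rw [Ideal.ofList_append, hI]
      rw [Ideal.Quotient.eq] at hyx
      have h3 := sub_mem (Ideal.mem_sup_right hy : y ∈ I ⊔ Ideal.ofList as)
        (Ideal.mem_sup_left hyx)
      rwa [sub_sub_cancel] at h3
  rw [isWeaklyRegular_append_iff] at h1
  refine (isWeaklyRegular_map_algebraMap_iff (P ⧸ I) (P ⧸ I) as).2 ?_
  refine (LinearEquiv.isWeaklyRegular_congr (Submodule.quotEquivOfEq _ _ ?_) _).1 h1.2
  rw [smul_eq_mul, Ideal.mul_top, hI]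

end QuotientParameters

namespace ConvSeries

open IsLocalRing RingTheory.Sequence

variable {ι κ : Type}

/-! ### The rings of the discriminant and of its normalisation -/

/-- Restriction of functions to the discriminant. -/
def toDRing (F : ConvSeries (ι ⊕ κ)) : ConvSeries κ →+* DRing F :=
  Ideal.Quotient.mk (discriminantIdeal F)

/-- Restriction of functions to the critical space. -/
def toDTildeRing (F : ConvSeries (ι ⊕ κ)) : ConvSeries (ι ⊕ κ) →+* DTildeRing F :=
  Ideal.Quotient.mk (criticalZeroIdeal F)

theorem toDRing_surjective (F : ConvSeries (ι ⊕ κ)) : Function.Surjective (toDRing F) :=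
  Ideal.Quotient.mk_surjective

theorem toDTildeRing_surjective (F : ConvSeries (ι ⊕ κ)) : Function.Surjective (toDTildeRing F) :=
  Ideal.Quotient.mk_surjective

theorem toDTildeRing_eq_zero_iff {F p : ConvSeries (ι ⊕ κ)} :
    toDTildeRing F p = 0 ↔ p ∈ criticalZeroIdeal F := Ideal.Quotient.eq_zero_iff_mem

theorem toDTildeRing_eq_iff {F p q : ConvSeries (ι ⊕ κ)} :
    toDTildeRing F p = toDTildeRing F q ↔ p - q ∈ criticalZeroIdeal F := by
  rw [← sub_eq_zero, ← map_sub, toDTildeRing_eq_zero_iff]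

theorem algebraMap_toDRing (F : ConvSeries (ι ⊕ κ)) (a : ConvSeries κ) :
    algebraMap (DRing F) (DTildeRing F) (toDRing F a) = toDTildeRing F (rename .inr a) := rfl

theorem algebraMap_injective (F : ConvSeries (ι ⊕ κ)) :
    Function.Injective (algebraMap (DRing F) (DTildeRing F)) :=
  RingHom.kerLift_injective (pullbackToDTilde F)

/-- Relations between the g_j over O_D lift to relations over O_S, which are the logarithmic vector
fields and hence combinations of the rows of a Saito matrix. -/
theorem isSymmetricPresentation {m : ℕ} {f : ConvSeries ι} {g : Fin (m + 1) → ConvSeries ι}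
    (hlast : g (Fin.last m) = 1)
    (hspan : Submodule.span (ConvSeries (Fin (m + 1))) (Set.range fun j =>
      Ideal.Quotient.mk (relIdeal (deformation f g)) (rename .inl (g j))) = ⊤)
    (hlog : ∀ a, a ∈ logVectorFields (deformation f g) ↔
      ∑ j, rename .inr (a j) * rename .inl (g j) ∈ criticalZeroIdeal (deformation f g))
    {χ : Matrix (Fin (m + 1)) (Fin (m + 1)) (ConvSeries (Fin (m + 1)))}
    (hχ : IsSaitoMatrix (deformation f g) χ) (hsymm : χ.IsSymm) :
    IsSymmetricPresentation (fun j => toDTildeRing (deformation f g) (rename .inl (g j)))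
      (χ.map (toDRing (deformation f g))) := by
  have hsum (a : Fin (m + 1) → ConvSeries (Fin (m + 1))) :
      ∑ j, toDRing (deformation f g) (a j) • toDTildeRing (deformation f g) (rename .inl (g j)) =
        toDTildeRing (deformation f g) (∑ j, rename .inr (a j) * rename .inl (g j)) := by
    rw [map_sum]
    refine Finset.sum_congr rfl fun j _ => ?_
    rw [Algebra.smul_def, algebraMap_toDRing, map_mul]
  refine ⟨?_, ?_, fun b => ?_, fun i => ?_, fun a ha => ?_⟩
  · rw [Matrix.IsSymm, ← Matrix.transpose_map, hsymm]
  · simp only [hlast, map_one]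
  · obtain ⟨p, rfl⟩ := toDTildeRing_surjective _ b
    obtain ⟨a, ha⟩ := exists_sub_sum_mem hspan p
    refine ⟨fun j => toDRing _ (a j), ?_⟩
    rw [hsum, eq_comm, toDTildeRing_eq_iff]
    exact relIdeal_le _ ha
  · simp only [Matrix.map_apply]
    rw [hsum, toDTildeRing_eq_zero_iff, ← hlog, ← hχ.span_eq]
    exact Submodule.subset_span ⟨i, rfl⟩
  · choose a' ha' using fun j => toDRing_surjective _ (a j)
    obtain rfl : (fun j => toDRing _ (a' j)) = a := funext ha'
    rw [hsum, toDTildeRing_eq_zero_iff, ← hlog, ← hχ.span_eq] at ha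
    obtain ⟨c, hc⟩ := (Submodule.mem_span_range_iff_exists_fun _).1 ha
    refine ⟨fun i => toDRing _ (c i), fun j => ?_⟩
    simp only [Matrix.map_apply]
    rw [← hc, Finset.sum_apply, map_sum]
    exact Finset.sum_congr rfl fun i _ => map_mul _ _ _

theorem isLocalRing_dTildeRing [Finite ι] [Finite κ] {F : ConvSeries (ι ⊕ κ)}
    (hF : criticalZeroIdeal F ≠ ⊤) : IsLocalRing (DTildeRing F) := by
  have : Nontrivial (DTildeRing F) := Ideal.Quotient.nontrivial_iff.2 hF
  exact IsLocalRing.of_surjective' (toDTildeRing F) (toDTildeRing_surjective F)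

theorem isLocalHom_algebraMap [Finite ι] [Finite κ] {F : ConvSeries (ι ⊕ κ)}
    (hF : criticalZeroIdeal F ≠ ⊤) : IsLocalHom (algebraMap (DRing F) (DTildeRing F)) := by
  refine ⟨fun r hr => ?_⟩
  obtain ⟨a, rfl⟩ := toDRing_surjective F r
  rw [algebraMap_toDRing] at hr
  have : Nontrivial (DTildeRing F) := Ideal.Quotient.nontrivial_iff.2 hF
  have := IsLocalHom.of_surjective (toDTildeRing F) (toDTildeRing_surjective F)
  have h1 : IsUnit (rename (.inr : κ ↪ ι ⊕ κ) a) := isUnit_of_map_unit (toDTildeRing F) _ hr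
  rw [isUnit_iff, constCoeff_rename, ← isUnit_iff] at h1
  exact h1.map _

/-- The jacobian algebra of an isolated singularity has a cyclic socle. -/
theorem socleIsCyclic_jacobian [Fintype ι] {f : ConvSeries ι} {k : ℕ}
    (hk : maximalIdeal (ConvSeries ι) ^ k ≤ jacobianIdeal f)
    (hJ : ∀ i, pderiv i f ∈ maximalIdeal (ConvSeries ι)) :
    SocleIsCyclic (ConvSeries ι) (ConvSeries ι ⧸ jacobianIdeal f) := by
  let as := (Finset.univ : Finset ι).toList.map fun i => pderiv i f
  have has : Ideal.ofList as = jacobianIdeal f := by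
    rw [Ideal.ofList, jacobianIdeal]
    congr 1
    ext p
    simp [as]
  have h1 := (isWeaklyRegular_of_le_radical (as := as) (by simp [as]) (fun a ha => ?_) ?_).2
  · exact h1.congr (Submodule.quotEquivOfEq _ _ has)
  · obtain ⟨i, -, rfl⟩ := List.mem_map.1 ha
    exact hJ i
  · rw [has]
    exact fun x hx => ⟨k, hk (Ideal.pow_mem_pow hx k)⟩

/-- On the free module C, logarithmic vector fields are the coefficient vectors of multiples of `F`;
the Frobenius form on the jacobian algebra supplies the symmetric matrix. -/
theorem exists_isSaitoMatrix_isSymm [Fintype ι] [Fintype κ] [DecidableEq κ] {f : ConvSeries ι}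
    {g : κ → ConvSeries ι} {k : ℕ} (hk : maximalIdeal (ConvSeries ι) ^ k ≤ jacobianIdeal f)
    (hJ : ∀ i, pderiv i f ∈ maximalIdeal (ConvSeries ι))
    (hli : LinearIndependent ℂ fun j => Ideal.Quotient.mk f.jacobianIdeal (g j))
    (hspan : Submodule.span ℂ (Set.range fun j => Ideal.Quotient.mk f.jacobianIdeal (g j)) = ⊤)
    (hreg : ∀ p, deformation f g * p ∈ relIdeal (deformation f g) → p ∈ relIdeal (deformation f g))
    (hlog : ∀ a, a ∈ logVectorFields (deformation f g) ↔
      ∑ j, rename .inr (a j) * rename .inl (g j) ∈ criticalZeroIdeal (deformation f g)) :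
    ∃ χ : Matrix κ κ (ConvSeries κ), IsSaitoMatrix (deformation f g) χ ∧ χ.IsSymm := by
  let b := Module.Basis.mk (linearIndependent_relative f g hk hJ hli)
    (span_relative_eq_top f g hk hspan).ge
  have hb (j : κ) : b j = Ideal.Quotient.mk (relIdeal (deformation f g)) (rename .inl (g j)) :=
    Module.Basis.mk_apply _ _ j
  have hρb (j : κ) : fibreRestrict f g (b j) = Ideal.Quotient.mk f.jacobianIdeal (g j) := by
    rw [hb, fibreRestrict_mk, restrict_rename]
  obtain ⟨l, hl⟩ := exists_nondegenerate ℂ hk (socleIsCyclic_jacobian hk hJ)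
  obtain ⟨χ, hsymm, hind, hχ⟩ := exists_isSymm_matrix b
    (Ideal.Quotient.mk (relIdeal (deformation f g)) (deformation f g)) (fun x hx => by
      obtain ⟨p, rfl⟩ := Ideal.Quotient.mk_surjective x
      rw [← map_mul, Ideal.Quotient.eq_zero_iff_mem] at hx
      exact Ideal.Quotient.eq_zero_iff_mem.2 (hreg p hx))
    (evalZero κ) (fun a ha => isUnit_iff.2 ha) (fibreRestrict f g) (fibreRestrict_smul f g)
    (by simpa only [hρb] using hli) (by simpa only [hρb] using hspan) l hl
  refine ⟨χ, ⟨hind, Submodule.ext fun a => ?_⟩, hsymm⟩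
  rw [hχ, hlog, criticalZeroIdeal_eq]
  have hsum : ∑ j, a j • b j = Ideal.Quotient.mk (relIdeal (deformation f g))
      (∑ j, rename .inr (a j) * rename .inl (g j)) := by
    rw [map_sum]
    exact Finset.sum_congr rfl fun j _ => by rw [hb, smul_mk]
  rw [hsum]
  constructor
  · rintro ⟨x, hx⟩
    obtain ⟨p, rfl⟩ := Ideal.Quotient.mk_surjective x
    rw [← map_mul, Ideal.Quotient.eq] at hx
    have h1 := add_mem (Ideal.mem_sup_left hx : _ ∈ relIdeal (deformation f g) ⊔
      Ideal.span {deformation f g}) (Ideal.mem_sup_right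
        (Ideal.mul_mem_right p _ (Ideal.mem_span_singleton_self (deformation f g))))
    rwa [sub_add_cancel] at h1
  · intro h
    obtain ⟨x, hx, y, hy, hxy⟩ := Submodule.mem_sup.1 h
    obtain ⟨p, rfl⟩ := Ideal.mem_span_singleton'.1 hy
    refine ⟨Ideal.Quotient.mk _ p, ?_⟩
    rw [← hxy, map_add, Ideal.Quotient.eq_zero_iff_mem.2 hx, zero_add, mul_comm p, map_mul]

end ConvSeries

/-! ### Proof of the proposition -/

open ConvSeries IsLocalRing in
theorem proposition6p3 (n m : ℕ)
    (f : ConvSeries (Fin (n + 1))) (g : Fin (m + 1) → ConvSeries (Fin (n + 1)))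
    (hf : f.constCoeff = 0)
    (hli : LinearIndependent ℂ fun j => Ideal.Quotient.mk f.jacobianIdeal (g j))
    (hspan : Submodule.span ℂ (Set.range fun j => Ideal.Quotient.mk f.jacobianIdeal (g j)) = ⊤)
    (hlast : g (Fin.last m) = 1)
    (F : ConvSeries (Fin (n + 1) ⊕ Fin (m + 1))) (hF : F = deformation f g) :
    (∃ hC : Module.IsTorsionBySet (DTildeRing F) (SelfExt (DRing F) (DTildeRing F) 1)
        (conductorIdeal (DRing F) (DTildeRing F) : Set (DTildeRing F)),
      letI := hC.module
      IsMaximalCohenMacaulay (DTildeRing F ⧸ conductorIdeal (DRing F) (DTildeRing F))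
        (SelfExt (DRing F) (DTildeRing F) 1)) ∧
    (∃ χ : Matrix (Fin (m + 1)) (Fin (m + 1)) (ConvSeries (Fin (m + 1))),
      IsSaitoMatrix F χ ∧ χ.IsSymm) ∧
    ∀ χ : Matrix (Fin (m + 1)) (Fin (m + 1)) (ConvSeries (Fin (m + 1))),
      IsSaitoMatrix F χ → χ.IsSymm →
        Nonempty (SelfExt (DRing F) (DTildeRing F) 1 ≃ₗ[DTildeRing F]
          MatrixCokernel ((χ.submatrix Fin.castSucc Fin.castSucc).map (pullbackToDTilde F))) := by
  subst hF
  -- Here μ = m + 1 is positive: a basis vector is nonzero, so the jacobian algebra is nonzero and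
  -- the origin is a critical point. Isolatedness of the singularity enters as finite dimensionality
  -- of this algebra.
  have hJtop : jacobianIdeal f ≠ ⊤ := fun h => hli.ne_zero (Fin.last m)
    (Ideal.Quotient.eq_zero_iff_mem.2 (by rw [h]; trivial))
  have hJ (i) : pderiv i f ∈ maximalIdeal (ConvSeries (Fin (n + 1))) :=
    le_maximalIdeal hJtop (Ideal.subset_span ⟨i, rfl⟩)
  have hf' : f ∈ maximalIdeal (ConvSeries (Fin (n + 1))) := mem_maximalIdeal.2 hf
  have hfinQ : Module.Finite ℂ (ConvSeries (Fin (n + 1)) ⧸ jacobianIdeal f) :=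
    ⟨Submodule.fg_def.2 ⟨_, Set.finite_range _, hspan⟩⟩
  obtain ⟨k, hk⟩ := exists_pow_maximalIdeal_le ℂ (jacobianIdeal f)
  have hspanC := span_relative_eq_top f g hk hspan
  have hprime := isPrime_criticalZeroIdeal f g hf' hJ hspan hlast
  have hfinC := finite_relativeCriticalRing f g hk
  have hint' (x : ConvSeries (Fin (n + 1) ⊕ Fin (m + 1)) ⧸ relIdeal (deformation f g)) :
      IsIntegral (ConvSeries (Fin (m + 1))) x := Algebra.IsIntegral.isIntegral x
  have hint (x : ConvSeries (Fin (n + 1) ⊕ Fin (m + 1)) ⧸ criticalZeroIdeal (deformation f g)) :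
      IsIntegral (ConvSeries (Fin (m + 1))) x := by
    obtain ⟨p, rfl⟩ := Ideal.Quotient.mk_surjective x
    exact (hint' (Ideal.Quotient.mk _ p)).map
      (Ideal.Quotient.factorₐ (ConvSeries (Fin (m + 1))) (relIdeal_le (deformation f g)))
  have hreg (p) (hp : deformation f g * p ∈ relIdeal (deformation f g)) :
      p ∈ relIdeal (deformation f g) := mem_relIdeal_of_mul_mem f g hf' hJ hspan hlast hp
  have hlog (a : Fin (m + 1) → ConvSeries (Fin (m + 1))) := mem_logVectorFields_iff (a := a)
    hprime hint hint' hreg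
  obtain ⟨d, hd, hd0⟩ := exists_mem_conductorIdeal hspanC hprime hint hint' hreg
  have hdom : IsDomain (DTildeRing (deformation f g)) := Ideal.Quotient.isDomain _
  have hloc := isLocalRing_dTildeRing hprime.ne_top
  have hlochom := isLocalHom_algebraMap hprime.ne_top
  have hnoeth : IsNoetherianRing (DTildeRing (deformation f g)) :=
    isNoetherianRing_of_surjective _ _ (toDTildeRing (deformation f g)) (toDTildeRing_surjective _)
  have hpres {χ} (hχ : IsSaitoMatrix (deformation f g) χ) (hsymm : χ.IsSymm) :=
    isSymmetricPresentation hlast hspanC hlog hχ hsymm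
  have hequiv {χ} (hχ : IsSaitoMatrix (deformation f g) χ) (hsymm : χ.IsSymm) :=
    (hpres hχ hsymm).nonempty_selfExt_equiv (algebraMap_injective _) hd hd0
  have hex := exists_isSaitoMatrix_isSymm hk hJ hli hspan hreg hlog
  refine ⟨?_, hex, fun χ hχ hsymm => hequiv hχ hsymm⟩
  obtain ⟨χ, hχ, hsymm⟩ := hex
  have hpresχ := hpres hχ hsymm
  obtain ⟨e⟩ := hequiv hχ hsymm
  have hC := hpresχ.isTorsionBySet e
  refine ⟨hC, ?_⟩
  let := hC.module
  have htower : IsScalarTower (DTildeRing (deformation f g))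
      (DTildeRing (deformation f g) ⧸ conductorIdeal (DRing (deformation f g)) _)
      (SelfExt (DRing (deformation f g)) (DTildeRing (deformation f g)) 1) := hC.isScalarTower
  obtain ⟨ys, hlen, hys, hmax⟩ := exists_coordinates f g hf' hJ hspan hlast (m := m) (by simp)
  refine isMaximalCohenMacaulay_matrixCokernel (k := m) ?_ ?_ _ _ ?_ ?_ ?_ e
  -- The `m` complementary coordinates generate the maximal ideal of O_D̃.
  · refine le_of_le_of_eq (ringKrullDim_quotient_le_length hprime.ne_top hys ?_)
      (congrArg (Nat.cast : ℕ → WithBot ℕ∞) hlen)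
    rw [← ofList_relList_append, ← Ideal.ofList_append, hmax]
    exact Ideal.le_radical
  · have hloc' : IsLocalRing (ConvSeries (Fin (n + 1) ⊕ Fin (m + 1)) ⧸
        criticalZeroIdeal (deformation f g)) := hloc
    exact isWeaklyRegular_quotient_of_le_radical (ofList_relList_append _) fun as hl ha hr =>
      isWeaklyRegular_coordinates f g hf' hJ (by simp) hl ha hr
  · exact fun h => hd0 (by rwa [h] at hd)
  -- Determinants in Xχ̃ = d give det X · det χ̃ = d^m, which is nonzero.
  · obtain ⟨X, hX⟩ := hpresχ.exists_mul_reduced hd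
    intro h0
    have h1 := congrArg Matrix.det hX
    rw [Matrix.det_mul, h0, mul_zero, Matrix.scalar_apply, Matrix.det_diagonal,
      Finset.prod_const] at h1
    exact pow_ne_zero _ hd0 h1.symm
  · intro htop
    by_contra hu
    exact htop (hpresχ.conductorIdeal_eq_top_of_isUnit_det (not_not.1 hu))

end
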